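/- Let $\Omega\subset\mathbb R^3$ be a bounded open convex set, let $0\le\alpha<1/2$, $0\le\gamma\le 1$, $B_0>0$, and put $B(r,\theta)=B_0\,r^{\gamma}\sin\theta\cos\theta$. For functions $F,G$ on $\mathbb R^3$ let $$Q(F,G)(\zeta)=\int_{\mathbb R^3}\int_0^{2\pi}\int_0^{\pi/2}\bigl[F(\zeta')G(\zeta_*')-F(\zeta)G(\zeta_*)\bigr]\,B(|\zeta-\zeta_*|,\theta)\,d\theta\,d\phi\,d\zeta_*,$$ where $\zeta'=\zeta+((\zeta_*-\zeta)\cdot\omega)\,\omega$, $\zeta_*'=\zeta_*-((\zeta_*-\zeta)\cdot\omega)\,\omega$, and $\omega=\cos\theta\,\frac{\zeta_*-\zeta}{|\zeta_*-\zeta|}+\sin\theta\cos\phi\;e_2+\sin\theta\sin\phi\;e_3$; here $e_2,e_3$ are any functions of $\zeta_*-\zeta$ such that $\frac{\zeta_*-\zeta}{|\zeta_*-\zeta|},e_2,e_3$ is an orthonormal basis of $\mathbb R^3$ whenever $\zeta_*\ne\zeta$. Let $M(\zeta)=\pi^{-3/2}e^{-|\zeta|^2}$, $$Lh=M^{-1/2}\bigl(Q(M,M^{1/2}h)+Q(M^{1/2}h,M)\bigr),\qquad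 \nu(|\zeta|)=\int_{\mathbb R^3}\int_0^{2\pi}\int_0^{\pi/2}M(\zeta_*)\,B(|\zeta-\zeta_*|,\theta)\,d\theta\,d\phi\,d\zeta_*,$$ and let $K=L+\nu$ be the integral part of the linearized collision operator $L=-\nu+K$; it acts on functions $h(x,\zeta)$ in the variable $\zeta$, for each fixed $x$. For $x\in\Omega$ and $\zeta\neq0$ let $\tau_-(x,\zeta)=\inf\{s>0: x-s\zeta\notin\Omega\}$ and $$S_\Omega h(x,\zeta)=\int_0^{\tau_-(x,\zeta)}e^{-\nu(|\zeta|)s}\,h(x-s\zeta,\zeta)\,ds.$$ Let $L^\infty_\alpha(\Omega\times\mathbb R^3)$ be the space of (classes modulo null sets of) real measurable functions $f$ on $\Omega\times\mathbb R^3$ with $\|f\|_{L^\infty_\alpha}=\operatorname{ess\,sup}_{(x,\zeta)\in\Omega\times\mathbb R^3}|f(x,\zeta)|\,e^{\alpha|\zeta|^2}<\infty$. Then the formulas above define bounded linear operators $S_\Omega$ and $K$ on $L^\infty_\alpha(\Omega\times\mathbb R^3)$ (the resulting classes do not depend on the representative), and the operator $(S_\Omega K)^2=S_\Omega K S_\Omega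 K$ is compact on $L^\infty_\alpha(\Omega\times\mathbb R^3)$. -/

import Mathlib

open MeasureTheory
open scoped ENNReal

noncomputable section

namespace Boltzmann

/-- Three-dimensional Euclidean space, used both for positions and for velocities. -/
abbrev E3 : Type := EuclideanSpace ℝ (Fin 3)

/-! ### The collision operator and its linearization -/

/-- The global Maxwellian `M(ζ) = π^{-3/2} e^{-|ζ|²}`. -/
def maxwellian (ζ : E3) : ℝ := Real.pi ^ (-(3 / 2) : ℝ) * Real.exp (-‖ζ‖ ^ 2)

/-- The cross section `B(r, θ) = B₀ r^γ sin θ cos θ`. -/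
def crossSection (B₀ γ r θ : ℝ) : ℝ := B₀ * r ^ γ * Real.sin θ * Real.cos θ

/-- For every relative velocity `v ≠ 0`, the vectors `v / |v|`, `e₂ v`, `e₃ v` form an orthonormal
basis of `ℝ³`. -/
def IsCollisionFrame (e₂ e₃ : E3 → E3) : Prop :=
  ∀ v : E3, v ≠ 0 → Orthonormal ℝ ![‖v‖⁻¹ • v, e₂ v, e₃ v]

/-- `ω = cos θ v/|v| + sin θ cos φ e₂ + sin θ sin φ e₃`, where `v = ζ_* - ζ`. -/
def collisionDir (e₂ e₃ : E3 → E3) (v : E3) (θ φ : ℝ) : E3 :=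
  Real.cos θ • (‖v‖⁻¹ • v) + (Real.sin θ * Real.cos φ) • e₂ v + (Real.sin θ * Real.sin φ) • e₃ v

/-- The transferred velocity `((ζ_* - ζ) · ω) ω`. -/
def transfer (e₂ e₃ : E3 → E3) (ζ ζs : E3) (θ φ : ℝ) : E3 :=
  (inner ℝ (ζs - ζ) (collisionDir e₂ e₃ (ζs - ζ) θ φ)) • collisionDir e₂ e₃ (ζs - ζ) θ φ

/-- The collision operator
`Q(F, G)(ζ) = ∫_{ℝ³} ∫_0^{2π} ∫_0^{π/2} [F(ζ') G(ζ_*') - F(ζ) G(ζ_*)] B(|ζ - ζ_*|, θ) dθ dφ dζ_*`,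
with `ζ' = ζ + ((ζ_* - ζ) · ω) ω` and `ζ_*' = ζ_* - ((ζ_* - ζ) · ω) ω`. -/
def collisionQ (e₂ e₃ : E3 → E3) (B₀ γ : ℝ) (F G : E3 → ℝ) (ζ : E3) : ℝ :=
  ∫ ζs : E3, ∫ φ in (0 : ℝ)..(2 * Real.pi), ∫ θ in (0 : ℝ)..(Real.pi / 2),
    (F (ζ + transfer e₂ e₃ ζ ζs θ φ) * G (ζs - transfer e₂ e₃ ζ ζs θ φ) - F ζ * G ζs)
      * crossSection B₀ γ ‖ζ - ζs‖ θ

/-- The linearized operator `L h = M^{-1/2} (Q(M, M^{1/2} h) + Q(M^{1/2} h, M))`. -/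
def linearizedL (e₂ e₃ : E3 → E3) (B₀ γ : ℝ) (h : E3 → ℝ) (ζ : E3) : ℝ :=
  (Real.sqrt (maxwellian ζ))⁻¹ *
    (collisionQ e₂ e₃ B₀ γ maxwellian (fun η => Real.sqrt (maxwellian η) * h η) ζ
      + collisionQ e₂ e₃ B₀ γ (fun η => Real.sqrt (maxwellian η) * h η) maxwellian ζ)

/-- The collision frequency `ν(|ζ|) = ∫_{ℝ³} ∫_0^{2π} ∫_0^{π/2} M(ζ_*) B(|ζ - ζ_*|, θ) dθ dφ dζ_*`,
the multiplicative part of `-L`. -/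
def collisionFreq (B₀ γ : ℝ) (ζ : E3) : ℝ :=
  ∫ ζs : E3, ∫ _φ in (0 : ℝ)..(2 * Real.pi), ∫ θ in (0 : ℝ)..(Real.pi / 2),
    maxwellian ζs * crossSection B₀ γ ‖ζ - ζs‖ θ

/-- The integral part `K` of `L = -ν + K`, acting on functions of position and velocity. -/
def opK (e₂ e₃ : E3 → E3) (B₀ γ : ℝ) (f : E3 × E3 → ℝ) (p : E3 × E3) : ℝ :=
  linearizedL e₂ e₃ B₀ γ (fun η => f (p.1, η)) p.2 + collisionFreq B₀ γ p.2 * f p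

/-! ### The transport solution operator -/

/-- The backward exit time `τ_-(x, ζ) = inf {s > 0 | x - s ζ ∉ Ω}`. -/
def exitTime (Ω : Set E3) (x ζ : E3) : ℝ := sInf {s : ℝ | 0 < s ∧ x - s • ζ ∉ Ω}

/-- `S_Ω h(x, ζ) = ∫_0^{τ_-(x, ζ)} e^{-ν(|ζ|) s} h(x - s ζ, ζ) ds`. -/
def opS (Ω : Set E3) (B₀ γ : ℝ) (f : E3 × E3 → ℝ) (p : E3 × E3) : ℝ :=
  ∫ s in (0 : ℝ)..(exitTime Ω p.1 p.2),
    Real.exp (-(collisionFreq B₀ γ p.2) * s) * f (p.1 - s • p.2, p.2)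

/-! ### The weighted space `L^∞_α(Ω × ℝ³)` -/

/-- Lebesgue measure on `Ω × ℝ³`. -/
def phaseMeasure (Ω : Set E3) : Measure (E3 × E3) := (volume.restrict Ω).prod volume

/-- The weighted function `(x, ζ) ↦ e^{α |ζ|²} f(x, ζ)`. -/
def weighted (α : ℝ) (f : E3 × E3 → ℝ) (p : E3 × E3) : ℝ := Real.exp (α * ‖p.2‖ ^ 2) * f p

lemma weighted_add_ae {Ω : Set E3} (α : ℝ) (f g : (E3 × E3) →ₘ[phaseMeasure Ω] ℝ) :
    weighted α ⇑(f + g) =ᵐ[phaseMeasure Ω] weighted α f + weighted α g := by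
  filter_upwards [AEEqFun.coeFn_add f g] with p hp
  simp [weighted, hp, mul_add]

lemma weighted_smul_ae {Ω : Set E3} (α c : ℝ) (f : (E3 × E3) →ₘ[phaseMeasure Ω] ℝ) :
    weighted α ⇑(c • f) =ᵐ[phaseMeasure Ω] c • weighted α f := by
  filter_upwards [AEEqFun.coeFn_smul c f] with p hp
  simp [weighted, hp, mul_left_comm]

/-- The classes `f` of measurable functions on `Ω × ℝ³` modulo equality almost everywhere for which
`e^{α |ζ|²} f` is essentially bounded. -/
def weightedSubmodule (Ω : Set E3) (α : ℝ) :
    Submodule ℝ ((E3 × E3) →ₘ[phaseMeasure Ω] ℝ) where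
  carrier := {f | MemLp (weighted α f) ∞ (phaseMeasure Ω)}
  zero_mem' := by
    refine (MemLp.zero (ε := ℝ)).ae_eq ?_
    filter_upwards [AEEqFun.coeFn_zero (α := E3 × E3) (β := ℝ) (μ := phaseMeasure Ω)] with p hp
    simp [weighted, hp]
  add_mem' {f g} hf hg := (MemLp.add hf hg).ae_eq (weighted_add_ae α f g).symm
  smul_mem' c f hf := (MemLp.const_smul hf c).ae_eq (weighted_smul_ae α c f).symm

/-- The space `L^∞_α(Ω × ℝ³)`. -/
def LinftyW (Ω : Set E3) (α : ℝ) : Type := weightedSubmodule Ω α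

instance (Ω : Set E3) (α : ℝ) : AddCommGroup (LinftyW Ω α) :=
  inferInstanceAs (AddCommGroup (weightedSubmodule Ω α))

instance (Ω : Set E3) (α : ℝ) : Module ℝ (LinftyW Ω α) :=
  inferInstanceAs (Module ℝ (weightedSubmodule Ω α))

/-- The underlying class of measurable functions modulo equality almost everywhere. -/
def toClass {Ω : Set E3} {α : ℝ} : LinftyW Ω α →ₗ[ℝ] (E3 × E3) →ₘ[phaseMeasure Ω] ℝ :=
  (weightedSubmodule Ω α).subtype

lemma toClass_injective {Ω : Set E3} {α : ℝ} :
    Function.Injective (toClass : LinftyW Ω α → (E3 × E3) →ₘ[phaseMeasure Ω] ℝ) :=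
  Subtype.val_injective

lemma memLp_toClass {Ω : Set E3} {α : ℝ} (f : LinftyW Ω α) :
    MemLp (weighted α (toClass f)) ∞ (phaseMeasure Ω) := f.2

/-- Multiplication by the weight, `f ↦ e^{α |ζ|²} f`, from `L^∞_α(Ω × ℝ³)` to `L^∞(Ω × ℝ³)`. -/
def mulWeight (Ω : Set E3) (α : ℝ) : LinftyW Ω α →ₗ[ℝ] Lp ℝ ∞ (phaseMeasure Ω) where
  toFun f := MemLp.toLp (weighted α (toClass f)) (memLp_toClass f)
  map_add' f g := by
    rw [← MemLp.toLp_add]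
    refine MemLp.toLp_congr _ _ ?_
    rw [map_add]
    exact weighted_add_ae α _ _
  map_smul' c f := by
    rw [RingHom.id_apply, ← MemLp.toLp_const_smul]
    refine MemLp.toLp_congr _ _ ?_
    rw [map_smul]
    exact weighted_smul_ae α c _

lemma mulWeight_injective (Ω : Set E3) (α : ℝ) : Function.Injective (mulWeight Ω α) := by
  intro f g h
  have h1 := (MemLp.toLp_eq_toLp_iff (memLp_toClass f) (memLp_toClass g)).1 h
  refine toClass_injective (AEEqFun.ext ?_)
  filter_upwards [h1] with p hp
  exact mul_left_cancel₀ (Real.exp_pos _).ne' hp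

/-- The norm of `L^∞_α(Ω × ℝ³)` is `‖f‖ = ess sup |f(x, ζ)| e^{α |ζ|²}`. -/
instance (Ω : Set E3) (α : ℝ) : NormedAddCommGroup (LinftyW Ω α) :=
  NormedAddCommGroup.induced _ _ (mulWeight Ω α) (mulWeight_injective Ω α)

instance (Ω : Set E3) (α : ℝ) : NormedSpace ℝ (LinftyW Ω α) :=
  NormedSpace.induced ℝ _ _ (mulWeight Ω α)

lemma norm_linftyW {Ω : Set E3} {α : ℝ} (f : LinftyW Ω α) :
    ‖f‖ = (eLpNorm (weighted α (toClass f)) ∞ (phaseMeasure Ω)).toReal :=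
  Lp.norm_toLp (weighted α (toClass f)) (memLp_toClass f)

/-- The function `f` on phase space is a representative of the class `F`. -/
def Represents {Ω : Set E3} {α : ℝ} (f : E3 × E3 → ℝ) (F : LinftyW Ω α) : Prop :=
  f =ᵐ[phaseMeasure Ω] (toClass F : E3 × E3 → ℝ)

/-- The bounded operator `T` on `L^∞_α(Ω × ℝ³)` is given by the pointwise formula `A`: whichever
representative `f` of `F` is taken, `A f` is a representative of `T F`. -/
def IsGivenBy {Ω : Set E3} {α : ℝ} (T : LinftyW Ω α →L[ℝ] LinftyW Ω α)
    (A : (E3 × E3 → ℝ) → E3 × E3 → ℝ) : Prop :=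
  ∀ (F : LinftyW Ω α) (f : E3 × E3 → ℝ), Represents f F → Represents (A f) (T F)

end Boltzmann

end

/-!
# Compactness of `(S_Ω K)²` on `L^∞_α(Ω × ℝ³)`

Multiplication by the weight `e^{α |ζ|²}` is an isometry of `L^∞_α` onto `L^∞`, so that it suffices
to treat the conjugated operators on `L^∞(Ω × ℝ³)`. All operators that occur are of the form
`f ↦ ∫ ρ(z, y) f(T(z, y)) dy` (`kernelAverage`). Such a formula defines a bounded operator on classes
if it does not see null sets and `∫ |ρ(z, y)| dy` is bounded in `z` (`IsAdmissible`), and its norm is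
controlled by the norm of `ρ` in `L^∞_z L^1_y`.

*The kernel of `K`.* Carleman's change of variables (`map_collisionMap_collisionMeasure`) replaces
the integration over the relative velocity and the collision angles by one over `p = ζ' - ζ` and over
`q = ζ_*' - ζ` in the plane orthogonal to `p`. Exchanging `ζ'` and `ζ_*'` (`collisionQ_swap`) identifies
the two gain terms, one of the two loss terms cancels with `ν`, and conservation of energy shows that
`K`, conjugated by the weight, is an integral operator in the velocity with kernel `collisionKernel`
(`weighted_opK_eq`). The Gaussian factor in this kernel, together with `|p + q|^{γ - 1} ≤ |p|^{γ - 1}`,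
bounds it in `L^1_η` uniformly in `ζ`; by dominated convergence and continuity of translations
it depends on `ζ` continuously in `L^1_η`. This is where `α < 1/2` and `γ ≤ 1` are used. The
frame `e₂, e₃` need not be measurable, because the integral over `φ` is the same for every frame
(`collisionQ_frame`).

*The operator `S_Ω`.* By convexity the characteristic through `x` is in `Ω` exactly until the exit
time, so `S_Ω` is the average of `f(x - s ζ, ζ)` with the kernel `1_{x - s ζ ∈ Ω} e^{-ν s}`. It is
bounded as `ν` is bounded below by a positive constant (`collisionFreq_ge`). On velocities with
`|ζ| > R` its norm is `O(1 / R)`, since fast particles leave the bounded set `Ω` quickly.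

*Compactness* (`isCompactOperator_transport_velocity_sq`). By the last remark, `K` may be replaced
by its restriction to outgoing velocities `|ζ| ≤ R`. By continuity in `L^1_η` and compactness of the
ball this is a norm limit of finite sums of operators with kernels `a(ζ) b(η)`. It remains to see that
`T₁ S_Ω T₂` is compact for two such operators. There one averages in `(η, s)` a function `G(x - s η)` of
the position alone; the substitution `y = x - s η` turns this into a convolution in `x` with an integrable
function (`exists_density_of_ray_average`), which is compact on a bounded set because translations
are continuous in `L^1` (`isCompactOperator_translate_comp_product`).
-/

noncomputable section

namespace Boltzmann

/-! ### Integral operators on `L^∞` -/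

section IntegralOperators

variable {X Y : Type*} [MeasurableSpace X] [MeasurableSpace Y] {μ : Measure X} {m : Measure Y}

lemma ae_norm_le_norm_linfty (f : Lp ℝ ∞ μ) : ∀ᵐ x ∂μ, ‖f x‖ ≤ ‖f‖ := by
  have h1 : eLpNormEssSup f μ ≠ ∞ := by
    have := Lp.eLpNorm_ne_top f
    rwa [eLpNorm_exponent_top] at this
  filter_upwards [enorm_ae_le_eLpNormEssSup f μ] with x hx
  rw [Lp.norm_def, eLpNorm_exponent_top]
  rw [← toReal_enorm]
  exact ENNReal.toReal_mono h1 hx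

lemma norm_linfty_le {f : Lp ℝ ∞ μ} {C : ℝ} (hC : 0 ≤ C) (h : ∀ᵐ x ∂μ, ‖f x‖ ≤ C) : ‖f‖ ≤ C := by
  rw [Lp.norm_def, eLpNorm_exponent_top]
  refine ENNReal.toReal_le_of_le_ofReal hC ?_
  exact eLpNormEssSup_le_of_ae_bound h

/-- The formula `f ↦ (z ↦ ∫ ρ(z, y) f(T(z, y)) dm(y))`: multiplication by a kernel and integration
of `f` along a family of curves or surfaces parametrized by `y`. Transport along characteristics,
velocity averages and convolutions all have this form. -/
def kernelAverage (m : Measure Y) (T : X × Y → X) (ρ : X × Y → ℝ) (f : X → ℝ) (z : X) : ℝ :=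
  ∫ y, ρ (z, y) * f (T (z, y)) ∂m

/-- The conditions under which `kernelAverage m T ρ` defines a bounded operator on `L^∞(μ)`: it does
not see null sets, and the kernel has mass at most `C`. -/
structure IsAdmissible (μ : Measure X) (m : Measure Y) (T : X × Y → X) (ρ : X × Y → ℝ)
    (C : ℝ) : Prop where
  measurable_map : Measurable T
  measurable_kernel : Measurable ρ
  null : ∀ N, MeasurableSet N → μ N = 0 → ∀ᵐ z ∂μ, ∀ᵐ y ∂m, ρ (z, y) ≠ 0 → T (z, y) ∉ N
  nonneg : 0 ≤ C
  bound : ∀ᵐ z ∂μ, ∫⁻ y, ‖ρ (z, y)‖ₑ ∂m ≤ ENNReal.ofReal C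

namespace IsAdmissible

variable {T : X × Y → X} {ρ ρ' : X × Y → ℝ} {C C' : ℝ}

lemma ae_of_ae (h : IsAdmissible μ m T ρ C) {P : X → Prop} (hP : ∀ᵐ x ∂μ, P x) :
    ∀ᵐ z ∂μ, ∀ᵐ y ∂m, ρ (z, y) ≠ 0 → P (T (z, y)) := by
  obtain ⟨N, hN, hNm, hN0⟩ := exists_measurable_superset_of_null (ae_iff.1 hP)
  filter_upwards [h.null N hNm hN0] with z hz
  filter_upwards [hz] with y hy hne
  by_contra hcon
  exact hy hne (hN hcon)

lemma average_congr (h : IsAdmissible μ m T ρ C) {f g : X → ℝ} (hfg : f =ᵐ[μ] g) :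
    kernelAverage m T ρ f =ᵐ[μ] kernelAverage m T ρ g := by
  filter_upwards [h.ae_of_ae hfg] with z hz
  refine integral_congr_ae ?_
  filter_upwards [hz] with y hy
  by_cases h0 : ρ (z, y) = 0
  · simp [h0]
  · rw [hy h0]

lemma integrable_kernel (h : IsAdmissible μ m T ρ C) :
    ∀ᵐ z ∂μ, Integrable (fun y => ρ (z, y)) m := by
  filter_upwards [h.bound] with z hz
  refine ⟨(h.measurable_kernel.comp measurable_prodMk_left).aestronglyMeasurable, ?_⟩
  exact lt_of_le_of_lt hz ENNReal.ofReal_lt_top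

lemma integrable (h : IsAdmissible μ m T ρ C) (f : Lp ℝ ∞ μ) :
    ∀ᵐ z ∂μ, Integrable (fun y => ρ (z, y) * f (T (z, y))) m := by
  filter_upwards [h.integrable_kernel, h.ae_of_ae (ae_norm_le_norm_linfty f)] with z hz h1
  refine (hz.norm.mul_const ‖f‖).mono' ?_ ?_
  · refine (Measurable.mul ?_ ?_).aestronglyMeasurable
    · exact h.measurable_kernel.comp measurable_prodMk_left
    · exact (Lp.stronglyMeasurable f).measurable.comp
        (h.measurable_map.comp measurable_prodMk_left)
  · filter_upwards [h1] with y hy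
    rw [norm_mul]
    by_cases h0 : ρ (z, y) = 0
    · simp [h0]
    · exact mul_le_mul_of_nonneg_left (hy h0) (norm_nonneg _)

lemma norm_average_le (h : IsAdmissible μ m T ρ C) {f : X → ℝ} {c : ℝ} (hc : 0 ≤ c)
    (hf : ∀ᵐ x ∂μ, ‖f x‖ ≤ c) : ∀ᵐ z ∂μ, ‖kernelAverage m T ρ f z‖ ≤ C * c := by
  filter_upwards [h.bound, h.ae_of_ae hf] with z hz h1
  have h2 : ‖kernelAverage m T ρ f z‖ₑ ≤ ENNReal.ofReal (C * c) := by
    calc ‖kernelAverage m T ρ f z‖ₑ ≤ ∫⁻ y, ‖ρ (z, y) * f (T (z, y))‖ₑ ∂m :=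
          enorm_integral_le_lintegral_enorm _
      _ ≤ ∫⁻ y, ‖ρ (z, y)‖ₑ * ENNReal.ofReal c ∂m := by
          refine lintegral_mono_ae ?_
          filter_upwards [h1] with y hy
          rw [enorm_mul]
          by_cases h0 : ρ (z, y) = 0
          · simp [h0]
          · gcongr
            rw [← ofReal_norm]
            exact ENNReal.ofReal_le_ofReal (hy h0)
      _ = (∫⁻ y, ‖ρ (z, y)‖ₑ ∂m) * ENNReal.ofReal c :=
          lintegral_mul_const' _ _ ENNReal.ofReal_ne_top
      _ ≤ ENNReal.ofReal C * ENNReal.ofReal c := by gcongr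
      _ = ENNReal.ofReal (C * c) := (ENNReal.ofReal_mul h.nonneg).symm
  rw [← ofReal_norm] at h2
  exact (ENNReal.ofReal_le_ofReal_iff (mul_nonneg h.nonneg hc)).1 h2

variable [SFinite m]

lemma aestronglyMeasurable_average (h : IsAdmissible μ m T ρ C) (f : Lp ℝ ∞ μ) :
    AEStronglyMeasurable (kernelAverage m T ρ f) μ := by
  refine StronglyMeasurable.aestronglyMeasurable ?_
  refine StronglyMeasurable.integral_prod_right' (f := fun q : X × Y => ρ q * f (T q)) ?_
  exact (h.measurable_kernel.mul
    ((Lp.stronglyMeasurable f).measurable.comp h.measurable_map)).stronglyMeasurable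

lemma memLp_average (h : IsAdmissible μ m T ρ C) (f : Lp ℝ ∞ μ) :
    MemLp (kernelAverage m T ρ f) ∞ μ :=
  memLp_top_of_bound (h.aestronglyMeasurable_average f) (C * ‖f‖)
    (h.norm_average_le (norm_nonneg _) (ae_norm_le_norm_linfty f))

/-- The bounded operator on `L^∞(μ)` given by `kernelAverage m T ρ`. -/
def toCLM (h : IsAdmissible μ m T ρ C) : Lp ℝ ∞ μ →L[ℝ] Lp ℝ ∞ μ :=
  LinearMap.mkContinuous
    { toFun := fun f => (h.memLp_average f).toLp _
      map_add' := by
        intro f g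
        rw [← MemLp.toLp_add]
        refine MemLp.toLp_congr _ _ ?_
        filter_upwards [h.average_congr (Lp.coeFn_add f g), h.integrable f, h.integrable g]
          with z hz h1 h2
        rw [hz, Pi.add_apply]
        simp only [kernelAverage, Pi.add_apply, mul_add]
        exact integral_add h1 h2
      map_smul' := by
        intro c f
        rw [RingHom.id_apply, ← MemLp.toLp_const_smul]
        refine MemLp.toLp_congr _ _ ?_
        filter_upwards [h.average_congr (Lp.coeFn_smul c f)] with z hz
        rw [hz, Pi.smul_apply]
        simp only [kernelAverage, Pi.smul_apply, smul_eq_mul, mul_left_comm _ c]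
        exact integral_const_mul _ _ }
    C (by
      intro f
      refine norm_linfty_le (mul_nonneg h.nonneg (norm_nonneg _)) ?_
      filter_upwards [(h.memLp_average f).coeFn_toLp,
        h.norm_average_le (norm_nonneg _) (ae_norm_le_norm_linfty f)] with z h1 h2
      simp only [LinearMap.coe_mk, AddHom.coe_mk]
      rw [h1]
      exact h2)

lemma coeFn_toCLM (h : IsAdmissible μ m T ρ C) (f : Lp ℝ ∞ μ) :
    (h.toCLM f : X → ℝ) =ᵐ[μ] kernelAverage m T ρ f :=
  (h.memLp_average f).coeFn_toLp

lemma toCLM_ae_eq (h : IsAdmissible μ m T ρ C) {F : Lp ℝ ∞ μ} {f : X → ℝ} (hf : f =ᵐ[μ] F) :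
    (h.toCLM F : X → ℝ) =ᵐ[μ] kernelAverage m T ρ f :=
  (h.coeFn_toCLM F).trans (h.average_congr hf.symm)

lemma norm_toCLM_le (h : IsAdmissible μ m T ρ C) : ‖h.toCLM‖ ≤ C :=
  LinearMap.mkContinuous_norm_le _ h.nonneg _

/-- Operators with the same map `T` are as close as their kernels are in `L^∞_z L^1_y`. -/
lemma norm_toCLM_sub_le (h : IsAdmissible μ m T ρ C) (h' : IsAdmissible μ m T ρ' C') {ε : ℝ}
    (hε : 0 ≤ ε) (hb : ∀ᵐ z ∂μ, ∫⁻ y, ‖ρ (z, y) - ρ' (z, y)‖ₑ ∂m ≤ ENNReal.ofReal ε) :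
    ‖h.toCLM - h'.toCLM‖ ≤ ε := by
  have hd : IsAdmissible μ m T (fun q => ρ q - ρ' q) ε :=
    { measurable_map := h.measurable_map
      measurable_kernel := h.measurable_kernel.sub h'.measurable_kernel
      nonneg := hε
      bound := hb
      null := by
        intro N hN hN0
        filter_upwards [h.null N hN hN0, h'.null N hN hN0] with z h1 h2
        filter_upwards [h1, h2] with y h3 h4 hne
        by_cases h5 : ρ (z, y) = 0
        · refine h4 fun h6 => hne ?_
          simp [h5, h6]
        · exact h3 h5 }
  have : h.toCLM - h'.toCLM = hd.toCLM := by
    ext1 F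
    refine Lp.ext ?_
    rw [sub_apply]
    filter_upwards [Lp.coeFn_sub (h.toCLM F) (h'.toCLM F), h.coeFn_toCLM F, h'.coeFn_toCLM F,
      hd.coeFn_toCLM F, h.integrable F, h'.integrable F] with z h1 h2 h3 h4 h5 h6
    rw [h1, Pi.sub_apply, h2, h3, h4]
    simp only [kernelAverage, sub_mul]
    exact (integral_sub h5 h6).symm
  rw [this]
  exact hd.norm_toCLM_le

end IsAdmissible

end IntegralOperators

/-! ### Removing the weight -/

instance (Ω : Set E3) : SFinite (phaseMeasure Ω) := by
  unfold phaseMeasure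
  infer_instance

lemma measurable_weight (α : ℝ) : Measurable fun p : E3 × E3 => Real.exp (α * ‖p.2‖ ^ 2) := by
  fun_prop

lemma mulWeight_ae_eq {Ω : Set E3} {α : ℝ} (F : LinftyW Ω α) :
    (mulWeight Ω α F : E3 × E3 → ℝ) =ᵐ[phaseMeasure Ω] weighted α (toClass F) :=
  (memLp_toClass F).coeFn_toLp

lemma mulWeight_surjective (Ω : Set E3) (α : ℝ) : Function.Surjective (mulWeight Ω α) := by
  intro G
  have hm : AEStronglyMeasurable (weighted (-α) G) (phaseMeasure Ω) :=
    (measurable_weight (-α)).aestronglyMeasurable.mul (Lp.aestronglyMeasurable G)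
  have h1 : weighted α (AEEqFun.mk _ hm) =ᵐ[phaseMeasure Ω] G := by
    filter_upwards [AEEqFun.coeFn_mk _ hm] with p hp
    rw [weighted, hp, weighted, ← mul_assoc, ← Real.exp_add]
    simp
  let F : weightedSubmodule Ω α := ⟨AEEqFun.mk _ hm, (memLp_congr_ae h1).2 (Lp.memLp G)⟩
  refine ⟨F, Lp.ext ?_⟩
  exact (mulWeight_ae_eq (F : LinftyW Ω α)).trans h1

/-- Multiplication by the weight is an isometric isomorphism from `L^∞_α(Ω × ℝ³)` onto
`L^∞(Ω × ℝ³)`. -/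
def weightIso (Ω : Set E3) (α : ℝ) : LinftyW Ω α ≃ₗᵢ[ℝ] Lp ℝ ∞ (phaseMeasure Ω) :=
  LinearIsometryEquiv.ofSurjective ⟨mulWeight Ω α, fun _ => rfl⟩ (mulWeight_surjective Ω α)

lemma weightIso_ae_eq {Ω : Set E3} {α : ℝ} (F : LinftyW Ω α) :
    (weightIso Ω α F : E3 × E3 → ℝ) =ᵐ[phaseMeasure Ω] weighted α (toClass F) :=
  mulWeight_ae_eq F

/-- The operator on `L^∞_α(Ω × ℝ³)` that corresponds to `T` on `L^∞(Ω × ℝ³)`. -/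
def conjWeight {Ω : Set E3} (α : ℝ) (T : Lp ℝ ∞ (phaseMeasure Ω) →L[ℝ] Lp ℝ ∞ (phaseMeasure Ω)) :
    LinftyW Ω α →L[ℝ] LinftyW Ω α :=
  ((weightIso Ω α).symm.toContinuousLinearEquiv : _ →L[ℝ] LinftyW Ω α).comp
    (T.comp ((weightIso Ω α).toContinuousLinearEquiv : LinftyW Ω α →L[ℝ] _))

lemma conjWeight_comp {Ω : Set E3} (α : ℝ)
    (T T' : Lp ℝ ∞ (phaseMeasure Ω) →L[ℝ] Lp ℝ ∞ (phaseMeasure Ω)) :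
    (conjWeight α T).comp (conjWeight α T') = conjWeight α (T.comp T') := by
  ext1 F
  simp [conjWeight]

lemma isCompactOperator_conjWeight {Ω : Set E3} (α : ℝ)
    {T : Lp ℝ ∞ (phaseMeasure Ω) →L[ℝ] Lp ℝ ∞ (phaseMeasure Ω)} (hT : IsCompactOperator T) :
    IsCompactOperator (conjWeight α T) := by
  let e : LinftyW Ω α →L[ℝ] Lp ℝ ∞ (phaseMeasure Ω) := (weightIso Ω α).toContinuousLinearEquiv
  let e' : Lp ℝ ∞ (phaseMeasure Ω) →L[ℝ] LinftyW Ω α := (weightIso Ω α).symm.toContinuousLinearEquiv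
  have h1 : IsCompactOperator (T ∘ e) := hT.comp_clm e
  have h2 : IsCompactOperator (e' ∘ (T ∘ e)) := h1.clm_comp e'
  exact h2

/-- It suffices to compare a formula and an operator after multiplication by the weight. -/
lemma isGivenBy_conjWeight {Ω : Set E3} {α : ℝ}
    {T : Lp ℝ ∞ (phaseMeasure Ω) →L[ℝ] Lp ℝ ∞ (phaseMeasure Ω)}
    {A : (E3 × E3 → ℝ) → E3 × E3 → ℝ}
    (h : ∀ (G : Lp ℝ ∞ (phaseMeasure Ω)) (f : E3 × E3 → ℝ),
      weighted α f =ᵐ[phaseMeasure Ω] G → weighted α (A f) =ᵐ[phaseMeasure Ω] T G) :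
    IsGivenBy (conjWeight α T) A := by
  intro F f hf
  have h1 : weighted α f =ᵐ[phaseMeasure Ω] weightIso Ω α F := by
    filter_upwards [weightIso_ae_eq F, hf] with p hp hfp
    rw [hp, weighted, weighted, hfp]
  have h2 : weightIso Ω α (conjWeight α T F) = T (weightIso Ω α F) := by
    simp [conjWeight]
  have h3 := weightIso_ae_eq (conjWeight α T F)
  rw [h2] at h3
  have h4 := (h _ f h1).trans h3
  unfold Represents
  filter_upwards [h4] with p hp
  exact mul_left_cancel₀ (Real.exp_pos _).ne' hp

/-! ### Continuity in mean and step functions -/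

open Filter Topology in
/-- Continuity of measure-preserving substitutions in `L¹`. -/
lemma tendsto_lintegral_comp_sub {κ : E3 → ℝ} (hκ : Integrable κ) {g : E3 × E3 → E3}
    (hg : Continuous g) (hgm : ∀ x, MeasurePreserving (fun y => g (x, y)) volume volume)
    (x₀ : E3) :
    Tendsto (fun x => ∫⁻ y, ‖κ (g (x, y)) - κ (g (x₀, y))‖ₑ) (𝓝 x₀) (𝓝 0) := by
  have hmem : MemLp κ 1 (volume : Measure E3) := memLp_one_iff_integrable.2 hκ
  let gc : C(E3, C(E3, E3)) := (ContinuousMap.mk g hg).curry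
  have hgm' : ∀ x, MeasurePreserving (gc x) volume volume := hgm
  have h1 : Tendsto (fun x => Lp.compMeasurePreserving (gc x) (hgm' x) (hmem.toLp κ)) (𝓝 x₀)
      (𝓝 (Lp.compMeasurePreserving (gc x₀) (hgm' x₀) (hmem.toLp κ))) :=
    Filter.Tendsto.compMeasurePreservingLp tendsto_const_nhds (gc.continuous.tendsto x₀) hgm'
      (hgm' x₀) ENNReal.one_ne_top
  rw [tendsto_iff_edist_tendsto_0] at h1
  refine h1.congr fun x => ?_
  rw [Lp.edist_def, eLpNorm_one_eq_lintegral_enorm]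
  refine lintegral_congr_ae ?_
  have h2 : ∀ x, (Lp.compMeasurePreserving (gc x) (hgm' x) (hmem.toLp κ) : E3 → ℝ) =ᵐ[volume]
      fun y => κ (g (x, y)) := by
    intro x
    refine (Lp.coeFn_compMeasurePreserving _ (hgm' x)).trans ?_
    exact (hgm' x).quasiMeasurePreserving.ae_eq_comp hmem.coeFn_toLp
  filter_upwards [h2 x, h2 x₀] with y h3 h4
  rw [Pi.sub_apply, h3, h4]

open Filter Topology in
/-- A family of functions that depends continuously in mean on its parameter is, on a compact set
of parameters, uniformly close in mean to one that takes finitely many values. -/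
lemma exists_simpleFunc_lintegral_le {Y : Type*} [MeasurableSpace Y] {m : Measure Y}
    {k : E3 → Y → ℝ}
    (hk : ∀ c, Tendsto (fun x => ∫⁻ y, ‖k x y - k c y‖ₑ ∂m) (𝓝 c) (𝓝 0))
    {K : Set E3} (hK : IsCompact K) {ε : ℝ≥0∞} (hε : 0 < ε) :
    ∃ σ : SimpleFunc E3 E3, ∀ x ∈ K, ∫⁻ y, ‖k x y - k (σ x) y‖ₑ ∂m ≤ ε := by
  have main : ∃ s' : Set E3, K ⊆ s' ∧ MeasurableSet s' ∧ ∃ σ : SimpleFunc E3 E3,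
      ∀ x ∈ s', ∫⁻ y, ‖k x y - k (σ x) y‖ₑ ∂m ≤ ε := by
    refine hK.induction_on (p := fun s => ∃ s' : Set E3, s ⊆ s' ∧ MeasurableSet s' ∧
      ∃ σ : SimpleFunc E3 E3, ∀ x ∈ s', ∫⁻ y, ‖k x y - k (σ x) y‖ₑ ∂m ≤ ε) ?_ ?_ ?_ ?_
    · exact ⟨∅, subset_rfl, MeasurableSet.empty, SimpleFunc.const _ 0, by simp⟩
    · rintro s t hst ⟨s', h1, h2⟩
      exact ⟨s', hst.trans h1, h2⟩
    · rintro s t ⟨s', h1, h2, σ, h3⟩ ⟨t', h4, h5, τ, h6⟩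
      refine ⟨s' ∪ t', Set.union_subset_union h1 h4, h2.union h5, SimpleFunc.piecewise s' h2 σ τ, ?_⟩
      intro x hx
      by_cases hxs : x ∈ s'
      · simpa [SimpleFunc.piecewise_apply, hxs] using h3 x hxs
      · simpa [SimpleFunc.piecewise_apply, hxs] using h6 x (hx.resolve_left hxs)
    · intro c _
      have h1 : ∀ᶠ x in 𝓝 c, ∫⁻ y, ‖k x y - k c y‖ₑ ∂m < ε := (hk c).eventually_lt_const hε
      obtain ⟨U, hU, hUo, hcU⟩ := eventually_nhds_iff.1 h1
      refine ⟨U, mem_nhdsWithin_of_mem_nhds (hUo.mem_nhds hcU), U, subset_rfl, hUo.measurableSet,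
        SimpleFunc.const _ c, fun x hx => ?_⟩
      exact (hU x hx).le
  obtain ⟨s', h1, -, σ, h2⟩ := main
  exact ⟨σ, fun x hx => h2 x (h1 hx)⟩

/-! ### Finite rank and finite sums of integral operators -/

lemma isCompactOperator_of_forall_mem {E F : Type*} [NormedAddCommGroup E] [NormedSpace ℝ E]
    [NormedAddCommGroup F] [NormedSpace ℝ F] (T : E →L[ℝ] F) (W : Submodule ℝ F)
    [FiniteDimensional ℝ W] (h : ∀ x, T x ∈ W) : IsCompactOperator T := by
  have h0 : ProperSpace W := FiniteDimensional.proper_real W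
  have h1 : IsCompactOperator (T.codRestrict W h) :=
    isCompactOperator_of_locallyCompactSpace_dom (T.codRestrict W h)
  exact h1.clm_comp W.subtypeL

lemma coeFn_finset_sum {X ι : Type*} [MeasurableSpace X] {μ : Measure X} (s : Finset ι)
    (f : ι → Lp ℝ ∞ μ) : (↑(∑ i ∈ s, f i) : X → ℝ) =ᵐ[μ] fun x => ∑ i ∈ s, f i x := by
  classical
  induction s using Finset.induction_on with
  | empty =>
    filter_upwards [Lp.coeFn_zero ℝ ∞ μ] with x hx
    simpa using hx
  | insert a s ha ih =>
    rw [Finset.sum_insert ha]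
    filter_upwards [Lp.coeFn_add (f a) (∑ i ∈ s, f i), ih] with x h1 h2
    rw [h1, Finset.sum_insert ha, Pi.add_apply, h2]

lemma IsAdmissible.toCLM_eq_sum {X Y ι : Type*} [MeasurableSpace X] [MeasurableSpace Y]
    {μ : Measure X} {m : Measure Y} [SFinite m] {T : X × Y → X} {ρ : X × Y → ℝ} {C : ℝ}
    (h : IsAdmissible μ m T ρ C) (s : Finset ι) {ρi : ι → X × Y → ℝ} {Ci : ι → ℝ}
    (hi : ∀ i, IsAdmissible μ m T (ρi i) (Ci i)) (hsum : ∀ q, ρ q = ∑ i ∈ s, ρi i q) :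
    h.toCLM = ∑ i ∈ s, (hi i).toCLM := by
  ext1 F
  refine Lp.ext ?_
  rw [sum_apply]
  have h1 : ∀ᵐ z ∂μ, ∀ i ∈ s, (hi i).toCLM F z = kernelAverage m T (ρi i) F z :=
    (Finset.eventually_all s).2 fun i _ => (hi i).coeFn_toCLM F
  have h2 : ∀ᵐ z ∂μ, ∀ i ∈ s, Integrable (fun y => ρi i (z, y) * F (T (z, y))) m :=
    (Finset.eventually_all s).2 fun i _ => (hi i).integrable F
  filter_upwards [h.coeFn_toCLM F, coeFn_finset_sum s fun i => (hi i).toCLM F, h1, h2]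
    with z h3 h4 h5 h6
  rw [h3, h4, Finset.sum_congr rfl h5]
  simp only [kernelAverage, hsum, Finset.sum_mul]
  exact integral_finsetSum s h6

/-! ### Velocity averages, transport and spatial averages on phase space -/

lemma ae_phase_iff {Ω : Set E3} {P : E3 × E3 → Prop} (hP : MeasurableSet {z | P z}) :
    (∀ᵐ z ∂phaseMeasure Ω, P z) ↔
      ∀ᵐ x ∂(volume.restrict Ω : Measure E3), ∀ᵐ ζ : E3, P (x, ζ) :=
  Measure.ae_prod_iff_ae_ae hP

lemma ae_phase_of_ae_fst {Ω : Set E3} {P : E3 → Prop}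
    (h : ∀ᵐ x ∂(volume.restrict Ω : Measure E3), P x) : ∀ᵐ z ∂phaseMeasure Ω, P z.1 :=
  Measure.quasiMeasurePreserving_fst.ae h

lemma ae_phase_of_ae_snd {Ω : Set E3} {P : E3 → Prop}
    (h : ∀ᵐ ζ : E3, P ζ) : ∀ᵐ z ∂phaseMeasure Ω, P z.2 :=
  Measure.quasiMeasurePreserving_snd.ae h

/-- The substitution `(x, ζ), η ↦ (x, η)` of an integral operator in the velocity. -/
def velocityMap (q : (E3 × E3) × E3) : E3 × E3 := (q.1.1, q.2)

/-- The substitution `(x, ζ), y ↦ (y, ζ)` of an integral operator in the position. -/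
def positionMap (q : (E3 × E3) × E3) : E3 × E3 := (q.2, q.1.2)

/-- The characteristics `(x, ζ), s ↦ (x - s ζ, ζ)` of free transport. -/
def transportMap (q : (E3 × E3) × ℝ) : E3 × E3 := (q.1.1 - q.2 • q.1.2, q.1.2)

/-- The kernel `1_{x - s ζ ∈ Ω} e^{-ν(ζ) s} χ(ζ)` of the transport solution operator, with an
additional factor `χ` that is used to cut off large velocities. -/
def transportKernel (Ω : Set E3) (ν χ : E3 → ℝ) (q : (E3 × E3) × ℝ) : ℝ :=
  {q : (E3 × E3) × ℝ | q.1.1 - q.2 • q.1.2 ∈ Ω}.indicator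
    (fun q => Real.exp (-(ν q.1.2) * q.2) * χ q.1.2) q

lemma isAdmissible_velocity (Ω : Set E3) {k : E3 × E3 → ℝ} (hk : Measurable k) {C : ℝ}
    (hC : 0 ≤ C) (hb : ∀ ζ, ∫⁻ η, ‖k (ζ, η)‖ₑ ≤ ENNReal.ofReal C) :
    IsAdmissible (phaseMeasure Ω) volume velocityMap (fun q => k (q.1.2, q.2)) C where
  measurable_map := by unfold velocityMap; fun_prop
  measurable_kernel := by fun_prop
  nonneg := hC
  bound := Filter.Eventually.of_forall fun z => hb z.2
  null N hN hN0 := by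
    have h1 : ∀ᵐ z ∂phaseMeasure Ω, z ∉ N := measure_eq_zero_iff_ae_notMem.1 hN0
    have h2 := Measure.ae_ae_of_ae_prod h1
    filter_upwards [ae_phase_of_ae_fst h2] with z hz
    filter_upwards [hz] with η hη _
    exact hη

lemma isAdmissible_position (Ω : Set E3) {κ : E3 × E3 → ℝ} (hκ : Measurable κ) {C : ℝ}
    (hC : 0 ≤ C) (hb : ∀ x, ∫⁻ y in Ω, ‖κ (x, y)‖ₑ ≤ ENNReal.ofReal C) :
    IsAdmissible (phaseMeasure Ω) (volume.restrict Ω) positionMap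
      (fun q => κ (q.1.1, q.2)) C where
  measurable_map := by unfold positionMap; fun_prop
  measurable_kernel := by fun_prop
  nonneg := hC
  bound := Filter.Eventually.of_forall fun z => hb z.1
  null N hN hN0 := by
    have h1 : ∀ᵐ z ∂phaseMeasure Ω, z ∉ N := measure_eq_zero_iff_ae_notMem.1 hN0
    have h2 := (Measure.ae_ae_comm (μ := volume.restrict Ω) (ν := (volume : Measure E3))
      (p := fun x ζ => (x, ζ) ∉ N) hN.compl).1 (Measure.ae_ae_of_ae_prod h1)
    filter_upwards [ae_phase_of_ae_snd h2] with z hz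
    filter_upwards [hz] with η hη _
    exact hη

lemma measurable_transportMap : Measurable transportMap := by
  unfold transportMap
  fun_prop

lemma measurable_transportKernel {Ω : Set E3} (hΩ : MeasurableSet Ω) {ν χ : E3 → ℝ}
    (hν : Measurable ν) (hχ : Measurable χ) : Measurable (transportKernel Ω ν χ) := by
  unfold transportKernel
  refine Measurable.indicator ?_ ?_
  · fun_prop
  · have : Measurable fun q : (E3 × E3) × ℝ => q.1.1 - q.2 • q.1.2 := by fun_prop
    exact this hΩ

/-- Along almost every characteristic a null set of phase space is met in a null set of times: for a
fixed time, free transport is a translation in `x`. -/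
lemma ae_ae_transport_notMem {Ω : Set E3} (hΩ : MeasurableSet Ω) {N : Set (E3 × E3)}
    (hN : MeasurableSet N) (hN0 : phaseMeasure Ω N = 0) (m : Measure ℝ) [SFinite m] :
    ∀ᵐ z ∂phaseMeasure Ω, ∀ᵐ s ∂m, z.1 - s • z.2 ∈ Ω → (z.1 - s • z.2, z.2) ∉ N := by
  have hT : Measurable fun q : (E3 × E3) × ℝ => (q.1.1 - q.2 • q.1.2, q.1.2) :=
    measurable_transportMap
  have hset : MeasurableSet {q : (E3 × E3) × ℝ |
      q.1.1 - q.2 • q.1.2 ∈ Ω → (q.1.1 - q.2 • q.1.2, q.1.2) ∉ N} := by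
    have h1 : MeasurableSet {z : E3 × E3 | z.1 ∈ Ω → z ∉ N} := by
      have : {z : E3 × E3 | z.1 ∈ Ω → z ∉ N} = (Prod.fst ⁻¹' Ω)ᶜ ∪ Nᶜ := by
        ext z
        simp [imp_iff_not_or]
      rw [this]
      exact (measurable_fst hΩ).compl.union hN.compl
    exact hT h1
  have h1 : ∀ᵐ z ∂phaseMeasure Ω, z ∉ N := measure_eq_zero_iff_ae_notMem.1 hN0
  have h2 := (Measure.ae_ae_comm (μ := volume.restrict Ω) (ν := (volume : Measure E3))
      (p := fun x ζ => (x, ζ) ∉ N) hN.compl).1 (Measure.ae_ae_of_ae_prod h1)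
  rw [Measure.ae_ae_comm (p := fun (z : E3 × E3) (s : ℝ) =>
    z.1 - s • z.2 ∈ Ω → (z.1 - s • z.2, z.2) ∉ N) hset]
  refine Filter.Eventually.of_forall fun s => ?_
  rw [ae_phase_iff (P := fun z : E3 × E3 => z.1 - s • z.2 ∈ Ω → (z.1 - s • z.2, z.2) ∉ N)
    ((measurable_id.prodMk measurable_const : Measurable fun z : E3 × E3 => (z, s)) hset)]
  rw [Measure.ae_ae_comm (p := fun x ζ : E3 => x - s • ζ ∈ Ω → (x - s • ζ, ζ) ∉ N)
    ((measurable_id.prodMk measurable_const : Measurable fun z : E3 × E3 => (z, s)) hset)]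
  filter_upwards [h2] with ζ hζ
  refine ae_restrict_of_ae ?_
  have h3 : ∀ᵐ x : E3, x ∈ Ω → (x, ζ) ∉ N := (ae_restrict_iff' hΩ).1 hζ
  exact (measurePreserving_sub_right volume (s • ζ)).quasiMeasurePreserving.ae h3

lemma isAdmissible_transport {Ω : Set E3} (hΩ : MeasurableSet Ω) {ν χ : E3 → ℝ}
    (hν : Measurable ν) (hχ : Measurable χ) {C : ℝ} (hC : 0 ≤ C)
    (hb : ∀ x ∈ Ω, ∀ ζ,
      ∫⁻ s in Set.Ioi (0 : ℝ), ‖transportKernel Ω ν χ ((x, ζ), s)‖ₑ ≤ ENNReal.ofReal C) :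
    IsAdmissible (phaseMeasure Ω) (volume.restrict (Set.Ioi 0)) transportMap
      (transportKernel Ω ν χ) C where
  measurable_map := measurable_transportMap
  measurable_kernel := measurable_transportKernel hΩ hν hχ
  nonneg := hC
  bound := by
    have h1 : ∀ᵐ x ∂(volume.restrict Ω : Measure E3), x ∈ Ω := ae_restrict_mem hΩ
    filter_upwards [ae_phase_of_ae_fst h1] with z hz
    exact hb z.1 hz z.2
  null N hN hN0 := by
    filter_upwards [ae_ae_transport_notMem hΩ hN hN0 (volume.restrict (Set.Ioi 0))] with z hz
    filter_upwards [hz] with s hs hne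
    refine hs ?_
    by_contra hcon
    exact hne (Set.indicator_of_notMem (by simpa using hcon) _)

lemma lintegral_exp_neg_mul_Ioi {a : ℝ} (ha : 0 < a) :
    ∫⁻ s in Set.Ioi (0 : ℝ), ENNReal.ofReal (Real.exp (-a * s)) = ENNReal.ofReal a⁻¹ := by
  rw [← ofReal_integral_eq_lintegral_ofReal]
  · rw [integral_exp_mul_Ioi (by linarith : -a < 0)]
    simp [neg_div_neg_eq]
  · exact (integrableOn_exp_mul_Ioi (by linarith) 0)
  · exact Filter.Eventually.of_forall fun s => (Real.exp_pos _).le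

lemma lintegral_transportKernel_le {Ω : Set E3} {ν χ : E3 → ℝ} {ν₀ : ℝ} (hν₀ : 0 < ν₀)
    (hν : ∀ ζ, ν₀ ≤ ν ζ) (hχ : ∀ ζ, |χ ζ| ≤ 1) (x ζ : E3) :
    ∫⁻ s in Set.Ioi (0 : ℝ), ‖transportKernel Ω ν χ ((x, ζ), s)‖ₑ ≤ ENNReal.ofReal ν₀⁻¹ := by
  rw [← lintegral_exp_neg_mul_Ioi hν₀]
  refine setLIntegral_mono' measurableSet_Ioi fun s hs => ?_
  rw [← ofReal_norm]
  refine ENNReal.ofReal_le_ofReal ?_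
  unfold transportKernel
  refine (norm_indicator_le_norm_self _ _).trans ?_
  rw [norm_mul, Real.norm_eq_abs, Real.norm_eq_abs, Real.abs_exp]
  have h1 : Real.exp (-ν ζ * s) ≤ Real.exp (-ν₀ * s) := by
    refine Real.exp_le_exp.2 ?_
    have := mul_le_mul_of_nonneg_right (hν ζ) (le_of_lt hs)
    linarith
  calc Real.exp (-ν ζ * s) * |χ ζ| ≤ Real.exp (-ν₀ * s) * 1 :=
        mul_le_mul h1 (hχ ζ) (abs_nonneg _) (Real.exp_pos _).le
    _ = _ := mul_one _

/-- Fast particles leave a bounded domain after a short time. -/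
lemma lintegral_transportKernel_le_of_fast {Ω : Set E3} {r R : ℝ} (hR : 0 < R)
    (hΩr : ∀ x ∈ Ω, ‖x‖ ≤ r) {ν χ : E3 → ℝ} (hν : ∀ ζ, 0 ≤ ν ζ) (hχ : ∀ ζ, |χ ζ| ≤ 1)
    (hχR : ∀ ζ, ‖ζ‖ ≤ R → χ ζ = 0) {x : E3} (hx : x ∈ Ω) (ζ : E3) :
    ∫⁻ s in Set.Ioi (0 : ℝ), ‖transportKernel Ω ν χ ((x, ζ), s)‖ₑ ≤
      ENNReal.ofReal (2 * r / R) := by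
  by_cases hζ : ‖ζ‖ ≤ R
  · have : ∀ s, transportKernel Ω ν χ ((x, ζ), s) = 0 := by
      intro s
      simp [transportKernel, hχR ζ hζ]
    simp [this]
  push Not at hζ
  have hmem : ∀ s ∈ Set.Ioi (0 : ℝ), ‖transportKernel Ω ν χ ((x, ζ), s)‖ₑ ≤
      (Set.Ioc (0 : ℝ) (2 * r / R)).indicator (fun _ => 1) s := by
    intro s hs
    by_cases hsΩ : x - s • ζ ∈ Ω
    · have h1 : s * R ≤ 2 * r := by
        have h2 : ‖s • ζ‖ ≤ ‖x‖ + ‖x - s • ζ‖ := by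
          have := norm_sub_le x (x - s • ζ)
          simpa using this
        rw [norm_smul, Real.norm_eq_abs, abs_of_pos hs] at h2
        have h3 := hΩr x hx
        have h4 := hΩr _ hsΩ
        have h5 : s * R ≤ s * ‖ζ‖ := mul_le_mul_of_nonneg_left hζ.le (le_of_lt hs)
        linarith
      have h6 : s ∈ Set.Ioc (0 : ℝ) (2 * r / R) := ⟨hs, (le_div_iff₀ hR).2 h1⟩
      rw [Set.indicator_of_mem h6, ← ofReal_norm, ← ENNReal.ofReal_one]
      refine ENNReal.ofReal_le_ofReal ?_
      refine (norm_indicator_le_norm_self _ _).trans ?_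
      rw [norm_mul, Real.norm_eq_abs, Real.norm_eq_abs, Real.abs_exp]
      have h7 : Real.exp (-ν ζ * s) ≤ 1 := by
        rw [Real.exp_le_one_iff]
        have := mul_nonneg (hν ζ) (le_of_lt hs)
        linarith
      exact mul_le_one₀ h7 (abs_nonneg _) (hχ ζ)
    · have : transportKernel Ω ν χ ((x, ζ), s) = 0 :=
        Set.indicator_of_notMem (by simpa using hsΩ) _
      simp [this]
  calc _ ≤ ∫⁻ s in Set.Ioi (0 : ℝ), (Set.Ioc (0 : ℝ) (2 * r / R)).indicator (fun _ => 1) s :=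
        setLIntegral_mono' measurableSet_Ioi hmem
    _ ≤ ∫⁻ s, (Set.Ioc (0 : ℝ) (2 * r / R)).indicator (fun _ => 1) s :=
        setLIntegral_le_lintegral _ _
    _ = _ := by
        rw [lintegral_indicator measurableSet_Ioc]
        simp

/-! ### Averaging along characteristics -/

/-- For fixed `x`, averaging `G(x - sη)` against an integrable density in `(η, s)` amounts to
averaging against a spatial density: `κ(z) = ∫ s⁻³ θ(z / s, s) ds`. -/
lemma exists_density_of_ray_average {θ : E3 × ℝ → ℝ} (hθm : Measurable θ)
    (hθ : Integrable θ (volume.prod (volume.restrict (Set.Ioi 0)))) :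
    ∃ κ : E3 → ℝ, Measurable κ ∧ Integrable κ ∧ ∀ (G : E3 → ℝ) (c : ℝ), Measurable G →
      (∀ z, |G z| ≤ c) →
      ∫ η, ∫ s in Set.Ioi (0 : ℝ), θ (η, s) * G (s • η) = ∫ z, κ z * G z := by
  set m : Measure ℝ := volume.restrict (Set.Ioi 0) with hm
  let Θ : ℝ × E3 → ℝ := fun q => (q.1 ^ 3)⁻¹ * θ (q.1⁻¹ • q.2, q.1)
  have hΘm : Measurable Θ := by
    have : Measurable fun q : ℝ × E3 => θ (q.1⁻¹ • q.2, q.1) := hθm.comp (by fun_prop)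
    exact Measurable.mul (by fun_prop) this
  -- the substitution `z = s η` for fixed `s > 0`
  have hsub : ∀ s ∈ Set.Ioi (0 : ℝ), ∀ H : E3 → ℝ,
      ∫ z, (s ^ 3)⁻¹ * H (s⁻¹ • z) = ∫ η, H η := by
    intro s hs H
    rw [integral_const_mul, Measure.integral_comp_inv_smul]
    have h3 : Module.finrank ℝ E3 = 3 := by simp
    have hs' : (0 : ℝ) < s := hs
    rw [h3, abs_of_pos (by positivity), smul_eq_mul, ← mul_assoc, inv_mul_cancel₀ (by positivity),
      one_mul]
  have hθ' := hθ.swap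
  have hΘ : Integrable Θ (m.prod volume) := by
    rw [integrable_prod_iff hΘm.aestronglyMeasurable]
    have h1 := (integrable_prod_iff hθ'.1).1 hθ'
    constructor
    · filter_upwards [h1.1, ae_restrict_mem measurableSet_Ioi] with s hs hs0
      have : s⁻¹ ≠ 0 := inv_ne_zero (ne_of_gt hs0)
      exact ((integrable_comp_smul_iff volume (fun η => θ (η, s)) this).2 hs).const_mul (s ^ 3)⁻¹
    · refine h1.2.congr ?_
      filter_upwards [ae_restrict_mem measurableSet_Ioi] with s hs0
      have hs' : (0 : ℝ) < s := hs0
      have := hsub s hs0 fun η => ‖θ (η, s)‖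
      refine Eq.trans this.symm ?_
      refine integral_congr_ae (Filter.Eventually.of_forall fun z => ?_)
      simp only [Θ]
      rw [norm_mul, Real.norm_of_nonneg (show 0 ≤ (s ^ 3)⁻¹ by positivity)]
  refine ⟨fun z => ∫ s, Θ (s, z) ∂m, ?_, hΘ.integral_prod_right, ?_⟩
  · exact (hΘm.stronglyMeasurable.comp_measurable measurable_swap).integral_prod_right'.measurable
  · intro G c hG hc
    have hbd : ∀ᵐ q ∂(m.prod (volume : Measure E3)), ‖G q.2‖ ≤ c :=
      Filter.Eventually.of_forall fun q => hc _
    have h1 : Integrable (fun q : ℝ × E3 => Θ q * G q.2) (m.prod volume) :=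
      hΘ.mul_bdd (c := c) (hG.comp measurable_snd).aestronglyMeasurable hbd
    have h2 : Integrable (fun q : ℝ × E3 => θ (q.2, q.1) * G (q.1 • q.2)) (m.prod volume) := by
      refine hθ'.mul_bdd (c := c) (g := fun q : ℝ × E3 => G (q.1 • q.2)) ?_ ?_
      · exact (hG.comp (by fun_prop : Measurable fun q : ℝ × E3 => q.1 • q.2)).aestronglyMeasurable
      · exact Filter.Eventually.of_forall fun q => hc _
    calc ∫ η, ∫ s, θ (η, s) * G (s • η) ∂m = ∫ s, (∫ η, θ (η, s) * G (s • η)) ∂m :=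
          (integral_integral_swap (f := fun s η => θ (η, s) * G (s • η)) h2).symm
      _ = ∫ s, (∫ z, Θ (s, z) * G z) ∂m := by
          refine integral_congr_ae ?_
          filter_upwards [ae_restrict_mem measurableSet_Ioi] with s hs0
          have hs' : (0 : ℝ) < s := hs0
          rw [← hsub s hs0]
          refine integral_congr_ae (Filter.Eventually.of_forall fun z => ?_)
          simp only [Θ]
          rw [smul_inv_smul₀ hs'.ne', mul_assoc]
      _ = ∫ z, ∫ s, Θ (s, z) * G z ∂m := integral_integral_swap h1
      _ = ∫ z, (∫ s, Θ (s, z) ∂m) * G z := by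
          simp only [integral_mul_const]

/-! ### Operators of rank one in the velocity -/

/-- The operator `T` on `L^∞(Ω × ℝ³)` acts in the velocity only, by a kernel `a(ζ) b(η)` with `a`
bounded and `b` integrable. -/
def IsProductKernel (Ω : Set E3)
    (T : Lp ℝ ∞ (phaseMeasure Ω) →L[ℝ] Lp ℝ ∞ (phaseMeasure Ω)) : Prop :=
  ∃ a b : E3 → ℝ, Measurable a ∧ (∃ c, ∀ ζ, |a ζ| ≤ c) ∧ Measurable b ∧ Integrable b ∧
    ∀ F : Lp ℝ ∞ (phaseMeasure Ω),
      T F =ᵐ[phaseMeasure Ω] fun z => a z.2 * ∫ η, b η * F (z.1, η)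

lemma ae_velocity_average_eq {Ω : Set E3} {f g : E3 × E3 → ℝ} (a b : E3 → ℝ)
    (hfg : f =ᵐ[phaseMeasure Ω] g) :
    (fun z : E3 × E3 => a z.2 * ∫ η, b η * f (z.1, η)) =ᵐ[phaseMeasure Ω]
      fun z => a z.2 * ∫ η, b η * g (z.1, η) := by
  filter_upwards [ae_phase_of_ae_fst (Measure.ae_ae_of_ae_prod hfg)] with z hz
  congr 1
  refine integral_congr_ae ?_
  filter_upwards [hz] with η hη
  rw [hη]

/-- The velocity average of a class in `L^∞(Ω × ℝ³)` has a representative that is measurable,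
everywhere bounded, and zero outside `Ω`. -/
lemma exists_velocity_average {Ω : Set E3} (hΩ : MeasurableSet Ω) {b : E3 → ℝ} (hbm : Measurable b)
    (hb : Integrable b) (F : Lp ℝ ∞ (phaseMeasure Ω)) :
    ∃ (G : E3 → ℝ) (c : ℝ), Measurable G ∧ (∀ y, |G y| ≤ c) ∧ (∀ y ∉ Ω, G y = 0) ∧
      ∀ᵐ y ∂(volume.restrict Ω : Measure E3), ∫ η, b η * F (y, η) = G y := by
  set c : ℝ := (∫ η, ‖b η‖) * ‖F‖ with hc
  let g : E3 → ℝ := fun y => ∫ η, b η * F (y, η)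
  have hg : Measurable g := by
    refine StronglyMeasurable.measurable ?_
    refine StronglyMeasurable.integral_prod_right' (f := fun q : E3 × E3 => b q.2 * F q) ?_
    exact ((hbm.comp measurable_snd).mul (Lp.stronglyMeasurable F).measurable).stronglyMeasurable
  have hgc : ∀ᵐ y ∂(volume.restrict Ω : Measure E3), |g y| ≤ c := by
    filter_upwards [Measure.ae_ae_of_ae_prod (ae_norm_le_norm_linfty F)] with y hy
    calc |g y| ≤ ∫ η, ‖b η * F (y, η)‖ :=
          norm_integral_le_integral_norm fun η => b η * F (y, η)
      _ ≤ ∫ η, ‖b η‖ * ‖F‖ := by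
          refine integral_mono_of_nonneg (Filter.Eventually.of_forall fun η => norm_nonneg _)
            (hb.norm.mul_const _) ?_
          filter_upwards [hy] with η hη
          rw [norm_mul]
          exact mul_le_mul_of_nonneg_left hη (norm_nonneg _)
      _ = c := integral_mul_const _ _
  have hset : MeasurableSet (Ω ∩ {y | |g y| ≤ c}) :=
    hΩ.inter (measurableSet_le (by fun_prop) measurable_const)
  have hc0 : 0 ≤ c := mul_nonneg (integral_nonneg fun _ => norm_nonneg _) (norm_nonneg _)
  refine ⟨(Ω ∩ {y | |g y| ≤ c}).indicator g, c, hg.indicator hset, ?_, ?_, ?_⟩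
  · intro y
    by_cases hy : y ∈ Ω ∩ {y | |g y| ≤ c}
    · rw [Set.indicator_of_mem hy]
      exact hy.2
    · rw [Set.indicator_of_notMem hy]
      simpa using hc0
  · intro y hy
    exact Set.indicator_of_notMem (fun h => hy h.1) _
  · filter_upwards [hgc, ae_restrict_mem hΩ] with y h1 h2
    exact (Set.indicator_of_mem (show y ∈ Ω ∩ {y | |g y| ≤ c} from ⟨h2, h1⟩) g).symm

lemma isAdmissible_translate (Ω : Set E3) {κ : E3 → ℝ} (hκm : Measurable κ) (hκ : Integrable κ)
    {σ : E3 → E3} (hσ : Measurable σ) :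
    IsAdmissible (phaseMeasure Ω) (volume.restrict Ω) positionMap
      (fun q => κ (σ q.1.1 - q.2)) (∫⁻ z, ‖κ z‖ₑ).toReal := by
  refine isAdmissible_position Ω (κ := fun q => κ (σ q.1 - q.2)) (by fun_prop)
    ENNReal.toReal_nonneg fun x => ?_
  rw [ENNReal.ofReal_toReal hκ.2.ne]
  refine (setLIntegral_le_lintegral _ _).trans (le_of_eq ?_)
  exact lintegral_sub_left_eq_self (fun z => ‖κ z‖ₑ) (σ x)

/-! ### Compactness of averages of transported functions -/

lemma isCompactOperator_of_approx {E F : Type*} [NormedAddCommGroup E] [NormedSpace ℝ E]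
    [NormedAddCommGroup F] [NormedSpace ℝ F] [CompleteSpace F] {T : E →L[ℝ] F}
    (h : ∀ ε > 0, ∃ T' : E →L[ℝ] F, IsCompactOperator T' ∧ ‖T - T'‖ ≤ ε) :
    IsCompactOperator T := by
  have hcl : IsClosed {f : E →L[ℝ] F | IsCompactOperator f} := isClosed_setOfPred_isCompactOperator
  have : T ∈ closure {f : E →L[ℝ] F | IsCompactOperator f} := by
    rw [Metric.mem_closure_iff]
    intro ε hε
    obtain ⟨T', h1, h2⟩ := h (ε / 2) (by positivity)
    refine ⟨T', h1, ?_⟩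
    rw [dist_eq_norm_sub]
    linarith
  rwa [hcl.closure_eq] at this

lemma measurable_indicator_simpleFunc (σ : SimpleFunc E3 E3) (c : E3) :
    Measurable ((σ ⁻¹' {c}).indicator fun _ => (1 : ℝ)) :=
  measurable_const.indicator (σ.measurableSet_fiber c)

lemma simpleFunc_sum_indicator (σ : SimpleFunc E3 E3) (g : E3 → ℝ) (x : E3) :
    g (σ x) = ∑ c ∈ σ.range, (σ ⁻¹' {c}).indicator (fun _ => (1 : ℝ)) x * g c := by
  rw [Finset.sum_eq_single (σ x)]
  · rw [Set.indicator_of_mem (by simp), one_mul]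
  · intro c _ hc
    rw [Set.indicator_of_notMem (by simpa using hc.symm), zero_mul]
  · intro h
    exact absurd (σ.mem_range_self x) h

lemma isAdmissible_product (Ω : Set E3) {a b : E3 → ℝ} (ha : Measurable a) {c : ℝ}
    (hac : ∀ ζ, |a ζ| ≤ c) (hbm : Measurable b) (hb : Integrable b) :
    IsAdmissible (phaseMeasure Ω) volume velocityMap (fun q => a q.1.2 * b q.2)
      (c * (∫⁻ η, ‖b η‖ₑ).toReal) := by
  have hc : 0 ≤ c := (abs_nonneg _).trans (hac 0)
  refine isAdmissible_velocity Ω (k := fun q => a q.1 * b q.2) (by fun_prop)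
    (mul_nonneg hc ENNReal.toReal_nonneg) fun ζ => ?_
  rw [ENNReal.ofReal_mul hc, ENNReal.ofReal_toReal hb.2.ne]
  simp only [enorm_mul]
  rw [lintegral_const_mul' _ _ enorm_ne_top]
  gcongr
  rw [← ofReal_norm]
  exact ENNReal.ofReal_le_ofReal (hac ζ)

lemma isProductKernel_toCLM {Ω : Set E3} {a b : E3 → ℝ} (ha : Measurable a) {c : ℝ}
    (hac : ∀ ζ, |a ζ| ≤ c) (hbm : Measurable b) (hb : Integrable b) {C : ℝ}
    (h : IsAdmissible (phaseMeasure Ω) volume velocityMap (fun q => a q.1.2 * b q.2) C) :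
    IsProductKernel Ω h.toCLM := by
  refine ⟨a, b, ha, ⟨c, hac⟩, hbm, hb, fun F => ?_⟩
  refine (h.coeFn_toCLM F).trans (Filter.Eventually.of_forall fun z => ?_)
  simp only [kernelAverage, velocityMap, mul_assoc]
  exact integral_const_mul _ _

/-- A spatial convolution after an average in the velocity is compact: the convolution kernel is
approximated in mean, uniformly in `x`, by kernels that take finitely many values as functions
of `x`, and these give operators of finite rank. -/
lemma isCompactOperator_translate_comp_product {Ω : Set E3} (hΩ : MeasurableSet Ω)
    (hΩb : Bornology.IsBounded Ω) {κ : E3 → ℝ} (hκm : Measurable κ) (hκ : Integrable κ)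
    {U : Lp ℝ ∞ (phaseMeasure Ω) →L[ℝ] Lp ℝ ∞ (phaseMeasure Ω)} (hU : IsProductKernel Ω U) :
    IsCompactOperator ((isAdmissible_translate Ω hκm hκ measurable_id).toCLM.comp U) := by
  obtain ⟨a, b, ha, ⟨ca, hac⟩, hbm, hb, hUF⟩ := hU
  obtain ⟨R, hR⟩ := hΩb.subset_closedBall (0 : E3)
  refine isCompactOperator_of_approx fun ε hε => ?_
  set δ : ℝ := ε / (‖U‖ + 1) with hδ
  have hδ0 : 0 < δ := by positivity
  obtain ⟨σ, hσ⟩ := exists_simpleFunc_lintegral_le (k := fun x y => κ (x - y))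
    (fun c => tendsto_lintegral_comp_sub (g := fun q => q.1 - q.2) hκ (by fun_prop)
      (fun x => Measure.measurePreserving_sub_left volume x) c)
    (isCompact_closedBall (0 : E3) R) (ENNReal.ofReal_pos.2 hδ0)
  have hX' := isAdmissible_translate Ω hκm hκ σ.measurable
  refine ⟨hX'.toCLM.comp U, ?_, ?_⟩
  · -- the kernel is a finite sum of kernels `1_{σ x = c} κ(c - y)`
    have hc : ∀ c : E3, IsAdmissible (phaseMeasure Ω) (volume.restrict Ω) positionMap
        (fun q => (σ ⁻¹' {c}).indicator (fun _ => (1 : ℝ)) q.1.1 * κ (c - q.2))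
        (∫⁻ z, ‖κ z‖ₑ).toReal := by
      intro c
      have h1 := measurable_indicator_simpleFunc σ c
      refine isAdmissible_position Ω
        (κ := fun q => (σ ⁻¹' {c}).indicator (fun _ => (1 : ℝ)) q.1 * κ (c - q.2)) (by fun_prop)
        ENNReal.toReal_nonneg fun x => ?_
      rw [ENNReal.ofReal_toReal hκ.2.ne]
      calc _ ≤ ∫⁻ y in Ω, ‖κ (c - y)‖ₑ := by
            refine lintegral_mono fun y => ?_
            by_cases hx : x ∈ σ ⁻¹' {c}
            · simp [Set.indicator_of_mem hx]
            · simp [Set.indicator_of_notMem hx]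
        _ ≤ ∫⁻ y, ‖κ (c - y)‖ₑ := setLIntegral_le_lintegral _ _
        _ = _ := lintegral_sub_left_eq_self (fun z => ‖κ z‖ₑ) c
    have hsum : hX'.toCLM = ∑ c ∈ σ.range, (hc c).toCLM :=
      hX'.toCLM_eq_sum σ.range hc fun q => simpleFunc_sum_indicator σ (fun c => κ (c - q.2)) q.1.1
    have hcomp : hX'.toCLM.comp U = ∑ c ∈ σ.range, (hc c).toCLM.comp U := by
      rw [hsum]
      ext1 F
      simp [sum_apply]
    rw [hcomp]
    refine (compactOperator (RingHom.id ℝ) _ _).sum_mem fun c _ => ?_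
    have hmem : MemLp (fun z : E3 × E3 => (σ ⁻¹' {c}).indicator (fun _ => (1 : ℝ)) z.1 * a z.2) ∞
        (phaseMeasure Ω) := by
      refine memLp_top_of_bound ?_ ca (Filter.Eventually.of_forall fun z => ?_)
      · have h1 := measurable_indicator_simpleFunc σ c
        exact Measurable.aestronglyMeasurable (by fun_prop)
      · by_cases hx : z.1 ∈ σ ⁻¹' {c}
        · simpa [Set.indicator_of_mem hx] using hac z.2
        · simpa [Set.indicator_of_notMem hx] using (abs_nonneg _).trans (hac 0)
    refine isCompactOperator_of_forall_mem _ (ℝ ∙ hmem.toLp _) fun F => ?_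
    obtain ⟨G, cG, hGm, hGc, hG0, hG⟩ := exists_velocity_average hΩ hbm hb F
    have h1 : (fun z : E3 × E3 => a z.2 * G z.1) =ᵐ[phaseMeasure Ω] U F := by
      filter_upwards [hUF F, ae_phase_of_ae_fst hG] with z h2 h3
      rw [h2, h3]
    rw [Submodule.mem_span_singleton]
    refine ⟨∫ y in Ω, κ (c - y) * G y, Lp.ext ?_⟩
    rw [ContinuousLinearMap.comp_apply]
    filter_upwards [(hc c).toCLM_ae_eq h1, hmem.coeFn_toLp,
      Lp.coeFn_smul (∫ y in Ω, κ (c - y) * G y) (hmem.toLp _)] with z h2 h3 h4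
    rw [h4, Pi.smul_apply, h3, h2, smul_eq_mul, mul_comm, ← integral_const_mul]
    refine integral_congr_ae (Filter.Eventually.of_forall fun y => ?_)
    simp only [positionMap]
    ring
  · rw [← ContinuousLinearMap.sub_comp]
    refine (ContinuousLinearMap.opNorm_comp_le _ _).trans ?_
    have h1 : ‖(isAdmissible_translate Ω hκm hκ measurable_id).toCLM - hX'.toCLM‖ ≤ δ := by
      refine IsAdmissible.norm_toCLM_sub_le _ _ hδ0.le ?_
      filter_upwards [ae_phase_of_ae_fst (ae_restrict_mem hΩ)] with z hz
      exact (setLIntegral_le_lintegral _ _).trans (hσ z.1 (hR hz))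
    calc _ ≤ δ * ‖U‖ := by gcongr
      _ ≤ δ * (‖U‖ + 1) := by gcongr; linarith
      _ = ε := div_mul_cancel₀ _ (by positivity)

/-- With `T₂ F (y, η) = a'(η) G(y)`, the function `T₁ S T₂ F (x, ζ)` is `a(ζ)` times the average of
`G(x - s η)` with the density `b(η) a'(η) e^{-ν(η) s}`, and hence `a(ζ) (κ * G)(x)`. -/
lemma isCompactOperator_product_transport_product {Ω : Set E3} (hΩ : MeasurableSet Ω)
    (hΩb : Bornology.IsBounded Ω) {ν : E3 → ℝ} (hν : Measurable ν) {ν₀ : ℝ} (hν₀ : 0 < ν₀)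
    (hνν₀ : ∀ ζ, ν₀ ≤ ν ζ) {C : ℝ}
    (hS : IsAdmissible (phaseMeasure Ω) (volume.restrict (Set.Ioi 0)) transportMap
      (transportKernel Ω ν fun _ => 1) C)
    {T₁ T₂ : Lp ℝ ∞ (phaseMeasure Ω) →L[ℝ] Lp ℝ ∞ (phaseMeasure Ω)}
    (h₁ : IsProductKernel Ω T₁) (h₂ : IsProductKernel Ω T₂) :
    IsCompactOperator (T₁.comp (hS.toCLM.comp T₂)) := by
  obtain ⟨a, b, ha, ⟨ca, hac⟩, hbm, hb, hT₁⟩ := h₁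
  obtain ⟨a', b', ha', ⟨ca', hac'⟩, hbm', hb', hT₂⟩ := h₂
  let θ : E3 × ℝ → ℝ := fun q => b q.1 * a' q.1 * Real.exp (-(ν q.1) * q.2)
  have hθm : Measurable θ := by fun_prop
  have hθ : Integrable θ (volume.prod (volume.restrict (Set.Ioi 0))) := by
    have h1 : Integrable (fun s : ℝ => Real.exp (-ν₀ * s)) (volume.restrict (Set.Ioi 0)) :=
      integrableOn_exp_mul_Ioi (by linarith) 0
    refine ((hb.norm.mul_const ca').mul_prod h1).mono' hθm.aestronglyMeasurable ?_
    have h2 : ∀ᵐ q ∂((volume : Measure E3).prod (volume.restrict (Set.Ioi (0 : ℝ)))),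
        q.2 ∈ Set.Ioi (0 : ℝ) :=
      Measure.quasiMeasurePreserving_snd.ae (ae_restrict_mem measurableSet_Ioi)
    filter_upwards [h2] with q hq
    simp only [θ]
    rw [norm_mul, norm_mul, Real.norm_of_nonneg (Real.exp_pos _).le]
    refine mul_le_mul ?_ ?_ (Real.exp_pos _).le
      (mul_nonneg (norm_nonneg _) ((abs_nonneg _).trans (hac' 0)))
    · exact mul_le_mul_of_nonneg_left (hac' _) (norm_nonneg _)
    · refine Real.exp_le_exp.2 ?_
      have := mul_le_mul_of_nonneg_right (hνν₀ q.1) (le_of_lt hq)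
      linarith
  obtain ⟨κ, hκm, hκ, hκG⟩ := exists_density_of_ray_average hθm hθ
  have hU := isAdmissible_product Ω ha hac hbm' hb'
  have hUp := isProductKernel_toCLM ha hac hbm' hb' hU
  have hX := isAdmissible_translate Ω hκm hκ measurable_id
  suffices h : T₁.comp (hS.toCLM.comp T₂) = hX.toCLM.comp hU.toCLM by
    rw [h]
    exact isCompactOperator_translate_comp_product hΩ hΩb hκm hκ hUp
  ext1 F
  refine Lp.ext ?_
  obtain ⟨G, cG, hGm, hGc, hG0, hG⟩ := exists_velocity_average hΩ hbm' hb' F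
  have h1 : (fun z : E3 × E3 => a' z.2 * G z.1) =ᵐ[phaseMeasure Ω] T₂ F := by
    filter_upwards [hT₂ F, ae_phase_of_ae_fst hG] with z h2 h3
    rw [h2, h3]
  have h2 : (fun z : E3 × E3 => a z.2 * G z.1) =ᵐ[phaseMeasure Ω] hU.toCLM F := by
    filter_upwards [hU.coeFn_toCLM F, ae_phase_of_ae_fst hG] with z h2 h3
    rw [h2, ← h3, ← integral_const_mul]
    refine integral_congr_ae (Filter.Eventually.of_forall fun η => ?_)
    simp only [velocityMap]
    ring
  have h3 := hS.toCLM_ae_eq h1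
  have h4 := (hT₁ (hS.toCLM (T₂ F))).trans (ae_velocity_average_eq a b h3)
  refine h4.trans (Filter.EventuallyEq.trans ?_ (hX.toCLM_ae_eq h2).symm)
  refine Filter.Eventually.of_forall fun z => ?_
  have h5 : ∫ η, b η * kernelAverage (volume.restrict (Set.Ioi 0)) transportMap
      (transportKernel Ω ν fun _ => 1) (fun z : E3 × E3 => a' z.2 * G z.1) (z.1, η) =
      ∫ η, ∫ s in Set.Ioi (0 : ℝ), θ (η, s) * G (z.1 - s • η) := by
    refine integral_congr_ae (Filter.Eventually.of_forall fun η => ?_)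
    simp only [kernelAverage]
    rw [← integral_const_mul]
    refine integral_congr_ae (Filter.Eventually.of_forall fun s => ?_)
    simp only [transportKernel, transportMap, θ]
    by_cases hx : z.1 - s • η ∈ Ω
    · rw [Set.indicator_of_mem (by simpa using hx)]
      ring
    · rw [Set.indicator_of_notMem (by simpa using hx), hG0 _ hx]
      ring
  have h6 := hκG (fun w => G (z.1 - w)) cG (by fun_prop) fun w => hGc _
  simp only at h6 h5 ⊢
  rw [h5, h6, ← integral_sub_left_eq_self (fun w => κ w * G (z.1 - w)) volume z.1,
    ← integral_const_mul]
  simp only [kernelAverage, positionMap, id]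
  rw [setIntegral_eq_integral_of_forall_compl_eq_zero]
  · refine integral_congr_ae (Filter.Eventually.of_forall fun y => ?_)
    simp only [sub_sub_cancel]
    ring
  · intro y hy
    rw [hG0 y hy]
    ring

/-- Let `V` be an integral operator in the velocity whose kernel depends continuously in mean on the
outgoing velocity, and `S` the transport solution operator of a bounded domain. Then `(S V)²` is
compact on `L^∞(Ω × ℝ³)`. -/
theorem isCompactOperator_transport_velocity_sq {Ω : Set E3} (hΩ : MeasurableSet Ω)
    (hΩb : Bornology.IsBounded Ω) {ν : E3 → ℝ} (hν : Measurable ν) {ν₀ : ℝ} (hν₀ : 0 < ν₀)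
    (hνν₀ : ∀ ζ, ν₀ ≤ ν ζ) {C D : ℝ}
    (hS : IsAdmissible (phaseMeasure Ω) (volume.restrict (Set.Ioi 0)) transportMap
      (transportKernel Ω ν fun _ => 1) C)
    {k : E3 × E3 → ℝ} (hk : Measurable k) (hD : 0 ≤ D)
    (hb : ∀ ζ, ∫⁻ η, ‖k (ζ, η)‖ₑ ≤ ENNReal.ofReal D)
    (hcont : ∀ c, Filter.Tendsto (fun ζ => ∫⁻ η, ‖k (ζ, η) - k (c, η)‖ₑ) (nhds c) (nhds 0)) :
    IsCompactOperator ((hS.toCLM.comp (isAdmissible_velocity Ω hk hD hb).toCLM).comp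
      (hS.toCLM.comp (isAdmissible_velocity Ω hk hD hb).toCLM)) := by
  set L := Lp ℝ ∞ (phaseMeasure Ω)
  set V : L →L[ℝ] L := (isAdmissible_velocity Ω hk hD hb).toCLM with hV
  set S : L →L[ℝ] L := hS.toCLM with hSdef
  set P : Submodule ℝ (L →L[ℝ] L) := Submodule.span ℝ {T | IsProductKernel Ω T} with hP
  -- products of operators in the closure of `P` with `S` in between are compact
  have hclosed : ∀ (A B : L →L[ℝ] L), IsClosed {T : L →L[ℝ] L | IsCompactOperator (T.comp B)} ∧
      IsClosed {T : L →L[ℝ] L | IsCompactOperator (A.comp T)} := by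
    intro A B
    have hcl : IsClosed {f : L →L[ℝ] L | IsCompactOperator f} :=
      isClosed_setOfPred_isCompactOperator
    exact ⟨hcl.preimage (f := fun T : L →L[ℝ] L => T.comp B) (by fun_prop),
      hcl.preimage (f := fun T : L →L[ℝ] L => A.comp T) (by fun_prop)⟩
  have hcomp1 : ∀ T₂, IsProductKernel Ω T₂ → ∀ T₁ ∈ P.topologicalClosure,
      IsCompactOperator (T₁.comp (S.comp T₂)) := by
    intro T₂ h₂ T₁ h₁
    refine closure_minimal (s := (P : Set (L →L[ℝ] L))) ?_ (hclosed 0 (S.comp T₂)).1 h₁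
    intro T hT
    refine Submodule.span_induction (p := fun T _ => IsCompactOperator (T.comp (S.comp T₂)))
      ?_ ?_ ?_ ?_ hT
    · intro T hT
      exact isCompactOperator_product_transport_product hΩ hΩb hν hν₀ hνν₀ hS hT h₂
    · rw [ContinuousLinearMap.zero_comp]
      exact isCompactOperator_zero
    · intro T T' _ _ h h'
      rw [ContinuousLinearMap.add_comp]
      exact h.add h'
    · intro c T _ h
      rw [ContinuousLinearMap.smul_comp]
      exact h.smul c
  have hcomp : ∀ T₁ ∈ P.topologicalClosure, ∀ T₂ ∈ P.topologicalClosure,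
      IsCompactOperator (T₁.comp (S.comp T₂)) := by
    intro T₁ h₁ T₂ h₂
    refine closure_minimal (s := (P : Set (L →L[ℝ] L))) ?_ (hclosed (T₁.comp S) 0).2 h₂
    intro T hT
    refine Submodule.span_induction (p := fun T _ => IsCompactOperator ((T₁.comp S).comp T))
      ?_ ?_ ?_ ?_ hT
    · intro T hT
      exact hcomp1 T hT T₁ h₁
    · rw [ContinuousLinearMap.comp_zero]
      exact isCompactOperator_zero
    · intro T T' _ _ h h'
      rw [ContinuousLinearMap.comp_add]
      exact h.add h'
    · intro c T _ h
      rw [ContinuousLinearMap.comp_smul]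
      exact h.smul c
  -- the part of the kernel with `|ζ| ≤ R`
  let χ : ℝ → E3 → ℝ := fun R => (Metric.closedBall (0 : E3) R).indicator fun _ => 1
  have hχm : ∀ R, Measurable (χ R) := fun R =>
    measurable_const.indicator Metric.isClosed_closedBall.measurableSet
  have hχ1 : ∀ R ζ, |χ R ζ| ≤ 1 := by
    intro R ζ
    by_cases h : ζ ∈ Metric.closedBall (0 : E3) R
    · simp [χ, Set.indicator_of_mem h]
    · simp [χ, Set.indicator_of_notMem h]
  have hkR : ∀ R, Measurable fun q : E3 × E3 => χ R q.1 * k q := by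
    intro R
    have := hχm R
    fun_prop
  have hbR : ∀ R ζ, ∫⁻ η, ‖χ R ζ * k (ζ, η)‖ₑ ≤ ENNReal.ofReal D := by
    intro R ζ
    refine (lintegral_mono fun η => ?_).trans (hb ζ)
    rw [enorm_mul]
    refine mul_le_of_le_one_left' ?_
    rw [← ofReal_norm, ← ENNReal.ofReal_one]
    exact ENNReal.ofReal_le_ofReal (hχ1 R ζ)
  let VR : ℝ → L →L[ℝ] L := fun R => (isAdmissible_velocity Ω (hkR R) hD (hbR R)).toCLM
  have hVR : ∀ R, VR R ∈ P.topologicalClosure := by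
    intro R
    rw [← SetLike.mem_coe, Submodule.topologicalClosure_coe, Metric.mem_closure_iff]
    intro ε hε
    obtain ⟨σ, hσ⟩ := exists_simpleFunc_lintegral_le (k := fun ζ η => k (ζ, η)) hcont
      (isCompact_closedBall (0 : E3) R) (ENNReal.ofReal_pos.2 (half_pos hε))
    have hint : ∀ c, Integrable fun η => k (c, η) := fun c =>
      ⟨(hk.comp measurable_prodMk_left).aestronglyMeasurable,
        lt_of_le_of_lt (hb c) ENNReal.ofReal_lt_top⟩
    have hbσ : ∀ ζ, ∫⁻ η, ‖χ R ζ * k (σ ζ, η)‖ₑ ≤ ENNReal.ofReal D := by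
      intro ζ
      refine (lintegral_mono fun η => ?_).trans (hb (σ ζ))
      rw [enorm_mul]
      refine mul_le_of_le_one_left' ?_
      rw [← ofReal_norm, ← ENNReal.ofReal_one]
      exact ENNReal.ofReal_le_ofReal (hχ1 R ζ)
    have hkσ : Measurable fun q : E3 × E3 => χ R q.1 * k (σ q.1, q.2) := by
      have := hχm R
      have := σ.measurable
      fun_prop
    have hσad := isAdmissible_velocity Ω hkσ hD hbσ
    have ham : ∀ c, Measurable fun ζ => χ R ζ * (σ ⁻¹' {c}).indicator (fun _ => (1 : ℝ)) ζ :=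
      fun c => (hχm R).mul (measurable_indicator_simpleFunc σ c)
    have ha1 : ∀ c ζ, |χ R ζ * (σ ⁻¹' {c}).indicator (fun _ => (1 : ℝ)) ζ| ≤ 1 := by
      intro c ζ
      rw [abs_mul]
      refine mul_le_one₀ (hχ1 R ζ) (abs_nonneg _) ?_
      by_cases h : ζ ∈ σ ⁻¹' {c}
      · simp [Set.indicator_of_mem h]
      · simp [Set.indicator_of_notMem h]
    have hcad := fun c => isAdmissible_product Ω (ham c) (ha1 c)
      (hk.comp (measurable_prodMk_left (x := c))) (hint c)
    refine ⟨hσad.toCLM, ?_, ?_⟩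
    · rw [hσad.toCLM_eq_sum σ.range hcad]
      · refine P.sum_mem fun c _ => Submodule.subset_span ?_
        exact isProductKernel_toCLM (ham c) (ha1 c) (hk.comp measurable_prodMk_left) (hint c) _
      · intro q
        simp only [Function.comp, mul_assoc]
        rw [← Finset.mul_sum, ← simpleFunc_sum_indicator σ (fun c => k (c, q.2)) q.1.2]
    · rw [dist_eq_norm_sub]
      refine lt_of_le_of_lt (IsAdmissible.norm_toCLM_sub_le _ _ (half_pos hε).le ?_)
        (half_lt_self hε)
      refine Filter.Eventually.of_forall fun z => ?_
      by_cases h : z.2 ∈ Metric.closedBall (0 : E3) R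
      · simpa [χ, Set.indicator_of_mem h] using hσ z.2 h
      · simp [χ, Set.indicator_of_notMem h]
  -- the remaining part is small after transport
  obtain ⟨r, hr⟩ := hΩb.subset_closedBall (0 : E3)
  have hΩr : ∀ x ∈ Ω, ‖x‖ ≤ |r| := fun x hx => by
    have := hr hx
    rw [mem_closedBall_zero_iff] at this
    exact this.trans (le_abs_self r)
  have hsmall : ∀ R : ℝ, 0 < R → ‖S.comp V - S.comp (VR R)‖ ≤ 2 * |r| / R * ‖V‖ := by
    intro R hR
    have hχ' : ∀ ζ, |1 - χ R ζ| ≤ 1 := by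
      intro ζ
      by_cases h : ζ ∈ Metric.closedBall (0 : E3) R
      · simp [χ, Set.indicator_of_mem h]
      · simp [χ, Set.indicator_of_notMem h]
    have hSR := isAdmissible_transport (Ω := Ω) (ν := ν) (χ := fun ζ => 1 - χ R ζ)
      (C := 2 * |r| / R) hΩ hν
      (measurable_const.sub (hχm R)) (by positivity)
      (fun x hx ζ => lintegral_transportKernel_le_of_fast hR hΩr
        (fun ζ => hν₀.le.trans (hνν₀ ζ)) hχ'
        (fun ζ hζ => by simp [χ, Set.indicator_of_mem (mem_closedBall_zero_iff.2 hζ)]) hx ζ)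
    have heq : S.comp V - S.comp (VR R) = hSR.toCLM.comp V := by
      rw [← ContinuousLinearMap.comp_sub]
      ext1 F
      refine Lp.ext ?_
      have h1 : (fun z : E3 × E3 => (1 - χ R z.2) * V F z) =ᵐ[phaseMeasure Ω] (V - VR R) F := by
        rw [sub_apply]
        filter_upwards [Lp.coeFn_sub (V F) (VR R F),
          (isAdmissible_velocity Ω hk hD hb).coeFn_toCLM F,
          (isAdmissible_velocity Ω (hkR R) hD (hbR R)).coeFn_toCLM F] with z h1 h2 h3
        rw [h1, Pi.sub_apply, h3, h2]
        simp only [kernelAverage, mul_assoc]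
        rw [integral_const_mul]
        ring
      refine (hS.toCLM_ae_eq h1).trans ?_
      refine Filter.EventuallyEq.trans ?_ (hSR.coeFn_toCLM (V F)).symm
      refine Filter.Eventually.of_forall fun z => ?_
      refine integral_congr_ae (Filter.Eventually.of_forall fun s => ?_)
      simp only [transportKernel, transportMap]
      by_cases hx : z.1 - s • z.2 ∈ Ω
      · rw [Set.indicator_of_mem (by simpa using hx), Set.indicator_of_mem (by simpa using hx)]
        ring
      · rw [Set.indicator_of_notMem (by simpa using hx), Set.indicator_of_notMem (by simpa using hx)]
        ring
    rw [heq]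
    refine (ContinuousLinearMap.opNorm_comp_le _ _).trans ?_
    gcongr
    exact hSR.norm_toCLM_le
  have htend : Filter.Tendsto (fun n : ℕ => S.comp (VR (n + 1))) Filter.atTop
      (nhds (S.comp V)) := by
    rw [tendsto_iff_norm_sub_tendsto_zero]
    have h0 : Filter.Tendsto (fun n : ℕ => 2 * |r| / ((n : ℝ) + 1) * ‖V‖) Filter.atTop
        (nhds 0) := by
      have := (tendsto_const_div_atTop_nhds_zero_nat (2 * |r|)).comp (Filter.tendsto_add_atTop_nat 1)
      simpa using this.mul_const ‖V‖
    refine squeeze_zero (fun n => norm_nonneg _) (fun n => ?_) h0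
    rw [norm_sub_rev]
    exact hsmall _ (by positivity)
  have htend2 : Filter.Tendsto (fun n : ℕ => (S.comp (VR (n + 1))).comp (S.comp (VR (n + 1))))
      Filter.atTop (nhds ((S.comp V).comp (S.comp V))) := by
    have hc : Continuous fun T : L →L[ℝ] L => T.comp T := by fun_prop
    exact (hc.tendsto (S.comp V)).comp htend
  refine isCompactOperator_of_tendsto htend2 (Filter.Eventually.of_forall fun n => ?_)
  exact (hcomp _ (hVR _) _ (hVR _)).clm_comp S

/-! ### Spherical coordinates with respect to an orthonormal frame -/

lemma measurePreserving_frame {u v w : E3} (h : Orthonormal ℝ ![u, v, w]) :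
    MeasurePreserving (fun q : ℝ × ℝ × ℝ => q.1 • u + q.2.1 • v + q.2.2 • w) volume volume := by
  have hspan : ⊤ ≤ Submodule.span ℝ (Set.range ![u, v, w]) :=
    (h.linearIndependent.span_eq_top_of_card_eq_finrank (by simp)).ge
  let b : OrthonormalBasis (Fin 3) ℝ E3 := OrthonormalBasis.mk h hspan
  have h1 := (volume_preserving_piFinSuccAbove (fun _ : Fin 3 => ℝ) 0).symm
  have h2 : MeasurePreserving (Prod.map id (MeasurableEquiv.piFinTwo fun _ => ℝ).symm)
      (volume : Measure (ℝ × ℝ × ℝ)) (volume : Measure (ℝ × (Fin 2 → ℝ))) :=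
    (MeasurePreserving.id volume).prod (volume_preserving_piFinTwo fun _ => ℝ).symm
  have h3 := b.measurePreserving_repr_symm.comp
    ((PiLp.volume_preserving_toLp (Fin 3)).comp (h1.comp h2))
  convert h3 using 1
  ext1 q
  have : ∀ x : E3, b.repr.symm x = ∑ i, x i • b i := fun x => (b.sum_repr_symm x).symm
  simp only [Function.comp, this, Fin.sum_univ_three]
  simp [b, MeasurableEquiv.piFinSuccAbove, MeasurableEquiv.piFinTwo, Fin.insertNthEquiv]

/-- The surface measure of the unit sphere, as a measure on `ℝ³`. -/
def sphereMeasure : Measure E3 := (volume : Measure E3).toSphere.map Subtype.val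

instance : IsFiniteMeasure sphereMeasure := by
  unfold sphereMeasure
  infer_instance

lemma ae_sphereMeasure_norm : ∀ᵐ ω ∂sphereMeasure, ‖ω‖ = 1 := by
  unfold sphereMeasure
  rw [ae_map_iff measurable_subtype_coe.aemeasurable (measurableSet_eq_fun (by fun_prop) (by fun_prop))]
  exact Filter.Eventually.of_forall fun ω => by simp

/-- Polar coordinates in `ℝ³`. -/
lemma lintegral_polar {f : E3 → ℝ≥0∞} (hf : Measurable f) :
    ∫⁻ w, f w = ∫⁻ ω, ∫⁻ r in Set.Ioi (0 : ℝ), ENNReal.ofReal (r ^ 2) * f (r • ω) ∂volume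
      ∂sphereMeasure := by
  have h0 : ∫⁻ w, f w = ∫⁻ w : ({0}ᶜ : Set E3), f w ∂((volume : Measure E3).comap Subtype.val) := by
    rw [lintegral_subtype_comap (measurableSet_singleton _).compl, restrict_compl_singleton]
  have h1 := (volume : Measure E3).measurePreserving_homeomorphUnitSphereProd
  have h2 : ∫⁻ w : ({0}ᶜ : Set E3), f w ∂((volume : Measure E3).comap Subtype.val) =
      ∫⁻ q, f (q.2.1 • q.1.1) ∂((volume : Measure E3).toSphere.prod
        (Measure.volumeIoiPow (Module.finrank ℝ E3 - 1))) := by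
    rw [← h1.lintegral_comp (by fun_prop)]
    refine lintegral_congr fun w => ?_
    congr 1
    have hw : (w : E3) ≠ 0 := w.2
    simp [smul_smul, mul_inv_cancel₀ (norm_ne_zero_iff.2 hw)]
  rw [h0, h2, lintegral_prod _ (by fun_prop), sphereMeasure, lintegral_map]
  · refine lintegral_congr fun ω => ?_
    have h3 : Module.finrank ℝ E3 - 1 = 2 := by simp
    rw [h3, Measure.volumeIoiPow, lintegral_withDensity_eq_lintegral_mul _ (by fun_prop)
      (by fun_prop)]
    exact lintegral_subtype_comap measurableSet_Ioi
      (fun r : ℝ => ENNReal.ofReal (r ^ 2) * f (r • (ω : E3)))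
  · refine Measurable.lintegral_prod_right' (f := fun q : E3 × ℝ =>
      ENNReal.ofReal (q.2 ^ 2) * f (q.2 • q.1)) (by fun_prop)
  · exact measurable_subtype_coe

lemma lintegral_polarCoord_right {f : ℝ × ℝ × ℝ → ℝ≥0∞} (hf : Measurable f) :
    ∫⁻ q, f q = ∫⁻ φ in Set.Ioo (-Real.pi) Real.pi, ∫⁻ q in Set.univ ×ˢ Set.Ioi (0 : ℝ),
      ENNReal.ofReal q.2 * f (q.1, q.2 * Real.cos φ, q.2 * Real.sin φ)
        ∂(volume : Measure (ℝ × ℝ)) := by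
  have h1 : ∀ t : ℝ, ∫⁻ p : ℝ × ℝ, f (t, p) = ∫⁻ φ in Set.Ioo (-Real.pi) Real.pi,
      ∫⁻ r in Set.Ioi (0 : ℝ), ENNReal.ofReal r * f (t, r * Real.cos φ, r * Real.sin φ) := by
    intro t
    rw [← lintegral_comp_polarCoord_symm, polarCoord_target, Measure.volume_eq_prod,
      ← Measure.prod_restrict, lintegral_prod_symm]
    · rfl
    · simp only [polarCoord_symm_apply]
      exact Measurable.aemeasurable (by fun_prop)
  rw [Measure.volume_eq_prod, lintegral_prod _ hf.aemeasurable]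
  simp only [h1]
  rw [lintegral_lintegral_swap]
  · refine lintegral_congr fun φ => ?_
    rw [Measure.volume_eq_prod, ← Measure.prod_restrict, Measure.restrict_univ,
      lintegral_prod _ (Measurable.aemeasurable (by fun_prop))]
  · refine Measurable.aemeasurable ?_
    refine Measurable.lintegral_prod_right' (f := fun q : (ℝ × ℝ) × ℝ => ENNReal.ofReal q.2 *
      f (q.1.1, q.2 * Real.cos q.1.2, q.2 * Real.sin q.1.2)) (by fun_prop)

lemma lintegral_quadrant_polar {f : ℝ × ℝ → ℝ≥0∞} (hf : Measurable f)
    (hf0 : ∀ t r, t ≤ 0 → f (t, r) = 0) :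
    ∫⁻ q in Set.univ ×ˢ Set.Ioi (0 : ℝ), f q = ∫⁻ θ in Set.Ioo 0 (Real.pi / 2),
      ∫⁻ ρ in Set.Ioi (0 : ℝ), ENNReal.ofReal ρ * f (ρ * Real.cos θ, ρ * Real.sin θ) := by
  have hms : MeasurableSet ((Set.univ : Set ℝ) ×ˢ Set.Ioi (0 : ℝ)) :=
    MeasurableSet.univ.prod measurableSet_Ioi
  rw [← lintegral_indicator hms, ← lintegral_comp_polarCoord_symm, polarCoord_target,
    Measure.volume_eq_prod, ← Measure.prod_restrict, lintegral_prod_symm]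
  · simp only [polarCoord_symm_apply]
    have hsub : Set.Ioo 0 (Real.pi / 2) ⊆ Set.Ioo (-Real.pi) Real.pi :=
      Set.Ioo_subset_Ioo (by linarith [Real.pi_pos]) (by linarith [Real.pi_pos])
    rw [← Set.inter_eq_self_of_subset_left hsub, ← setLIntegral_indicator measurableSet_Ioo]
    refine setLIntegral_congr_fun measurableSet_Ioo fun θ hθ => ?_
    by_cases h : θ ∈ Set.Ioo 0 (Real.pi / 2)
    · simp only [Set.indicator_of_mem h]
      refine setLIntegral_congr_fun measurableSet_Ioi fun ρ hρ => ?_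
      have hs : 0 < Real.sin θ := Real.sin_pos_of_pos_of_lt_pi h.1 hθ.2
      simp only [smul_eq_mul]
      rw [Set.indicator_of_mem]
      exact ⟨trivial, mul_pos hρ hs⟩
    · simp only [Set.indicator_of_notMem h]
      refine (setLIntegral_congr_fun measurableSet_Ioi (g := fun _ => 0) fun ρ hρ => ?_).trans
        (by simp)
      simp only [smul_eq_mul]
      by_cases hs : 0 < Real.sin θ
      · -- then `θ` lies in `[π/2, π)`, where the cosine is not positive
        have hθ0 : 0 < θ := by
          by_contra hcon
          exact absurd hs (not_lt.2 (Real.sin_nonpos_of_nonpos_of_neg_pi_le (not_lt.1 hcon) hθ.1.le))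
        have hθ1 : Real.pi / 2 ≤ θ := by
          by_contra hcon
          exact h ⟨hθ0, not_le.1 hcon⟩
        have hc : Real.cos θ ≤ 0 :=
          Real.cos_nonpos_of_pi_div_two_le_of_le hθ1 (by linarith [hθ.2, Real.pi_pos])
        have : ρ * Real.cos θ ≤ 0 := mul_nonpos_of_nonneg_of_nonpos (le_of_lt hρ) hc
        rw [Set.indicator_apply, hf0 _ _ this]
        simp
      · rw [Set.indicator_of_notMem, mul_zero]
        intro hmem
        exact hs (pos_of_mul_pos_right hmem.2 (le_of_lt hρ))
  · simp only [polarCoord_symm_apply]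
    have : Measurable ((Set.univ ×ˢ Set.Ioi (0 : ℝ)).indicator f) := hf.indicator hms
    exact Measurable.aemeasurable (by fun_prop)

/-- Integration over the half sphere around `u` in spherical coordinates. -/
lemma lintegral_halfSphere {u v w : E3} (h : Orthonormal ℝ ![u, v, w]) {g : E3 → ℝ≥0∞}
    (hg : Measurable g) :
    ∫⁻ ω, {ω | 0 < inner ℝ ω u}.indicator g ω ∂sphereMeasure =
      ∫⁻ φ in Set.Ioc 0 (2 * Real.pi), ∫⁻ θ in Set.Ioc 0 (Real.pi / 2), ENNReal.ofReal (Real.sin θ) *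
        g (Real.cos θ • u + (Real.sin θ * Real.cos φ) • v + (Real.sin θ * Real.sin φ) • w) := by
  set J : ℝ≥0∞ := ∫⁻ r in Set.Ioc (0 : ℝ) 1, ENNReal.ofReal (r ^ 2) with hJ
  have hJ' : J = ENNReal.ofReal (1 / 3) := by
    rw [hJ, ← ofReal_integral_eq_lintegral_ofReal]
    · rw [← intervalIntegral.integral_of_le zero_le_one, integral_pow]
      norm_num
    · exact (intervalIntegral.intervalIntegrable_pow (μ := volume) (a := 0) (b := 1) 2).1
    · exact Filter.Eventually.of_forall fun r => sq_nonneg r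
  have hJ0 : J ≠ 0 := by rw [hJ']; simp
  have hJt : J ≠ ∞ := by rw [hJ']; simp
  set A : Set E3 := {ω | 0 < inner ℝ ω u} with hA
  have hAm : MeasurableSet A := measurableSet_lt measurable_const (by fun_prop)
  have hgA : Measurable (A.indicator g) := hg.indicator hAm
  -- test function: radially the indicator of the unit ball
  let f : E3 → ℝ≥0∞ := fun x =>
    (Metric.closedBall (0 : E3) 1).indicator (fun x => A.indicator g (‖x‖⁻¹ • x)) x
  have hfm : Measurable f := by
    refine Measurable.indicator ?_ Metric.isClosed_closedBall.measurableSet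
    fun_prop
  have hfr : ∀ ω : E3, ‖ω‖ = 1 → ∀ r : ℝ, 0 < r →
      f (r • ω) = (Set.Iic (1 : ℝ)).indicator (fun _ => A.indicator g ω) r := by
    intro ω hω r hr
    have h1 : ‖r • ω‖ = r := by rw [norm_smul, hω, mul_one, Real.norm_of_nonneg hr.le]
    have h2 : r • ω ∈ Metric.closedBall (0 : E3) 1 ↔ r ∈ Set.Iic (1 : ℝ) := by
      rw [mem_closedBall_zero_iff, h1, Set.mem_Iic]
    have h3 : ‖r • ω‖⁻¹ • r • ω = ω := by rw [h1, smul_smul, inv_mul_cancel₀ hr.ne', one_smul]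
    simp only [f]
    by_cases hr1 : r ∈ Set.Iic (1 : ℝ)
    · rw [Set.indicator_of_mem (h2.2 hr1), Set.indicator_of_mem hr1, h3]
    · rw [Set.indicator_of_notMem (fun h => hr1 (h2.1 h)), Set.indicator_of_notMem hr1]
  have hrad : ∀ (c : ℝ≥0∞), ∫⁻ r in Set.Ioi (0 : ℝ), ENNReal.ofReal (r ^ 2) *
      (Set.Iic (1 : ℝ)).indicator (fun _ => c) r = J * c := by
    intro c
    have : ∀ r : ℝ, ENNReal.ofReal (r ^ 2) * (Set.Iic (1 : ℝ)).indicator (fun _ => c) r =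
        (Set.Iic (1 : ℝ)).indicator (fun r => ENNReal.ofReal (r ^ 2) * c) r := by
      intro r
      by_cases hr : r ∈ Set.Iic (1 : ℝ)
      · simp only [Set.indicator_of_mem hr]
      · simp only [Set.indicator_of_notMem hr, mul_zero]
    simp only [this]
    rw [setLIntegral_indicator measurableSet_Iic, Set.inter_comm, Set.Ioi_inter_Iic,
      lintegral_mul_const _ (by fun_prop)]
  have hleft : ∫⁻ x, f x = J * ∫⁻ ω, A.indicator g ω ∂sphereMeasure := by
    rw [lintegral_polar hfm, ← lintegral_const_mul _ hgA]
    refine lintegral_congr_ae ?_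
    filter_upwards [ae_sphereMeasure_norm] with ω hω
    rw [← hrad]
    refine setLIntegral_congr_fun measurableSet_Ioi fun r hr => ?_
    simp only [hfr ω hω r hr]
  let dir : ℝ → ℝ → E3 := fun φ θ =>
    Real.cos θ • u + (Real.sin θ * Real.cos φ) • v + (Real.sin θ * Real.sin φ) • w
  have hu : ‖u‖ = 1 := h.1 0
  have hvn : ‖v‖ = 1 := h.1 1
  have hwn : ‖w‖ = 1 := h.1 2
  have huv : inner ℝ v u = 0 := h.2 (show (1 : Fin 3) ≠ 0 by decide)
  have huw : inner ℝ w u = 0 := h.2 (show (2 : Fin 3) ≠ 0 by decide)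
  have hvw : inner ℝ v w = 0 := h.2 (show (1 : Fin 3) ≠ 2 by decide)
  have huv' : inner ℝ u v = 0 := h.2 (show (0 : Fin 3) ≠ 1 by decide)
  have huw' : inner ℝ u w = 0 := h.2 (show (0 : Fin 3) ≠ 2 by decide)
  have hwv : inner ℝ w v = 0 := h.2 (show (2 : Fin 3) ≠ 1 by decide)
  have hinner : ∀ a b c : ℝ, inner ℝ (a • u + b • v + c • w) u = a := by
    intro a b c
    simp only [inner_add_left, inner_smul_left, huv, huw, real_inner_self_eq_norm_sq, hu]
    simp
  have hnorm : ∀ a b c : ℝ, ‖a • u + b • v + c • w‖ ^ 2 = a ^ 2 + b ^ 2 + c ^ 2 := by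
    intro a b c
    rw [← real_inner_self_eq_norm_sq]
    simp only [inner_add_left, inner_add_right, inner_smul_left, inner_smul_right, huv, huw, hvw,
      huv', huw', hwv, real_inner_self_eq_norm_sq, hu, hvn, hwn]
    simp
    ring
  have hdirn : ∀ φ θ, ‖dir φ θ‖ = 1 := by
    intro φ θ
    have h1 : ‖dir φ θ‖ ^ 2 = 1 := by
      rw [hnorm]
      nlinarith [Real.sin_sq_add_cos_sq θ, Real.sin_sq_add_cos_sq φ]
    exact (pow_eq_one_iff_of_nonneg (norm_nonneg _) two_ne_zero).1 h1
  have hdirm : Measurable fun q : ℝ × ℝ => dir q.1 q.2 := by fun_prop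
  let Ψ : ℝ → ℝ≥0∞ := fun φ => ∫⁻ θ in Set.Ioo 0 (Real.pi / 2),
    ENNReal.ofReal (Real.sin θ) * g (dir φ θ)
  have hΨper : Function.Periodic Ψ (2 * Real.pi) := by
    intro φ
    simp only [Ψ, dir, Real.cos_add_two_pi, Real.sin_add_two_pi]
  have hright : ∫⁻ x, f x = J * ∫⁻ φ in Set.Ioo (-Real.pi) Real.pi, Ψ φ := by
    rw [← (measurePreserving_frame h).lintegral_comp hfm,
      lintegral_polarCoord_right (by fun_prop)]
    have hΨm : Measurable Ψ := Measurable.lintegral_prod_right'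
      (f := fun q : ℝ × ℝ => ENNReal.ofReal (Real.sin q.2) * g (dir q.1 q.2)) (by fun_prop)
    rw [← lintegral_const_mul _ hΨm]
    refine lintegral_congr fun φ => ?_
    rw [lintegral_quadrant_polar (by fun_prop)]
    · simp only [Ψ]
      rw [← lintegral_const_mul _ (by fun_prop)]
      refine setLIntegral_congr_fun measurableSet_Ioo fun θ hθ => ?_
      have hs : 0 < Real.sin θ :=
        Real.sin_pos_of_pos_of_lt_pi hθ.1 (by linarith [hθ.2, Real.pi_pos])
      have hc : 0 < Real.cos θ := Real.cos_pos_of_mem_Ioo ⟨by linarith [hθ.1, Real.pi_pos], hθ.2⟩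
      have hgdir : A.indicator g (dir φ θ) = g (dir φ θ) := by
        refine Set.indicator_of_mem ?_ _
        change 0 < inner ℝ (dir φ θ) u
        rwa [hinner]
      rw [← hgdir, ← mul_assoc, mul_comm J, mul_assoc, ← hrad,
        ← lintegral_const_mul' _ _ ENNReal.ofReal_ne_top]
      refine setLIntegral_congr_fun measurableSet_Ioi fun ρ hρ => ?_
      have hρ' : 0 < ρ := hρ
      rw [← hfr _ (hdirn φ θ) ρ hρ, ← mul_assoc, ← mul_assoc, ← ENNReal.ofReal_mul hρ'.le,
        ← ENNReal.ofReal_mul hs.le]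
      congr 2
      · ring
      · simp only [dir, smul_add, smul_smul, mul_assoc]
    · intro t r ht
      have : f (t • u + (r * Real.cos φ) • v + (r * Real.sin φ) • w) = 0 := by
        simp only [f]
        refine Set.indicator_apply_eq_zero.2 fun _ => Set.indicator_of_notMem ?_ _
        change ¬ 0 < inner ℝ _ u
        rw [inner_smul_left, hinner, not_lt]
        exact mul_nonpos_of_nonneg_of_nonpos (by simp) ht
      simp only [this, mul_zero]
  have h2 : ∫⁻ ω, A.indicator g ω ∂sphereMeasure =
      ∫⁻ φ in Set.Ioo (-Real.pi) Real.pi, Ψ φ :=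
    (ENNReal.mul_right_inj hJ0 hJt).1 (hleft.symm.trans hright)
  rw [h2, setLIntegral_congr Ioo_ae_eq_Ioc]
  have h2pi : 0 < 2 * Real.pi := by positivity
  have h3 := (isAddFundamentalDomain_Ioc h2pi (-Real.pi)).setLIntegral_eq
    (isAddFundamentalDomain_Ioc h2pi 0) Ψ (by
      rintro ⟨c, hc⟩ x
      obtain ⟨n, rfl⟩ := AddSubgroup.mem_zmultiples_iff.1 hc
      have := hΨper.zsmul n x
      rw [AddSubgroup.vadd_def, vadd_eq_add, add_comm]
      exact this)
  rw [show -Real.pi + 2 * Real.pi = Real.pi by ring, zero_add] at h3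
  rw [h3]
  refine lintegral_congr fun φ => ?_
  exact setLIntegral_congr Ioo_ae_eq_Ioc

/-! ### A measurable collision frame -/

/-- The second vector of a measurable collision frame: horizontal and orthogonal to `v`. -/
def stdE2 (v : E3) : E3 :=
  if (‖v‖⁻¹ • v) 0 ^ 2 + (‖v‖⁻¹ • v) 1 ^ 2 = 0 then !₂[1, 0, 0]
  else (Real.sqrt ((‖v‖⁻¹ • v) 0 ^ 2 + (‖v‖⁻¹ • v) 1 ^ 2))⁻¹ •
    !₂[-(‖v‖⁻¹ • v) 1, (‖v‖⁻¹ • v) 0, 0]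

/-- The third vector of a measurable collision frame: the cross product of `v / |v|` and
`stdE2 v`, up to sign when `v` is vertical. -/
def stdE3 (v : E3) : E3 :=
  if (‖v‖⁻¹ • v) 0 ^ 2 + (‖v‖⁻¹ • v) 1 ^ 2 = 0 then !₂[0, 1, 0]
  else (Real.sqrt ((‖v‖⁻¹ • v) 0 ^ 2 + (‖v‖⁻¹ • v) 1 ^ 2))⁻¹ •
    !₂[-((‖v‖⁻¹ • v) 2 * (‖v‖⁻¹ • v) 0), -((‖v‖⁻¹ • v) 2 * (‖v‖⁻¹ • v) 1),
      (‖v‖⁻¹ • v) 0 ^ 2 + (‖v‖⁻¹ • v) 1 ^ 2]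

lemma orthonormal_vec3 {u v w : E3} (hu : ‖u‖ = 1) (hv : ‖v‖ = 1) (hw : ‖w‖ = 1)
    (huv : inner ℝ u v = 0) (huw : inner ℝ u w = 0) (hvw : inner ℝ v w = 0) :
    Orthonormal ℝ ![u, v, w] := by
  constructor
  · intro i
    fin_cases i
    exacts [hu, hv, hw]
  · intro i j hij
    fin_cases i <;> fin_cases j <;>
      first
        | exact absurd rfl hij
        | assumption
        | (rw [real_inner_comm]; assumption)

lemma inner_eq_sum3 (u v : E3) : inner ℝ u v = u 0 * v 0 + u 1 * v 1 + u 2 * v 2 := by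
  simp [PiLp.inner_apply, Fin.sum_univ_three, mul_comm]

lemma norm_eq_one_of_sum3 {u : E3} (h : u 0 ^ 2 + u 1 ^ 2 + u 2 ^ 2 = 1) : ‖u‖ = 1 := by
  have h1 : ‖u‖ ^ 2 = 1 := by
    rw [← real_inner_self_eq_norm_sq, inner_eq_sum3]
    linarith
  exact (pow_eq_one_iff_of_nonneg (norm_nonneg _) two_ne_zero).1 h1

lemma isCollisionFrame_std : IsCollisionFrame stdE2 stdE3 := by
  intro v hv
  set n : E3 := ‖v‖⁻¹ • v with hn
  have hn1 : ‖n‖ = 1 := by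
    rw [hn, norm_smul, norm_inv, norm_norm, inv_mul_cancel₀ (norm_ne_zero_iff.2 hv)]
  have hsum : n 0 ^ 2 + n 1 ^ 2 + n 2 ^ 2 = 1 := by
    have h1 : ‖n‖ ^ 2 = 1 := by rw [hn1]; norm_num
    rw [← real_inner_self_eq_norm_sq, inner_eq_sum3] at h1
    linarith
  by_cases h : n 0 ^ 2 + n 1 ^ 2 = 0
  · have h0 : n 0 = 0 := by nlinarith [sq_nonneg (n 0), sq_nonneg (n 1)]
    have h1 : n 1 = 0 := by nlinarith [sq_nonneg (n 0), sq_nonneg (n 1)]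
    have e2 : stdE2 v = !₂[1, 0, 0] := if_pos h
    have e3 : stdE3 v = !₂[0, 1, 0] := if_pos h
    rw [e2, e3]
    refine orthonormal_vec3 hn1 (norm_eq_one_of_sum3 ?_) (norm_eq_one_of_sum3 ?_) ?_ ?_ ?_ <;>
      simp [inner_eq_sum3, h0, h1]
  · set ρ : ℝ := Real.sqrt (n 0 ^ 2 + n 1 ^ 2) with hρ
    have hpos : 0 < n 0 ^ 2 + n 1 ^ 2 := lt_of_le_of_ne (by positivity) (Ne.symm h)
    have hρ0 : 0 < ρ := Real.sqrt_pos.2 hpos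
    have hρ2 : ρ ^ 2 = n 0 ^ 2 + n 1 ^ 2 := Real.sq_sqrt hpos.le
    have e2 : stdE2 v = ρ⁻¹ • !₂[-n 1, n 0, 0] := if_neg h
    have e3 : stdE3 v = ρ⁻¹ • !₂[-(n 2 * n 0), -(n 2 * n 1), n 0 ^ 2 + n 1 ^ 2] := if_neg h
    rw [e2, e3]
    refine orthonormal_vec3 hn1 (norm_eq_one_of_sum3 ?_) (norm_eq_one_of_sum3 ?_) ?_ ?_ ?_ <;>
      simp only [inner_eq_sum3, PiLp.smul_apply, smul_eq_mul, Matrix.cons_val_zero,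
        Matrix.cons_val_one, Matrix.cons_val] <;> field_simp
    · rw [hρ2]
      ring
    · rw [hρ2]
      have : n 2 ^ 2 = 1 - (n 0 ^ 2 + n 1 ^ 2) := by linarith
      linear_combination (n 0 ^ 2 + n 1 ^ 2) * this
    all_goals ring

lemma measurable_stdE2 : Measurable stdE2 := by
  unfold stdE2
  refine Measurable.ite (measurableSet_eq_fun (by fun_prop) (by fun_prop)) measurable_const ?_
  fun_prop

lemma measurable_stdE3 : Measurable stdE3 := by
  unfold stdE3
  refine Measurable.ite (measurableSet_eq_fun (by fun_prop) (by fun_prop)) measurable_const ?_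
  fun_prop

lemma normalize_smul {t : ℝ} (ht : 0 < t) (v : E3) : ‖t • v‖⁻¹ • t • v = ‖v‖⁻¹ • v := by
  rw [norm_smul, Real.norm_of_nonneg ht.le, smul_smul, mul_inv, mul_right_comm,
    inv_mul_cancel₀ ht.ne', one_mul]

lemma stdE2_smul {t : ℝ} (ht : 0 < t) (v : E3) : stdE2 (t • v) = stdE2 v := by
  simp only [stdE2, normalize_smul ht]

lemma stdE3_smul {t : ℝ} (ht : 0 < t) (v : E3) : stdE3 (t • v) = stdE3 v := by
  simp only [stdE3, normalize_smul ht]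

/-! ### Carleman's change of variables -/

/-- The transferred velocity `(v · ω) ω` as a function of the relative velocity `v`. -/
def momentum (e₂ e₃ : E3 → E3) (v : E3) (θ φ : ℝ) : E3 :=
  (inner ℝ v (collisionDir e₂ e₃ v θ φ)) • collisionDir e₂ e₃ v θ φ

/-- The map that takes the relative velocity and the collision angles to the pair
`(ζ' - ζ, ζ_*' - ζ)` of orthogonal vectors. -/
def collisionMap (q : E3 × ℝ × ℝ) : E3 × E3 :=
  (momentum stdE2 stdE3 q.1 q.2.2 q.2.1, q.1 - momentum stdE2 stdE3 q.1 q.2.2 q.2.1)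

/-- The map that takes a vector `p` and coordinates in the orthogonal plane to the pair of `p` and
the corresponding vector of the plane. -/
def planeMap (q : E3 × ℝ × ℝ) : E3 × E3 :=
  (q.1, q.2.1 • stdE2 q.1 + q.2.2 • stdE3 q.1)

lemma measurable_momentum_std :
    Measurable fun q : E3 × ℝ × ℝ => momentum stdE2 stdE3 q.1 q.2.2 q.2.1 := by
  have h2 := measurable_stdE2
  have h3 := measurable_stdE3
  have h : Measurable fun q : E3 × ℝ × ℝ => collisionDir stdE2 stdE3 q.1 q.2.2 q.2.1 := by
    unfold collisionDir
    fun_prop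
  unfold momentum
  exact Measurable.smul (Measurable.inner (𝕜 := ℝ) measurable_fst h) h

lemma measurable_collisionMap : Measurable collisionMap :=
  measurable_momentum_std.prodMk (measurable_fst.sub measurable_momentum_std)

lemma measurable_planeMap : Measurable planeMap := by
  have h2 := measurable_stdE2
  have h3 := measurable_stdE3
  unfold planeMap
  fun_prop

lemma orthonormal_std {ω : E3} (hω : ‖ω‖ = 1) : Orthonormal ℝ ![ω, stdE2 ω, stdE3 ω] := by
  have h := isCollisionFrame_std ω (by rintro rfl; simp at hω)
  rwa [hω, inv_one, one_smul] at h

lemma inner_frame_left {u v w : E3} (h : Orthonormal ℝ ![u, v, w]) (a b c : ℝ) :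
    inner ℝ u (a • u + b • v + c • w) = a := by
  have hu : ‖u‖ = 1 := h.1 0
  have huv : inner ℝ u v = 0 := h.2 (show (0 : Fin 3) ≠ 1 by decide)
  have huw : inner ℝ u w = 0 := h.2 (show (0 : Fin 3) ≠ 2 by decide)
  simp only [inner_add_right, inner_smul_right, huv, huw, real_inner_self_eq_norm_sq, hu]
  simp

lemma inner_collisionDir {e₂ e₃ : E3 → E3} (he : IsCollisionFrame e₂ e₃) {v : E3} (hv : v ≠ 0)
    (θ φ : ℝ) : inner ℝ v (collisionDir e₂ e₃ v θ φ) = ‖v‖ * Real.cos θ := by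
  have h1 := inner_frame_left (he v hv) (Real.cos θ) (Real.sin θ * Real.cos φ)
    (Real.sin θ * Real.sin φ)
  rw [inner_smul_left] at h1
  simp only [conj_trivial] at h1
  have hv' : ‖v‖ ≠ 0 := norm_ne_zero_iff.2 hv
  rwa [inv_mul_eq_iff_eq_mul₀ hv'] at h1

/-- Carleman's change of variables: instead of over the relative velocity and the collision angles,
one integrates over `p = ζ' - ζ` and over the vectors `q = ζ_*' - ζ` in the plane orthogonal to `p`.
Both sides are computed by integrating over all pairs of a relative velocity and a direction `ω`. -/
theorem lintegral_carleman {F : E3 × E3 → ℝ≥0∞} (hF : Measurable F) :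
    ∫⁻ v, ∫⁻ φ in Set.Ioc 0 (2 * Real.pi), ∫⁻ θ in Set.Ioc 0 (Real.pi / 2),
        ENNReal.ofReal (Real.sin θ * Real.cos θ) * F (collisionMap (v, φ, θ)) =
      ∫⁻ p, ∫⁻ s : ℝ × ℝ, ENNReal.ofReal (‖p‖⁻¹ * ‖p + (planeMap (p, s)).2‖⁻¹) *
        F (planeMap (p, s)) := by
  have hpl := measurable_planeMap
  have h2 := measurable_stdE2
  have h3 := measurable_stdE3
  let g : E3 × E3 → ℝ≥0∞ := fun q => ENNReal.ofReal (inner ℝ q.1 q.2 * ‖q.2‖⁻¹) *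
    F ((inner ℝ q.2 q.1) • q.1, q.2 - (inner ℝ q.2 q.1) • q.1)
  have hg : Measurable g := by fun_prop
  let B : Set (E3 × E3) := {q | 0 < inner ℝ q.1 q.2}
  have hB : MeasurableSet B := measurableSet_lt measurable_const (by fun_prop)
  have hleft : ∀ v : E3, v ≠ 0 → ∫⁻ φ in Set.Ioc 0 (2 * Real.pi), ∫⁻ θ in Set.Ioc 0 (Real.pi / 2),
      ENNReal.ofReal (Real.sin θ * Real.cos θ) * F (collisionMap (v, φ, θ)) =
      ∫⁻ ω, B.indicator g (ω, v) ∂sphereMeasure := by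
    intro v hv
    have hv' : 0 < ‖v‖ := norm_pos_iff.2 hv
    have h1 := lintegral_halfSphere (isCollisionFrame_std v hv) (g := fun ω => g (ω, v))
      (by fun_prop)
    have h2 : ∀ ω : E3, {ω : E3 | 0 < inner ℝ ω (‖v‖⁻¹ • v)}.indicator (fun ω => g (ω, v)) ω =
        B.indicator g (ω, v) := by
      intro ω
      have h3 : ω ∈ {ω : E3 | 0 < inner ℝ ω (‖v‖⁻¹ • v)} ↔ (ω, v) ∈ B := by
        simp only [Set.mem_ofPred_eq, B, inner_smul_right]
        exact mul_pos_iff_of_pos_left (inv_pos.2 hv')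
      by_cases h4 : (ω, v) ∈ B
      · rw [Set.indicator_of_mem h4, Set.indicator_of_mem (h3.2 h4)]
      · rw [Set.indicator_of_notMem h4, Set.indicator_of_notMem fun h => h4 (h3.1 h)]
    simp only [h2] at h1
    rw [h1]
    refine lintegral_congr fun φ => setLIntegral_congr_fun measurableSet_Ioc fun θ hθ => ?_
    have hs : 0 ≤ Real.sin θ :=
      Real.sin_nonneg_of_nonneg_of_le_pi hθ.1.le (by linarith [hθ.2, Real.pi_pos])
    have h5 := inner_collisionDir isCollisionFrame_std hv θ φ
    have h6 : inner ℝ (collisionDir stdE2 stdE3 v θ φ) v * ‖v‖⁻¹ = Real.cos θ := by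
      rw [real_inner_comm, h5, mul_comm, inv_mul_cancel_left₀ hv'.ne']
    change _ = ENNReal.ofReal (Real.sin θ) * (ENNReal.ofReal
      (inner ℝ (collisionDir stdE2 stdE3 v θ φ) v * ‖v‖⁻¹) * F (collisionMap (v, φ, θ)))
    rw [h6, ENNReal.ofReal_mul hs, mul_assoc]
  have hright : ∀ ω : E3, ‖ω‖ = 1 → ∫⁻ v, B.indicator g (ω, v) =
      ∫⁻ r in Set.Ioi (0 : ℝ), ENNReal.ofReal (r ^ 2) * ∫⁻ s : ℝ × ℝ,
        ENNReal.ofReal (‖r • ω‖⁻¹ * ‖r • ω + (planeMap (r • ω, s)).2‖⁻¹) *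
          F (planeMap (r • ω, s)) := by
    intro ω hω
    have hfr := orthonormal_std hω
    have hgB : Measurable (B.indicator g) := hg.indicator hB
    rw [← (measurePreserving_frame hfr).lintegral_comp
      (f := fun v => B.indicator g (ω, v)) (by fun_prop), Measure.volume_eq_prod,
      lintegral_prod _ (Measurable.aemeasurable (by fun_prop)),
      ← lintegral_indicator measurableSet_Ioi]
    refine lintegral_congr fun t => ?_
    have hin : ∀ s : ℝ × ℝ,
        inner ℝ ω (t • ω + s.1 • stdE2 ω + s.2 • stdE3 ω) = t := fun s => inner_frame_left hfr _ _ _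
    by_cases ht : t ∈ Set.Ioi (0 : ℝ)
    · have ht' : 0 < t := ht
      rw [Set.indicator_of_mem ht, ← lintegral_const_mul _ (by fun_prop)]
      refine lintegral_congr fun s => ?_
      have hmem : (ω, t • ω + s.1 • stdE2 ω + s.2 • stdE3 ω) ∈ B := by
        change 0 < inner ℝ ω (t • ω + s.1 • stdE2 ω + s.2 • stdE3 ω)
        rwa [hin]
      have hpm : planeMap (t • ω, s) = (t • ω, s.1 • stdE2 ω + s.2 • stdE3 ω) := by
        simp only [planeMap, stdE2_smul ht', stdE3_smul ht']
      rw [Set.indicator_of_mem hmem]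
      simp only [g]
      have hin' := hin s
      rw [real_inner_comm] at hin'
      rw [hin s, hin', hpm, norm_smul, hω, Real.norm_of_nonneg ht'.le, ← mul_assoc,
        ← ENNReal.ofReal_mul (by positivity), add_assoc, add_sub_cancel_left]
      congr 2
      field_simp
    · rw [Set.indicator_of_notMem ht]
      refine (lintegral_congr fun s => ?_).trans lintegral_zero
      refine Set.indicator_of_notMem (fun hmem => ht ?_) _
      change 0 < inner ℝ ω (t • ω + s.1 • stdE2 ω + s.2 • stdE3 ω) at hmem
      rwa [hin] at hmem
  calc _ = ∫⁻ v : E3, ∫⁻ ω, B.indicator g (ω, v) ∂sphereMeasure := by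
        refine lintegral_congr_ae ?_
        have h0 : ∀ᵐ v : E3, v ≠ 0 := compl_mem_ae_iff.2 (measure_singleton 0)
        filter_upwards [h0] with v hv
        exact hleft v hv
    _ = ∫⁻ ω, (∫⁻ v, B.indicator g (ω, v)) ∂sphereMeasure :=
        lintegral_lintegral_swap (f := fun v ω => B.indicator g (ω, v))
          ((hg.indicator hB).comp measurable_swap).aemeasurable
    _ = ∫⁻ ω, (∫⁻ r in Set.Ioi (0 : ℝ), ENNReal.ofReal (r ^ 2) * (∫⁻ s : ℝ × ℝ,
        ENNReal.ofReal (‖r • ω‖⁻¹ * ‖r • ω + (planeMap (r • ω, s)).2‖⁻¹) *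
          F (planeMap (r • ω, s)))) ∂sphereMeasure := by
        refine lintegral_congr_ae ?_
        filter_upwards [ae_sphereMeasure_norm] with ω hω
        exact hright ω hω
    _ = _ := by
        refine (lintegral_polar (f := fun p => ∫⁻ s : ℝ × ℝ,
          ENNReal.ofReal (‖p‖⁻¹ * ‖p + (planeMap (p, s)).2‖⁻¹) * F (planeMap (p, s))) ?_).symm
        exact Measurable.lintegral_prod_right' (f := fun q : E3 × ℝ × ℝ =>
          ENNReal.ofReal (‖q.1‖⁻¹ * ‖q.1 + (planeMap q).2‖⁻¹) * F (planeMap q)) (by fun_prop)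

/-- The parameters of a collision: the relative velocity and the angles `(φ, θ)`, with the angular
density `sin θ cos θ`. -/
def collisionMeasure : Measure (E3 × ℝ × ℝ) :=
  ((volume : Measure E3).prod ((volume.restrict (Set.Ioc 0 (2 * Real.pi))).prod
    (volume.restrict (Set.Ioc 0 (Real.pi / 2))))).withDensity
      fun q => ENNReal.ofReal (Real.sin q.2.2 * Real.cos q.2.2)

/-- The measure on pairs of a vector `p` and coordinates in the plane orthogonal to `p` that
corresponds to `collisionMeasure`. -/
def planeMeasure : Measure (E3 × ℝ × ℝ) :=
  (volume : Measure (E3 × ℝ × ℝ)).withDensity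
    fun q => ENNReal.ofReal (‖q.1‖⁻¹ * ‖q.1 + (planeMap q).2‖⁻¹)

theorem map_collisionMap_collisionMeasure :
    collisionMeasure.map collisionMap = planeMeasure.map planeMap := by
  have hpl := measurable_planeMap
  have h2 := measurable_stdE2
  have h3 := measurable_stdE3
  have hcm := measurable_collisionMap
  refine Measure.ext_of_lintegral _ fun F hF => ?_
  have h := lintegral_carleman hF
  rw [lintegral_map hF hcm, lintegral_map hF hpl, collisionMeasure, planeMeasure,
    lintegral_withDensity_eq_lintegral_mul _ (by fun_prop) (by fun_prop),
    lintegral_withDensity_eq_lintegral_mul _ (by fun_prop) (by fun_prop),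
    Measure.volume_eq_prod, lintegral_prod _ (Measurable.aemeasurable (by fun_prop)),
    lintegral_prod _ (Measurable.aemeasurable (by fun_prop))]
  refine Eq.trans (lintegral_congr fun v => ?_) h
  rw [lintegral_prod _ (Measurable.aemeasurable (by fun_prop))]
  rfl

/-! ### Symmetries of the angular integration -/

lemma exists_cos_sin {c s : ℝ} (h : c ^ 2 + s ^ 2 = 1) : ∃ φ : ℝ, c = Real.cos φ ∧ s = Real.sin φ := by
  have hz : ‖(⟨c, s⟩ : ℂ)‖ = 1 := by
    rw [Complex.norm_def, Complex.normSq_mk, ← pow_two, ← pow_two, h, Real.sqrt_one]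
  have hz0 : (⟨c, s⟩ : ℂ) ≠ 0 := by
    intro h0
    rw [h0, norm_zero] at hz
    exact zero_ne_one hz
  refine ⟨Complex.arg ⟨c, s⟩, ?_, ?_⟩
  · rw [Complex.cos_arg hz0, hz, div_one]
  · rw [Complex.sin_arg, hz, div_one]

lemma eq_sum_frame {u v w : E3} (h : Orthonormal ℝ ![u, v, w]) (x : E3) :
    x = inner ℝ u x • u + inner ℝ v x • v + inner ℝ w x • w := by
  have hspan : ⊤ ≤ Submodule.span ℝ (Set.range ![u, v, w]) :=
    (h.linearIndependent.span_eq_top_of_card_eq_finrank (by simp)).ge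
  have h1 := (OrthonormalBasis.mk h hspan).sum_repr' x
  rw [Fin.sum_univ_three] at h1
  simpa using h1.symm

/-- Two frames with the same first vector differ by a rotation or a reflection of the angle, so that
they define the same angular averages. No measurability is involved. -/
lemma integral_angle_frame {u v w v' w' : E3} (h : Orthonormal ℝ ![u, v, w])
    (h' : Orthonormal ℝ ![u, v', w']) (H : E3 → ℝ) :
    ∫ φ in (0 : ℝ)..(2 * Real.pi), H (Real.cos φ • v' + Real.sin φ • w') =
      ∫ φ in (0 : ℝ)..(2 * Real.pi), H (Real.cos φ • v + Real.sin φ • w) := by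
  have huv' : inner ℝ u v' = 0 := h'.2 (show (0 : Fin 3) ≠ 1 by decide)
  have huw' : inner ℝ u w' = 0 := h'.2 (show (0 : Fin 3) ≠ 2 by decide)
  have hvw : inner ℝ v w = 0 := h.2 (show (1 : Fin 3) ≠ 2 by decide)
  have hwv : inner ℝ w v = 0 := h.2 (show (2 : Fin 3) ≠ 1 by decide)
  have hvw' : inner ℝ v' w' = 0 := h'.2 (show (1 : Fin 3) ≠ 2 by decide)
  have hv : ‖v‖ = 1 := h.1 1
  have hw : ‖w‖ = 1 := h.1 2
  have hv' : ‖v'‖ = 1 := h'.1 1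
  have hw' : ‖w'‖ = 1 := h'.1 2
  have e1 := eq_sum_frame h v'
  have e2 := eq_sum_frame h w'
  rw [huv', zero_smul, zero_add] at e1
  rw [huw', zero_smul, zero_add] at e2
  generalize inner ℝ v v' = c at e1
  generalize inner ℝ w v' = s at e1
  generalize inner ℝ v w' = c' at e2
  generalize inner ℝ w w' = s' at e2
  have hin : ∀ a b a' b' : ℝ, inner ℝ (a • v + b • w) (a' • v + b' • w) = a * a' + b * b' := by
    intro a b a' b'
    simp only [inner_add_left, inner_add_right, inner_smul_left, inner_smul_right, hvw, hwv,
      real_inner_self_eq_norm_sq, hv, hw, conj_trivial]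
    ring
  have hcs : c ^ 2 + s ^ 2 = 1 := by
    have := hin c s c s
    rw [← e1, real_inner_self_eq_norm_sq, hv'] at this
    linarith
  have hcs' : c' ^ 2 + s' ^ 2 = 1 := by
    have := hin c' s' c' s'
    rw [← e2, real_inner_self_eq_norm_sq, hw'] at this
    linarith
  have horth : c * c' + s * s' = 0 := by
    have := hin c s c' s'
    rw [← e1, ← e2, hvw'] at this
    linarith
  -- the determinant of the change of frame
  set ε : ℝ := c * s' - s * c' with hε
  have hc' : c' = -ε * s := by rw [hε]; linear_combination c * horth - c' * hcs
  have hs' : s' = ε * c := by rw [hε]; linear_combination s * horth - s' * hcs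
  have hε2 : ε ^ 2 = 1 := by
    rw [hc', hs'] at hcs'
    nlinarith
  obtain ⟨φ₀, rfl, rfl⟩ := exists_cos_sin hcs
  let I : ℝ → ℝ := fun x => H (Real.cos x • v + Real.sin x • w)
  have hI : Function.Periodic I (2 * Real.pi) := by
    intro x
    simp only [I, Real.cos_add_two_pi, Real.sin_add_two_pi]
  have key : ∀ φ, H (Real.cos φ • v' + Real.sin φ • w') = I (φ₀ + ε * φ) := by
    intro φ
    simp only [I]
    congr 1
    rw [e1, e2, hc', hs']
    rcases sq_eq_one_iff.1 hε2 with h1 | h1 <;> rw [h1]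
    · rw [show (1 : ℝ) * φ = φ from one_mul φ, Real.cos_add, Real.sin_add]
      module
    · rw [show (-1 : ℝ) * φ = -φ by ring, Real.cos_add, Real.sin_add, Real.cos_neg, Real.sin_neg]
      module
  simp only [key]
  change _ = ∫ φ in (0 : ℝ)..(2 * Real.pi), I φ
  have hshift : ∀ t, ∫ x in t..t + 2 * Real.pi, I x = ∫ x in (0 : ℝ)..(2 * Real.pi), I x := by
    intro t
    rw [hI.intervalIntegral_add_eq t 0, zero_add]
  rcases sq_eq_one_iff.1 hε2 with h1 | h1
  · simp only [h1, one_mul]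
    rw [intervalIntegral.integral_comp_add_left, add_zero, hshift]
  · simp only [h1, neg_one_mul, ← sub_eq_add_neg]
    rw [intervalIntegral.integral_comp_sub_left, sub_zero, ← hshift (φ₀ - 2 * Real.pi),
      sub_add_cancel]

lemma collisionDir_eq (e₂ e₃ : E3 → E3) (v : E3) (θ φ : ℝ) :
    collisionDir e₂ e₃ v θ φ =
      Real.cos θ • (‖v‖⁻¹ • v) + Real.sin θ • (Real.cos φ • e₂ v + Real.sin φ • e₃ v) := by
  unfold collisionDir
  module

lemma momentum_zero (e₂ e₃ : E3 → E3) (θ φ : ℝ) : momentum e₂ e₃ 0 θ φ = 0 := by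
  simp [momentum]

/-- The collision operator does not depend on the frame. -/
lemma collisionQ_frame {e₂ e₃ : E3 → E3} (he : IsCollisionFrame e₂ e₃) (B₀ γ : ℝ) (F G : E3 → ℝ)
    (ζ : E3) : collisionQ e₂ e₃ B₀ γ F G ζ = collisionQ stdE2 stdE3 B₀ γ F G ζ := by
  unfold collisionQ
  congr 1
  ext1 ζs
  change ∫ φ in (0 : ℝ)..(2 * Real.pi), ∫ θ in (0 : ℝ)..(Real.pi / 2),
      (F (ζ + momentum e₂ e₃ (ζs - ζ) θ φ) * G (ζs - momentum e₂ e₃ (ζs - ζ) θ φ) - F ζ * G ζs)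
        * crossSection B₀ γ ‖ζ - ζs‖ θ = ∫ φ in (0 : ℝ)..(2 * Real.pi),
      ∫ θ in (0 : ℝ)..(Real.pi / 2), (F (ζ + momentum stdE2 stdE3 (ζs - ζ) θ φ) *
        G (ζs - momentum stdE2 stdE3 (ζs - ζ) θ φ) - F ζ * G ζs) * crossSection B₀ γ ‖ζ - ζs‖ θ
  rcases eq_or_ne (ζs - ζ) 0 with hv | hv
  · simp only [hv, momentum_zero]
  · simp only [momentum, collisionDir_eq]
    exact integral_angle_frame (isCollisionFrame_std _ hv) (he _ hv) fun n =>
      ∫ θ in (0 : ℝ)..(Real.pi / 2),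
      (F (ζ + (inner ℝ (ζs - ζ) (Real.cos θ • (‖ζs - ζ‖⁻¹ • (ζs - ζ)) + Real.sin θ • n)) •
        (Real.cos θ • (‖ζs - ζ‖⁻¹ • (ζs - ζ)) + Real.sin θ • n)) *
       G (ζs - (inner ℝ (ζs - ζ) (Real.cos θ • (‖ζs - ζ‖⁻¹ • (ζs - ζ)) + Real.sin θ • n)) •
        (Real.cos θ • (‖ζs - ζ‖⁻¹ • (ζs - ζ)) + Real.sin θ • n)) - F ζ * G ζs)
        * crossSection B₀ γ ‖ζ - ζs‖ θ

/-- Replacing `θ` by `π / 2 - θ` and `φ` by `φ + π` exchanges the two velocities after the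
collision. -/
lemma momentum_swap (v : E3) (θ φ : ℝ) :
    momentum stdE2 stdE3 v (Real.pi / 2 - θ) (φ + Real.pi) =
      v - momentum stdE2 stdE3 v θ φ := by
  rcases eq_or_ne v 0 with rfl | hv
  · simp [momentum_zero]
  have hv' : ‖v‖ ≠ 0 := norm_ne_zero_iff.2 hv
  unfold momentum
  rw [inner_collisionDir isCollisionFrame_std hv, inner_collisionDir isCollisionFrame_std hv]
  simp only [collisionDir_eq, Real.cos_pi_div_two_sub, Real.sin_pi_div_two_sub, Real.cos_add_pi,
    Real.sin_add_pi]
  have h1 : v = ‖v‖ • (‖v‖⁻¹ • v) := by rw [smul_smul, mul_inv_cancel₀ hv', one_smul]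
  generalize ‖v‖⁻¹ • v = n at h1 ⊢
  have h2 : v = (‖v‖ * (Real.sin θ ^ 2 + Real.cos θ ^ 2)) • n := by
    rw [Real.sin_sq_add_cos_sq, mul_one]
    exact h1
  refine Eq.trans ?_ (congrArg (· - _) h2.symm)
  module

lemma crossSection_swap (B₀ γ r θ : ℝ) :
    crossSection B₀ γ r (Real.pi / 2 - θ) = crossSection B₀ γ r θ := by
  simp only [crossSection, Real.cos_pi_div_two_sub, Real.sin_pi_div_two_sub]
  ring

/-- The two velocities after the collision may be exchanged. -/
lemma collisionQ_swap (B₀ γ : ℝ) (F G : E3 → ℝ) (ζ : E3) :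
    collisionQ stdE2 stdE3 B₀ γ F G ζ =
      ∫ ζs : E3, ∫ φ in (0 : ℝ)..(2 * Real.pi), ∫ θ in (0 : ℝ)..(Real.pi / 2),
        (F (ζs - momentum stdE2 stdE3 (ζs - ζ) θ φ) * G (ζ + momentum stdE2 stdE3 (ζs - ζ) θ φ)
          - F ζ * G ζs) * crossSection B₀ γ ‖ζ - ζs‖ θ := by
  unfold collisionQ
  congr 1
  ext1 ζs
  change ∫ φ in (0 : ℝ)..(2 * Real.pi), ∫ θ in (0 : ℝ)..(Real.pi / 2),
      (F (ζ + momentum stdE2 stdE3 (ζs - ζ) θ φ) * G (ζs - momentum stdE2 stdE3 (ζs - ζ) θ φ)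
        - F ζ * G ζs) * crossSection B₀ γ ‖ζ - ζs‖ θ = _
  let I : ℝ → ℝ := fun φ => ∫ θ in (0 : ℝ)..(Real.pi / 2),
      (F (ζ + momentum stdE2 stdE3 (ζs - ζ) θ φ) * G (ζs - momentum stdE2 stdE3 (ζs - ζ) θ φ)
        - F ζ * G ζs) * crossSection B₀ γ ‖ζ - ζs‖ θ
  have hI : Function.Periodic I (2 * Real.pi) := by
    intro φ
    simp only [I, momentum, collisionDir, Real.cos_add_two_pi, Real.sin_add_two_pi]
  have h1 : ∀ φ, ∫ θ in (0 : ℝ)..(Real.pi / 2),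
        (F (ζs - momentum stdE2 stdE3 (ζs - ζ) θ φ) * G (ζ + momentum stdE2 stdE3 (ζs - ζ) θ φ)
          - F ζ * G ζs) * crossSection B₀ γ ‖ζ - ζs‖ θ = I (φ + Real.pi) := by
    intro φ
    have h2 := intervalIntegral.integral_comp_sub_left (a := 0) (b := Real.pi / 2)
      (fun θ => (F (ζ + momentum stdE2 stdE3 (ζs - ζ) θ (φ + Real.pi)) *
        G (ζs - momentum stdE2 stdE3 (ζs - ζ) θ (φ + Real.pi)) - F ζ * G ζs) *
          crossSection B₀ γ ‖ζ - ζs‖ θ) (Real.pi / 2)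
    rw [sub_self, sub_zero] at h2
    simp only [I]
    rw [← h2]
    simp only [momentum_swap, crossSection_swap]
    refine intervalIntegral.integral_congr fun θ _ => ?_
    have h3 : ∀ w : E3, ζ + (ζs - ζ - w) = ζs - w := fun w => by abel
    have h4 : ∀ w : E3, ζs - (ζs - ζ - w) = ζ + w := fun w => by abel
    simp only [h3, h4]
  simp only [h1]
  change ∫ φ in (0 : ℝ)..(2 * Real.pi), I φ = _
  rw [intervalIntegral.integral_comp_add_right, zero_add, add_comm (2 * Real.pi),
    hI.intervalIntegral_add_eq Real.pi 0, zero_add]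

/-! ### The kernel of `K` -/

/-- The density of the gain part of `K`, conjugated by the weight `e^{α |ζ|²}`, in the variables
of `planeMap`. -/
def planeDensity (B₀ γ α : ℝ) (ζ : E3) (s : E3 × ℝ × ℝ) : ℝ :=
  ‖s.1‖⁻¹ * ‖s.1 + (planeMap s).2‖⁻¹ * (B₀ * ‖s.1 + (planeMap s).2‖ ^ γ) *
    (Real.pi ^ (-(3 / 2) : ℝ) * Real.exp (-(1 / 2 - α) * ‖ζ + (planeMap s).2‖ ^ 2
      - (1 / 2 + α) * ‖ζ + (planeMap s).2 + s.1‖ ^ 2))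

/-- The kernel of either of the two gain terms as a function of `p = ζ' - ζ`. -/
def gainKernel (B₀ γ α : ℝ) (ζ p : E3) : ℝ := ∫ s : ℝ × ℝ, planeDensity B₀ γ α ζ (p, s)

/-- The kernel of the loss term of `K` as a function of `p = ζ_* - ζ`. -/
def lossKernel (B₀ γ α : ℝ) (ζ p : E3) : ℝ :=
  Real.pi * B₀ * ‖p‖ ^ γ *
    (Real.pi ^ (-(3 / 2) : ℝ) * Real.exp (-(1 / 2 - α) * ‖ζ‖ ^ 2 - (1 / 2 + α) * ‖ζ + p‖ ^ 2))

/-- The kernel of `K`, conjugated by the weight `e^{α |ζ|²}`, as a function of `η - ζ`. The factor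
`2` accounts for the two gain terms, which agree. -/
def weightedKernel (B₀ γ α : ℝ) (ζ p : E3) : ℝ :=
  2 * gainKernel B₀ γ α ζ p - lossKernel B₀ γ α ζ p

lemma measurable_planeDensity (B₀ γ α : ℝ) :
    Measurable fun q : E3 × E3 × ℝ × ℝ => planeDensity B₀ γ α q.1 q.2 := by
  have h1 := measurable_planeMap
  have h2 := measurable_stdE2
  have h3 := measurable_stdE3
  unfold planeDensity
  fun_prop

lemma measurable_planeDensity_right (B₀ γ α : ℝ) (ζ : E3) :
    Measurable fun s => planeDensity B₀ γ α ζ s :=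
  Measurable.comp (g := fun q : E3 × E3 × ℝ × ℝ => planeDensity B₀ γ α q.1 q.2)
    (f := fun s => (ζ, s)) (measurable_planeDensity B₀ γ α) measurable_prodMk_left

lemma measurable_gainKernel (B₀ γ α : ℝ) :
    Measurable fun q : E3 × E3 => gainKernel B₀ γ α q.1 q.2 := by
  refine StronglyMeasurable.measurable ?_
  refine StronglyMeasurable.integral_prod_right'
    (f := fun q : (E3 × E3) × ℝ × ℝ => planeDensity B₀ γ α q.1.1 (q.1.2, q.2)) ?_
  exact (Measurable.comp (g := fun q : E3 × E3 × ℝ × ℝ => planeDensity B₀ γ α q.1 q.2)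
    (f := fun q : (E3 × E3) × ℝ × ℝ => (q.1.1, q.1.2, q.2)) (measurable_planeDensity B₀ γ α)
    (by fun_prop)).stronglyMeasurable

lemma measurable_lossKernel (B₀ γ α : ℝ) :
    Measurable fun q : E3 × E3 => lossKernel B₀ γ α q.1 q.2 := by
  unfold lossKernel
  fun_prop

lemma measurable_weightedKernel (B₀ γ α : ℝ) :
    Measurable fun q : E3 × E3 => weightedKernel B₀ γ α q.1 q.2 :=
  ((measurable_gainKernel B₀ γ α).const_mul 2).sub (measurable_lossKernel B₀ γ α)

lemma planeDensity_nonneg {B₀ γ α : ℝ} (hB₀ : 0 ≤ B₀) (ζ : E3) (s : E3 × ℝ × ℝ) :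
    0 ≤ planeDensity B₀ γ α ζ s := by
  unfold planeDensity
  positivity

/-- A Gaussian with a power of the norm is integrable on `ℝ³`. -/
lemma integrable_rpow_mul_gaussian {s c : ℝ} (hs : -3 < s) (hc : 0 < c) :
    Integrable fun p : E3 => ‖p‖ ^ s * Real.exp (-c * ‖p‖ ^ 2) := by
  have h := (integrable_fun_norm_addHaar (volume : Measure E3)
    (f := fun y : ℝ => y ^ s * Real.exp (-c * y ^ 2))).2 ?_
  · exact h
  · have h1 := integrableOn_rpow_mul_exp_neg_mul_sq hc (by linarith : -1 < s + 2)
    refine h1.congr_fun (fun y hy => ?_) measurableSet_Ioi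
    have hy' : 0 < y := hy
    have h3 : Module.finrank ℝ E3 - 1 = 2 := by simp
    simp only [smul_eq_mul, h3]
    rw [Real.rpow_add hy', Real.rpow_two]
    ring

lemma norm_frame_sq_ge {u v w : E3} (h : Orthonormal ℝ ![u, v, w]) (x : E3) :
    inner ℝ v x ^ 2 + inner ℝ w x ^ 2 ≤ ‖x‖ ^ 2 := by
  have h1 := h.sum_inner_products_le (s := Finset.univ) (x := x)
  rw [Fin.sum_univ_three] at h1
  simp only [Real.norm_eq_abs, sq_abs] at h1
  have h2 : inner ℝ u x ^ 2 + inner ℝ v x ^ 2 + inner ℝ w x ^ 2 ≤ ‖x‖ ^ 2 := h1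
  nlinarith [sq_nonneg (inner ℝ u x)]

lemma inner_frame_zero {u v w : E3} (h : Orthonormal ℝ ![u, v, w]) (b c : ℝ) :
    inner ℝ u (b • v + c • w) = 0 := by
  have := inner_frame_left h 0 b c
  simpa using this

lemma inner_planeMap {p : E3} (hp : p ≠ 0) (s : ℝ × ℝ) : inner ℝ p (planeMap (p, s)).2 = 0 := by
  have h := inner_frame_zero (isCollisionFrame_std p hp) s.1 s.2
  rw [inner_smul_left] at h
  exact (mul_eq_zero.1 h).resolve_left (by simpa using hp)

lemma norm_add_planeMap_ge {p : E3} (hp : p ≠ 0) (s : ℝ × ℝ) :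
    ‖p‖ ≤ ‖p + (planeMap (p, s)).2‖ := by
  have h := norm_add_sq_real p (planeMap (p, s)).2
  rw [inner_planeMap hp] at h
  refine (sq_le_sq₀ (norm_nonneg _) (norm_nonneg _)).1 ?_
  nlinarith [sq_nonneg ‖(planeMap (p, s)).2‖]

/-- The coordinates of the projection of `ζ` to the plane orthogonal to `p`. -/
def planeCoord (p ζ : E3) : ℝ × ℝ := (inner ℝ (stdE2 p) ζ, inner ℝ (stdE3 p) ζ)

lemma planeCoord_sq_le {p : E3} (hp : p ≠ 0) (ζ : E3) :
    (planeCoord p ζ).1 ^ 2 + (planeCoord p ζ).2 ^ 2 ≤ ‖ζ‖ ^ 2 :=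
  norm_frame_sq_ge (isCollisionFrame_std p hp) ζ

/-- By the parallelogram identity the right-hand side is `2 |ζ + q + p / 2|² + |p|² / 2`, with `q` the
vector of the plane, and the projection of `ζ + q + p / 2` to the plane is that of `ζ + q`. -/
lemma planeMap_sq_ge {p : E3} (hp : p ≠ 0) (ζ : E3) (s : ℝ × ℝ) :
    2 * ((s.1 + (planeCoord p ζ).1) ^ 2 + (s.2 + (planeCoord p ζ).2) ^ 2) + ‖p‖ ^ 2 / 2 ≤
      ‖ζ + (planeMap (p, s)).2‖ ^ 2 + ‖ζ + (planeMap (p, s)).2 + p‖ ^ 2 := by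
  have hfr := isCollisionFrame_std p hp
  have h23 : inner ℝ (stdE2 p) (stdE3 p) = 0 := hfr.2 (show (1 : Fin 3) ≠ 2 by decide)
  have h32 : inner ℝ (stdE3 p) (stdE2 p) = 0 := hfr.2 (show (2 : Fin 3) ≠ 1 by decide)
  have h21 : inner ℝ (stdE2 p) (‖p‖⁻¹ • p) = 0 := hfr.2 (show (1 : Fin 3) ≠ 0 by decide)
  have h31 : inner ℝ (stdE3 p) (‖p‖⁻¹ • p) = 0 := hfr.2 (show (2 : Fin 3) ≠ 0 by decide)
  have hp' : ‖p‖⁻¹ ≠ 0 := inv_ne_zero (norm_ne_zero_iff.2 hp)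
  rw [inner_smul_right] at h21 h31
  have h21' := (mul_eq_zero.1 h21).resolve_left hp'
  have h31' := (mul_eq_zero.1 h31).resolve_left hp'
  have hn2 : ‖stdE2 p‖ = 1 := hfr.1 1
  have hn3 : ‖stdE3 p‖ = 1 := hfr.1 2
  set y : E3 := ζ + (planeMap (p, s)).2 with hy
  have h1 := norm_frame_sq_ge hfr (y + (1 / 2 : ℝ) • p)
  have e2 : inner ℝ (stdE2 p) (y + (1 / 2 : ℝ) • p) = s.1 + (planeCoord p ζ).1 := by
    simp only [hy, planeMap, planeCoord, inner_add_right, inner_smul_right, h21', h23,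
      real_inner_self_eq_norm_sq, hn2]
    ring
  have e3 : inner ℝ (stdE3 p) (y + (1 / 2 : ℝ) • p) = s.2 + (planeCoord p ζ).2 := by
    simp only [hy, planeMap, planeCoord, inner_add_right, inner_smul_right, h31', h32,
      real_inner_self_eq_norm_sq, hn3]
    ring
  rw [e2, e3] at h1
  have h2 : ‖y + (1 / 2 : ℝ) • p‖ ^ 2 = ‖y‖ ^ 2 + inner ℝ y p + ‖p‖ ^ 2 / 4 := by
    rw [norm_add_sq_real, inner_smul_right, norm_smul, mul_pow]
    norm_num
    ring
  have h3 := norm_add_sq_real y p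
  rw [h2] at h1
  linarith

/-- The singularity of the gain kernel at `p = 0` and its Gaussian decay, uniformly in `ζ`. -/
lemma planeDensity_le {B₀ γ α : ℝ} (hB₀ : 0 ≤ B₀) (hγ₁ : γ ≤ 1) (hα₀ : 0 ≤ α) (hα₁ : α < 1 / 2)
    {p : E3} (hp : p ≠ 0) (ζ : E3) (s : ℝ × ℝ) :
    planeDensity B₀ γ α ζ (p, s) ≤
      B₀ * Real.pi ^ (-(3 / 2) : ℝ) *
        (‖p‖ ^ (γ - 2) * Real.exp (-((1 / 2 - α) / 2) * ‖p‖ ^ 2)) *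
        Real.exp (-(2 * (1 / 2 - α)) *
          ((s.1 + (planeCoord p ζ).1) ^ 2 + (s.2 + (planeCoord p ζ).2) ^ 2)) := by
  have hp0 : 0 < ‖p‖ := norm_pos_iff.2 hp
  have h1 := norm_add_planeMap_ge hp s
  have h2 := planeMap_sq_ge hp ζ s
  unfold planeDensity
  simp only
  set q := (planeMap (p, s)).2
  have hpq : 0 < ‖p + q‖ := hp0.trans_le h1
  have hpow : ‖p‖⁻¹ * ‖p + q‖⁻¹ * (B₀ * ‖p + q‖ ^ γ) ≤ B₀ * ‖p‖ ^ (γ - 2) := by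
    have h3 : ‖p + q‖⁻¹ * ‖p + q‖ ^ γ = ‖p + q‖ ^ (γ - 1) := by
      rw [Real.rpow_sub_one hpq.ne', div_eq_inv_mul]
    have h4 : ‖p‖⁻¹ * ‖p‖ ^ (γ - 1) = ‖p‖ ^ (γ - 2) := by
      rw [show γ - 2 = γ - 1 - 1 by ring, Real.rpow_sub_one hp0.ne' (γ - 1), div_eq_inv_mul]
    have h5 : ‖p + q‖ ^ (γ - 1) ≤ ‖p‖ ^ (γ - 1) :=
      Real.rpow_le_rpow_of_nonpos hp0 h1 (by linarith)
    calc ‖p‖⁻¹ * ‖p + q‖⁻¹ * (B₀ * ‖p + q‖ ^ γ)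
        = B₀ * (‖p‖⁻¹ * (‖p + q‖⁻¹ * ‖p + q‖ ^ γ)) := by ring
      _ = B₀ * (‖p‖⁻¹ * ‖p + q‖ ^ (γ - 1)) := by rw [h3]
      _ ≤ B₀ * (‖p‖⁻¹ * ‖p‖ ^ (γ - 1)) := by gcongr
      _ = B₀ * ‖p‖ ^ (γ - 2) := by rw [h4]
  have hexp : Real.exp (-(1 / 2 - α) * ‖ζ + q‖ ^ 2 - (1 / 2 + α) * ‖ζ + q + p‖ ^ 2) ≤
      Real.exp (-((1 / 2 - α) / 2) * ‖p‖ ^ 2) * Real.exp (-(2 * (1 / 2 - α)) *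
          ((s.1 + (planeCoord p ζ).1) ^ 2 + (s.2 + (planeCoord p ζ).2) ^ 2)) := by
    rw [← Real.exp_add]
    refine Real.exp_le_exp.2 ?_
    have h6 : 0 ≤ α * ‖ζ + q + p‖ ^ 2 := by positivity
    nlinarith [mul_le_mul_of_nonneg_left h2 (by linarith : 0 ≤ 1 / 2 - α)]
  calc _ ≤ B₀ * ‖p‖ ^ (γ - 2) * (Real.pi ^ (-(3 / 2) : ℝ) *
        (Real.exp (-((1 / 2 - α) / 2) * ‖p‖ ^ 2) * Real.exp (-(2 * (1 / 2 - α)) *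
          ((s.1 + (planeCoord p ζ).1) ^ 2 + (s.2 + (planeCoord p ζ).2) ^ 2)))) := by
        refine mul_le_mul hpow ?_ (by positivity) (by positivity)
        gcongr
    _ = _ := by ring

lemma ae_fst_ne_zero : ∀ᵐ s : E3 × ℝ × ℝ, s.1 ≠ 0 := by
  have h0 : ∀ᵐ v : E3, v ≠ 0 := compl_mem_ae_iff.2 (measure_singleton 0)
  exact Measure.quasiMeasurePreserving_fst.ae h0

/-- The total mass of the majorant of `planeDensity`. -/
def gainMass (B₀ γ α : ℝ) : ℝ≥0∞ :=
  (∫⁻ p : E3, ENNReal.ofReal (B₀ * Real.pi ^ (-(3 / 2) : ℝ) *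
        (‖p‖ ^ (γ - 2) * Real.exp (-((1 / 2 - α) / 2) * ‖p‖ ^ 2)))) *
    ∫⁻ s : ℝ × ℝ, ENNReal.ofReal (Real.exp (-(2 * (1 / 2 - α)) * (s.1 ^ 2 + s.2 ^ 2)))

lemma integrable_gaussian_prod {c : ℝ} (hc : 0 < c) :
    Integrable fun s : ℝ × ℝ => Real.exp (-c * (s.1 ^ 2 + s.2 ^ 2)) := by
  have h1 : Integrable fun x : ℝ => Real.exp (-c * x ^ 2) := integrable_exp_neg_mul_sq hc
  refine (h1.mul_prod h1).congr (Filter.Eventually.of_forall fun s => ?_)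
  simp only
  rw [← Real.exp_add]
  congr 1
  ring

lemma gainMass_ne_top {B₀ γ α : ℝ} (hγ₀ : 0 ≤ γ) (hα₁ : α < 1 / 2) :
    gainMass B₀ γ α ≠ ∞ := by
  refine ENNReal.mul_ne_top ?_ ?_
  · exact ((integrable_rpow_mul_gaussian (by linarith) (by linarith)).const_mul _).lintegral_lt_top.ne
  · exact (integrable_gaussian_prod (by linarith)).lintegral_lt_top.ne

lemma lintegral_planeDensity_le {B₀ γ α : ℝ} (hB₀ : 0 ≤ B₀) (hγ₁ : γ ≤ 1)
    (hα₀ : 0 ≤ α) (hα₁ : α < 1 / 2) (ζ : E3) :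
    ∫⁻ s, ‖planeDensity B₀ γ α ζ s‖ₑ ≤ gainMass B₀ γ α := by
  have hm := measurable_planeDensity_right B₀ γ α ζ
  rw [Measure.volume_eq_prod, lintegral_prod _ (Measurable.aemeasurable (by fun_prop)), gainMass,
    ← lintegral_mul_const _ (by fun_prop)]
  have h0 : ∀ᵐ v : E3, v ≠ 0 := compl_mem_ae_iff.2 (measure_singleton 0)
  refine lintegral_mono_ae ?_
  filter_upwards [h0] with p hp
  rw [← lintegral_add_right_eq_self (fun s : ℝ × ℝ =>
    ENNReal.ofReal (Real.exp (-(2 * (1 / 2 - α)) * (s.1 ^ 2 + s.2 ^ 2)))) (planeCoord p ζ),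
    ← lintegral_const_mul _ (by fun_prop)]
  refine lintegral_mono fun s => ?_
  rw [← ENNReal.ofReal_mul (by positivity), ← ofReal_norm,
    Real.norm_of_nonneg (planeDensity_nonneg hB₀ _ _)]
  exact ENNReal.ofReal_le_ofReal (planeDensity_le hB₀ hγ₁ hα₀ hα₁ hp ζ s)

lemma integrable_planeDensity {B₀ γ α : ℝ} (hB₀ : 0 ≤ B₀) (hγ₀ : 0 ≤ γ) (hγ₁ : γ ≤ 1)
    (hα₀ : 0 ≤ α) (hα₁ : α < 1 / 2) (ζ : E3) : Integrable (planeDensity B₀ γ α ζ) :=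
  ⟨(measurable_planeDensity_right B₀ γ α ζ).aestronglyMeasurable,
    (lintegral_planeDensity_le hB₀ hγ₁ hα₀ hα₁ ζ).trans_lt
      (gainMass_ne_top hγ₀ hα₁).lt_top⟩

open Filter Topology in
lemma tendsto_lintegral_planeDensity {B₀ γ α : ℝ} (hB₀ : 0 ≤ B₀) (hγ₀ : 0 ≤ γ) (hγ₁ : γ ≤ 1)
    (hα₀ : 0 ≤ α) (hα₁ : α < 1 / 2) (ζ₀ : E3) :
    Tendsto (fun ζ => ∫⁻ s, ‖planeDensity B₀ γ α ζ s - planeDensity B₀ γ α ζ₀ s‖ₑ) (𝓝 ζ₀)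
      (𝓝 0) := by
  set β := 1 / 2 - α with hβ
  have hβ0 : 0 < β := by linarith
  -- an integrable majorant for all `ζ` within distance `1` of `ζ₀`
  let D : E3 × ℝ × ℝ → ℝ := fun s =>
    (B₀ * Real.pi ^ (-(3 / 2) : ℝ) * (‖s.1‖ ^ (γ - 2) * Real.exp (-(β / 2) * ‖s.1‖ ^ 2))) *
      (Real.exp (2 * β * (‖ζ₀‖ + 1) ^ 2) * Real.exp (-β * (s.2.1 ^ 2 + s.2.2 ^ 2)))
  have hD : Integrable D :=
    (((integrable_rpow_mul_gaussian (by linarith) (by linarith)).const_mul _).mul_prod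
      ((integrable_gaussian_prod hβ0).const_mul _))
  have hle : ∀ ζ : E3, ‖ζ‖ ≤ ‖ζ₀‖ + 1 → ∀ s : E3 × ℝ × ℝ, s.1 ≠ 0 →
      planeDensity B₀ γ α ζ s ≤ D s := by
    rintro ζ hζ ⟨p, s⟩ hp
    refine (planeDensity_le hB₀ hγ₁ hα₀ hα₁ hp ζ s).trans ?_
    simp only [D]
    rw [← Real.exp_add]
    refine mul_le_mul_of_nonneg_left (Real.exp_le_exp.2 ?_) (by positivity)
    have h1 := planeCoord_sq_le hp ζ
    have h2 : ‖ζ‖ ^ 2 ≤ (‖ζ₀‖ + 1) ^ 2 := by gcongr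
    have h3 : (s.1 ^ 2 + s.2 ^ 2) / 2 - (‖ζ₀‖ + 1) ^ 2 ≤
        (s.1 + (planeCoord p ζ).1) ^ 2 + (s.2 + (planeCoord p ζ).2) ^ 2 := by
      nlinarith [sq_nonneg (s.1 + 2 * (planeCoord p ζ).1), sq_nonneg (s.2 + 2 * (planeCoord p ζ).2)]
    nlinarith [mul_le_mul_of_nonneg_left h3 hβ0.le]
  have hfin : ∫⁻ s, 2 * ‖D s‖ₑ ≠ ∞ := by
    rw [lintegral_const_mul' _ _ (by norm_num)]
    exact ENNReal.mul_ne_top (by norm_num) hD.2.ne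
  have hlim := tendsto_lintegral_filter_of_dominated_convergence (μ := volume) (l := 𝓝 ζ₀)
    (F := fun ζ s => ‖planeDensity B₀ γ α ζ s - planeDensity B₀ γ α ζ₀ s‖ₑ) (f := fun _ => 0)
    (fun s => 2 * ‖D s‖ₑ) ?_ ?_ hfin ?_
  · simpa using hlim
  · refine Eventually.of_forall fun ζ => ?_
    have h1 := measurable_planeDensity_right B₀ γ α ζ
    have h2 := measurable_planeDensity_right B₀ γ α ζ₀
    fun_prop
  · filter_upwards [Metric.ball_mem_nhds ζ₀ one_pos] with ζ hζ
    have hζn : ‖ζ‖ ≤ ‖ζ₀‖ + 1 := by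
      have h1 : ‖ζ - ζ₀‖ < 1 := mem_ball_iff_norm.1 hζ
      have h2 := norm_add_le (ζ - ζ₀) ζ₀
      rw [sub_add_cancel] at h2
      linarith
    filter_upwards [ae_fst_ne_zero] with s hs
    have h3 : ∀ ξ : E3, ‖ξ‖ ≤ ‖ζ₀‖ + 1 → ‖planeDensity B₀ γ α ξ s‖ₑ ≤ ‖D s‖ₑ := by
      intro ξ hξ
      have h4 := hle ξ hξ s hs
      have h5 := planeDensity_nonneg (γ := γ) (α := α) hB₀ ξ s
      rw [← ofReal_norm, ← ofReal_norm, Real.norm_of_nonneg h5, Real.norm_of_nonneg (h5.trans h4)]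
      exact ENNReal.ofReal_le_ofReal h4
    refine (enorm_sub_le).trans ?_
    rw [two_mul]
    exact add_le_add (h3 ζ hζn) (h3 ζ₀ (by linarith))
  · refine Eventually.of_forall fun s => ?_
    have hc : Continuous fun ζ => ‖planeDensity B₀ γ α ζ s - planeDensity B₀ γ α ζ₀ s‖ₑ := by
      unfold planeDensity
      fun_prop
    simpa using hc.tendsto ζ₀

lemma lossKernel_nonneg {B₀ γ α : ℝ} (hB₀ : 0 ≤ B₀) (ζ p : E3) : 0 ≤ lossKernel B₀ γ α ζ p := by
  unfold lossKernel
  have := Real.pi_pos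
  positivity

lemma lossKernel_le {B₀ γ α : ℝ} (hB₀ : 0 ≤ B₀) (hα₀ : 0 ≤ α) (hα₁ : α < 1 / 2) (ζ p : E3) :
    lossKernel B₀ γ α ζ p ≤ Real.pi * B₀ * Real.pi ^ (-(3 / 2) : ℝ) *
      (‖p‖ ^ γ * Real.exp (-((1 / 2 - α) / 2) * ‖p‖ ^ 2)) := by
  unfold lossKernel
  have hpi := Real.pi_pos
  have h1 : ‖p‖ ^ 2 ≤ 2 * (‖ζ‖ ^ 2 + ‖ζ + p‖ ^ 2) := by
    have h2 : ‖p‖ ≤ ‖ζ + p‖ + ‖ζ‖ := by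
      have := norm_sub_le (ζ + p) ζ
      rwa [add_sub_cancel_left] at this
    nlinarith [sq_nonneg (‖ζ + p‖ - ‖ζ‖), norm_nonneg p, norm_nonneg ζ, norm_nonneg (ζ + p)]
  have h3 : Real.exp (-(1 / 2 - α) * ‖ζ‖ ^ 2 - (1 / 2 + α) * ‖ζ + p‖ ^ 2) ≤
      Real.exp (-((1 / 2 - α) / 2) * ‖p‖ ^ 2) := by
    refine Real.exp_le_exp.2 ?_
    have h4 : 0 ≤ α * ‖ζ + p‖ ^ 2 := by positivity
    nlinarith [mul_le_mul_of_nonneg_left h1 (by linarith : 0 ≤ 1 / 2 - α)]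
  calc _ ≤ Real.pi * B₀ * ‖p‖ ^ γ *
        (Real.pi ^ (-(3 / 2) : ℝ) * Real.exp (-((1 / 2 - α) / 2) * ‖p‖ ^ 2)) := by gcongr
    _ = _ := by ring

lemma integrable_lossMajorant {B₀ γ α : ℝ} (hγ₀ : 0 ≤ γ) (hα₁ : α < 1 / 2) :
    Integrable fun p : E3 => Real.pi * B₀ * Real.pi ^ (-(3 / 2) : ℝ) *
      (‖p‖ ^ γ * Real.exp (-((1 / 2 - α) / 2) * ‖p‖ ^ 2)) :=
  (integrable_rpow_mul_gaussian (by linarith) (by linarith)).const_mul _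

lemma measurable_lossKernel_right (B₀ γ α : ℝ) (ζ : E3) :
    Measurable fun p => lossKernel B₀ γ α ζ p :=
  Measurable.comp (g := fun q : E3 × E3 => lossKernel B₀ γ α q.1 q.2)
    (f := fun p => (ζ, p)) (measurable_lossKernel B₀ γ α) measurable_prodMk_left

lemma measurable_gainKernel_right (B₀ γ α : ℝ) (ζ : E3) :
    Measurable fun p => gainKernel B₀ γ α ζ p :=
  Measurable.comp (g := fun q : E3 × E3 => gainKernel B₀ γ α q.1 q.2)
    (f := fun p => (ζ, p)) (measurable_gainKernel B₀ γ α) measurable_prodMk_left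

lemma lintegral_gainKernel_le {B₀ γ α : ℝ} (hB₀ : 0 ≤ B₀) (hγ₁ : γ ≤ 1)
    (hα₀ : 0 ≤ α) (hα₁ : α < 1 / 2) (ζ : E3) :
    ∫⁻ p, ‖gainKernel B₀ γ α ζ p‖ₑ ≤ gainMass B₀ γ α := by
  refine le_trans ?_ (lintegral_planeDensity_le hB₀ hγ₁ hα₀ hα₁ ζ)
  have hm := measurable_planeDensity_right B₀ γ α ζ
  rw [Measure.volume_eq_prod, lintegral_prod _ (Measurable.aemeasurable (by fun_prop))]
  exact lintegral_mono fun p => enorm_integral_le_lintegral_enorm _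

lemma integrable_gainKernel {B₀ γ α : ℝ} (hB₀ : 0 ≤ B₀) (hγ₀ : 0 ≤ γ) (hγ₁ : γ ≤ 1)
    (hα₀ : 0 ≤ α) (hα₁ : α < 1 / 2) (ζ : E3) : Integrable (gainKernel B₀ γ α ζ) :=
  ⟨(measurable_gainKernel_right B₀ γ α ζ).aestronglyMeasurable,
    (lintegral_gainKernel_le hB₀ hγ₁ hα₀ hα₁ ζ).trans_lt (gainMass_ne_top hγ₀ hα₁).lt_top⟩

lemma integrable_lossKernel {B₀ γ α : ℝ} (hB₀ : 0 ≤ B₀) (hγ₀ : 0 ≤ γ)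
    (hα₀ : 0 ≤ α) (hα₁ : α < 1 / 2) (ζ : E3) : Integrable (lossKernel B₀ γ α ζ) := by
  refine (integrable_lossMajorant (B₀ := B₀) hγ₀ hα₁).mono'
    (measurable_lossKernel_right B₀ γ α ζ).aestronglyMeasurable
    (Filter.Eventually.of_forall fun p => ?_)
  rw [Real.norm_of_nonneg (lossKernel_nonneg hB₀ ζ p)]
  exact lossKernel_le hB₀ hα₀ hα₁ ζ p

open Filter Topology in
lemma tendsto_lintegral_gainKernel {B₀ γ α : ℝ} (hB₀ : 0 ≤ B₀) (hγ₀ : 0 ≤ γ) (hγ₁ : γ ≤ 1)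
    (hα₀ : 0 ≤ α) (hα₁ : α < 1 / 2) (ζ₀ : E3) :
    Tendsto (fun ζ => ∫⁻ p, ‖gainKernel B₀ γ α ζ p - gainKernel B₀ γ α ζ₀ p‖ₑ) (𝓝 ζ₀)
      (𝓝 0) := by
  refine tendsto_of_tendsto_of_tendsto_of_le_of_le tendsto_const_nhds
    (tendsto_lintegral_planeDensity hB₀ hγ₀ hγ₁ hα₀ hα₁ ζ₀) (fun ζ => zero_le) fun ζ => ?_
  have hm := measurable_planeDensity_right B₀ γ α ζ
  have hm₀ := measurable_planeDensity_right B₀ γ α ζ₀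
  have hi := integrable_planeDensity hB₀ hγ₀ hγ₁ hα₀ hα₁ ζ
  have hi₀ := integrable_planeDensity hB₀ hγ₀ hγ₁ hα₀ hα₁ ζ₀
  simp only
  rw [Measure.volume_eq_prod] at hi hi₀ ⊢
  rw [lintegral_prod _ (Measurable.aemeasurable (by fun_prop))]
  refine lintegral_mono_ae ?_
  filter_upwards [hi.prod_right_ae, hi₀.prod_right_ae] with p h1 h2
  unfold gainKernel
  rw [← integral_sub h1 h2]
  exact enorm_integral_le_lintegral_enorm _

open Filter Topology in
lemma tendsto_lintegral_lossKernel {B₀ γ α : ℝ} (hB₀ : 0 ≤ B₀) (hγ₀ : 0 ≤ γ)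
    (hα₀ : 0 ≤ α) (hα₁ : α < 1 / 2) (ζ₀ : E3) :
    Tendsto (fun ζ => ∫⁻ p, ‖lossKernel B₀ γ α ζ p - lossKernel B₀ γ α ζ₀ p‖ₑ) (𝓝 ζ₀)
      (𝓝 0) := by
  set D : E3 → ℝ := fun p => Real.pi * B₀ * Real.pi ^ (-(3 / 2) : ℝ) *
      (‖p‖ ^ γ * Real.exp (-((1 / 2 - α) / 2) * ‖p‖ ^ 2)) with hDdef
  have hD : Integrable D := integrable_lossMajorant hγ₀ hα₁
  have hfin : ∫⁻ p, 2 * ‖D p‖ₑ ≠ ∞ := by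
    rw [lintegral_const_mul' _ _ (by norm_num)]
    exact ENNReal.mul_ne_top (by norm_num) hD.2.ne
  have hlim := tendsto_lintegral_filter_of_dominated_convergence (μ := volume) (l := 𝓝 ζ₀)
    (F := fun ζ p => ‖lossKernel B₀ γ α ζ p - lossKernel B₀ γ α ζ₀ p‖ₑ) (f := fun _ => 0)
    (fun p => 2 * ‖D p‖ₑ) ?_ ?_ hfin ?_
  · simpa using hlim
  · refine Eventually.of_forall fun ζ => ?_
    have h1 := measurable_lossKernel_right B₀ γ α ζ
    have h2 := measurable_lossKernel_right B₀ γ α ζ₀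
    fun_prop
  · refine Eventually.of_forall fun ζ => Eventually.of_forall fun p => ?_
    have h3 : ∀ ξ : E3, ‖lossKernel B₀ γ α ξ p‖ₑ ≤ ‖D p‖ₑ := by
      intro ξ
      have h4 := lossKernel_le (γ := γ) hB₀ hα₀ hα₁ ξ p
      have h5 := lossKernel_nonneg (γ := γ) (α := α) hB₀ ξ p
      rw [← ofReal_norm, ← ofReal_norm, Real.norm_of_nonneg h5, Real.norm_of_nonneg (h5.trans h4)]
      exact ENNReal.ofReal_le_ofReal h4
    refine (enorm_sub_le).trans ?_
    rw [two_mul]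
    exact add_le_add (h3 ζ) (h3 ζ₀)
  · refine Eventually.of_forall fun p => ?_
    have hc : Continuous fun ζ => ‖lossKernel B₀ γ α ζ p - lossKernel B₀ γ α ζ₀ p‖ₑ := by
      unfold lossKernel
      fun_prop
    simpa using hc.tendsto ζ₀

lemma integrable_weightedKernel {B₀ γ α : ℝ} (hB₀ : 0 ≤ B₀) (hγ₀ : 0 ≤ γ) (hγ₁ : γ ≤ 1)
    (hα₀ : 0 ≤ α) (hα₁ : α < 1 / 2) (ζ : E3) : Integrable (weightedKernel B₀ γ α ζ) :=
  ((integrable_gainKernel hB₀ hγ₀ hγ₁ hα₀ hα₁ ζ).const_mul 2).sub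
    (integrable_lossKernel hB₀ hγ₀ hα₀ hα₁ ζ)

open Filter Topology in
lemma tendsto_lintegral_weightedKernel {B₀ γ α : ℝ} (hB₀ : 0 ≤ B₀) (hγ₀ : 0 ≤ γ) (hγ₁ : γ ≤ 1)
    (hα₀ : 0 ≤ α) (hα₁ : α < 1 / 2) (ζ₀ : E3) :
    Tendsto (fun ζ => ∫⁻ p, ‖weightedKernel B₀ γ α ζ p - weightedKernel B₀ γ α ζ₀ p‖ₑ) (𝓝 ζ₀)
      (𝓝 0) := by
  have h := (ENNReal.Tendsto.const_mul (a := 2)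
    (tendsto_lintegral_gainKernel hB₀ hγ₀ hγ₁ hα₀ hα₁ ζ₀) (Or.inr (by norm_num))).add
    (tendsto_lintegral_lossKernel hB₀ hγ₀ hα₀ hα₁ ζ₀)
  rw [mul_zero, add_zero] at h
  refine tendsto_of_tendsto_of_tendsto_of_le_of_le tendsto_const_nhds h (fun ζ => zero_le)
    fun ζ => ?_
  have h1 := measurable_gainKernel_right B₀ γ α ζ
  have h2 := measurable_gainKernel_right B₀ γ α ζ₀
  simp only
  rw [← lintegral_const_mul' _ _ (by norm_num), ← lintegral_add_left (by fun_prop)]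
  refine lintegral_mono fun p => ?_
  have h3 : weightedKernel B₀ γ α ζ p - weightedKernel B₀ γ α ζ₀ p =
      2 * (gainKernel B₀ γ α ζ p - gainKernel B₀ γ α ζ₀ p) -
        (lossKernel B₀ γ α ζ p - lossKernel B₀ γ α ζ₀ p) := by
    unfold weightedKernel
    ring
  rw [h3]
  refine enorm_sub_le.trans ?_
  rw [enorm_mul]
  gcongr
  rw [← ofReal_norm]
  norm_num

/-- The kernel of `K`, conjugated by the weight, as a function of `(ζ, η)`. -/
def collisionKernel (B₀ γ α : ℝ) (q : E3 × E3) : ℝ := weightedKernel B₀ γ α q.1 (q.2 - q.1)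

lemma measurable_collisionKernel (B₀ γ α : ℝ) : Measurable (collisionKernel B₀ γ α) :=
  Measurable.comp (g := fun q : E3 × E3 => weightedKernel B₀ γ α q.1 q.2)
    (f := fun q : E3 × E3 => (q.1, q.2 - q.1)) (measurable_weightedKernel B₀ γ α) (by fun_prop)

lemma exists_lintegral_collisionKernel_le {B₀ γ α : ℝ} (hB₀ : 0 ≤ B₀) (hγ₀ : 0 ≤ γ) (hγ₁ : γ ≤ 1)
    (hα₀ : 0 ≤ α) (hα₁ : α < 1 / 2) :
    ∃ D : ℝ, 0 ≤ D ∧ ∀ ζ, ∫⁻ η, ‖collisionKernel B₀ γ α (ζ, η)‖ₑ ≤ ENNReal.ofReal D := by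
  set D₁ : ℝ≥0∞ := ∫⁻ p : E3, ‖Real.pi * B₀ * Real.pi ^ (-(3 / 2) : ℝ) *
      (‖p‖ ^ γ * Real.exp (-((1 / 2 - α) / 2) * ‖p‖ ^ 2))‖ₑ with hD₁
  have hD₁t : D₁ ≠ ∞ := (integrable_lossMajorant hγ₀ hα₁).2.ne
  have hD₂ := gainMass_ne_top (B₀ := B₀) hγ₀ hα₁
  refine ⟨(2 * gainMass B₀ γ α + D₁).toReal, ENNReal.toReal_nonneg, fun ζ => ?_⟩
  rw [ENNReal.ofReal_toReal (ENNReal.add_ne_top.2 ⟨ENNReal.mul_ne_top (by norm_num) hD₂, hD₁t⟩)]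
  unfold collisionKernel
  simp only
  rw [lintegral_sub_right_eq_self (fun p => ‖weightedKernel B₀ γ α ζ p‖ₑ) ζ]
  have h1 := measurable_gainKernel_right B₀ γ α ζ
  calc ∫⁻ p, ‖weightedKernel B₀ γ α ζ p‖ₑ
      ≤ ∫⁻ p, (2 * ‖gainKernel B₀ γ α ζ p‖ₑ + ‖lossKernel B₀ γ α ζ p‖ₑ) := by
        refine lintegral_mono fun p => ?_
        unfold weightedKernel
        refine enorm_sub_le.trans ?_
        rw [enorm_mul]
        gcongr
        rw [← ofReal_norm]
        norm_num
    _ = 2 * (∫⁻ p, ‖gainKernel B₀ γ α ζ p‖ₑ) + ∫⁻ p, ‖lossKernel B₀ γ α ζ p‖ₑ := by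
        rw [lintegral_add_left (by fun_prop), lintegral_const_mul' _ _ (by norm_num)]
    _ ≤ 2 * gainMass B₀ γ α + D₁ := by
        gcongr
        · exact lintegral_gainKernel_le hB₀ hγ₁ hα₀ hα₁ ζ
        · refine lintegral_mono fun p => ?_
          have h4 := lossKernel_le (γ := γ) hB₀ hα₀ hα₁ ζ p
          have h5 := lossKernel_nonneg (γ := γ) (α := α) hB₀ ζ p
          rw [← ofReal_norm, ← ofReal_norm, Real.norm_of_nonneg h5,
            Real.norm_of_nonneg (h5.trans h4)]
          exact ENNReal.ofReal_le_ofReal h4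

open Filter Topology in
lemma tendsto_lintegral_collisionKernel {B₀ γ α : ℝ} (hB₀ : 0 ≤ B₀) (hγ₀ : 0 ≤ γ) (hγ₁ : γ ≤ 1)
    (hα₀ : 0 ≤ α) (hα₁ : α < 1 / 2) (ζ₀ : E3) :
    Tendsto (fun ζ => ∫⁻ η, ‖collisionKernel B₀ γ α (ζ, η) - collisionKernel B₀ γ α (ζ₀, η)‖ₑ)
      (𝓝 ζ₀) (𝓝 0) := by
  -- vary first the kernel as a function of `η - ζ`, then the translation
  have h := (tendsto_lintegral_weightedKernel hB₀ hγ₀ hγ₁ hα₀ hα₁ ζ₀).add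
    (tendsto_lintegral_comp_sub (g := fun q => q.2 - q.1)
      (integrable_weightedKernel hB₀ hγ₀ hγ₁ hα₀ hα₁ ζ₀) (by fun_prop)
      (fun x => measurePreserving_sub_right volume x) ζ₀)
  rw [add_zero] at h
  refine tendsto_of_tendsto_of_tendsto_of_le_of_le tendsto_const_nhds h (fun ζ => zero_le)
    fun ζ => ?_
  have hm : ∀ ξ, Measurable fun p => weightedKernel B₀ γ α ξ p := fun ξ =>
    Measurable.comp (g := fun q : E3 × E3 => weightedKernel B₀ γ α q.1 q.2)
      (f := fun p => (ξ, p)) (measurable_weightedKernel B₀ γ α) measurable_prodMk_left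
  have h1 := hm ζ
  have h2 := hm ζ₀
  simp only
  rw [← lintegral_sub_right_eq_self
    (fun p => ‖weightedKernel B₀ γ α ζ p - weightedKernel B₀ γ α ζ₀ p‖ₑ) ζ,
    ← lintegral_add_left (by fun_prop)]
  refine lintegral_mono fun η => ?_
  unfold collisionKernel
  simp only
  rw [show weightedKernel B₀ γ α ζ (η - ζ) - weightedKernel B₀ γ α ζ₀ (η - ζ₀) =
    (weightedKernel B₀ γ α ζ (η - ζ) - weightedKernel B₀ γ α ζ₀ (η - ζ)) +
      (weightedKernel B₀ γ α ζ₀ (η - ζ) - weightedKernel B₀ γ α ζ₀ (η - ζ₀)) by ring]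
  exact enorm_add_le _ _

/-! ### `K` is an integral operator -/

lemma integral_sin_mul_cos :
    ∫ θ in (0 : ℝ)..(Real.pi / 2), Real.sin θ * Real.cos θ = 1 / 2 := by
  rw [integral_sin_mul_cos₁]
  simp

lemma collisionFreq_eq (B₀ γ : ℝ) (ζ : E3) :
    collisionFreq B₀ γ ζ = Real.pi * ∫ v : E3, B₀ * ‖v‖ ^ γ * maxwellian (ζ + v) := by
  rw [← integral_const_mul, ← integral_add_left_eq_self _ (-ζ)]
  unfold collisionFreq
  refine integral_congr_ae (Filter.Eventually.of_forall fun ζs => ?_)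
  simp only
  have h1 : ∀ θ, maxwellian ζs * crossSection B₀ γ ‖ζ - ζs‖ θ =
      maxwellian ζs * (B₀ * ‖ζ - ζs‖ ^ γ) * (Real.sin θ * Real.cos θ) := fun θ => by
    unfold crossSection
    ring
  simp only [h1, intervalIntegral.integral_const_mul, integral_sin_mul_cos,
    intervalIntegral.integral_const, smul_eq_mul]
  rw [show -ζ + ζs = -(ζ - ζs) by abel, norm_neg, ← sub_eq_add_neg, sub_sub_cancel]
  ring

lemma ae_collisionMeasure_base :
    ∀ᵐ q ∂((volume : Measure E3).prod ((volume.restrict (Set.Ioc 0 (2 * Real.pi))).prod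
      (volume.restrict (Set.Ioc 0 (Real.pi / 2))))), 0 ≤ Real.sin q.2.2 * Real.cos q.2.2 := by
  have h : ∀ᵐ θ ∂(volume.restrict (Set.Ioc 0 (Real.pi / 2))), 0 ≤ Real.sin θ * Real.cos θ := by
    refine (ae_restrict_mem measurableSet_Ioc).mono fun θ hθ => ?_
    exact mul_nonneg (Real.sin_nonneg_of_nonneg_of_le_pi hθ.1.le (by linarith [hθ.2, Real.pi_pos]))
      (Real.cos_nonneg_of_mem_Icc ⟨by linarith [hθ.1, Real.pi_pos], hθ.2⟩)
  have h2 := Measure.quasiMeasurePreserving_snd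
    (μ := volume.restrict (Set.Ioc 0 (2 * Real.pi)))
    (ν := volume.restrict (Set.Ioc 0 (Real.pi / 2))) |>.ae h
  exact Measure.quasiMeasurePreserving_snd (μ := (volume : Measure E3)) |>.ae h2

/-- The iterated integral over the collision parameters of a gain and a loss term, where the loss
term depends on the relative velocity only. -/
lemma integral_collision_sub {Γ : E3 × ℝ × ℝ → ℝ} {G : E3 → ℝ} (hΓ : Integrable Γ collisionMeasure)
    (hG : Integrable G) :
    ∫ v, ∫ φ in (0 : ℝ)..(2 * Real.pi), ∫ θ in (0 : ℝ)..(Real.pi / 2),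
        (Γ (v, φ, θ) - G v) * (Real.sin θ * Real.cos θ) =
      ∫ q, Γ q ∂collisionMeasure - Real.pi * ∫ v, G v := by
  have hpi := Real.pi_pos
  have hm : Measurable fun q : E3 × ℝ × ℝ => ENNReal.ofReal (Real.sin q.2.2 * Real.cos q.2.2) := by
    fun_prop
  unfold collisionMeasure at hΓ ⊢
  rw [integrable_withDensity_iff_integrable_smul' hm
    (Filter.Eventually.of_forall fun _ => ENNReal.ofReal_lt_top)] at hΓ
  rw [integral_withDensity_eq_integral_toReal_smul hm
    (Filter.Eventually.of_forall fun _ => ENNReal.ofReal_lt_top)]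
  have heq : (fun q : E3 × ℝ × ℝ => (ENNReal.ofReal (Real.sin q.2.2 * Real.cos q.2.2)).toReal • Γ q)
      =ᵐ[(volume : Measure E3).prod ((volume.restrict (Set.Ioc 0 (2 * Real.pi))).prod
        (volume.restrict (Set.Ioc 0 (Real.pi / 2))))]
      fun q => Γ q * (Real.sin q.2.2 * Real.cos q.2.2) := by
    filter_upwards [ae_collisionMeasure_base] with q hq
    rw [ENNReal.toReal_ofReal hq, smul_eq_mul, mul_comm]
  have hΓ' := hΓ.congr heq
  rw [integral_congr_ae heq]
  have hsc : Integrable (fun y : ℝ × ℝ => Real.sin y.2 * Real.cos y.2)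
      ((volume.restrict (Set.Ioc 0 (2 * Real.pi))).prod
        (volume.restrict (Set.Ioc 0 (Real.pi / 2)))) := by
    refine Integrable.of_bound (C := 1) (by fun_prop) (Filter.Eventually.of_forall fun y => ?_)
    rw [norm_mul]
    exact mul_le_one₀ (Real.abs_sin_le_one _) (norm_nonneg _) (Real.abs_cos_le_one _)
  have hG' := hG.mul_prod hsc
  have hsub : ∫ v, ∫ φ in (0 : ℝ)..(2 * Real.pi), ∫ θ in (0 : ℝ)..(Real.pi / 2),
      (Γ (v, φ, θ) - G v) * (Real.sin θ * Real.cos θ) =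
      ∫ q, (Γ q * (Real.sin q.2.2 * Real.cos q.2.2) - G q.1 * (Real.sin q.2.2 * Real.cos q.2.2))
        ∂((volume : Measure E3).prod ((volume.restrict (Set.Ioc 0 (2 * Real.pi))).prod
          (volume.restrict (Set.Ioc 0 (Real.pi / 2))))) := by
    refine Eq.trans ?_ (integral_prod _ (hΓ'.sub hG')).symm
    refine integral_congr_ae ?_
    filter_upwards [(hΓ'.sub hG').prod_right_ae] with v hv
    rw [integral_prod _ hv, intervalIntegral.integral_of_le (by positivity)]
    refine integral_congr_ae (Filter.Eventually.of_forall fun φ => ?_)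
    simp only
    rw [intervalIntegral.integral_of_le (by positivity)]
    simp only [sub_mul, Pi.sub_apply]
  rw [hsub, integral_sub hΓ' hG']
  congr 1
  rw [integral_prod_mul (f := G) (g := fun y : ℝ × ℝ => Real.sin y.2 * Real.cos y.2), mul_comm]
  congr 1
  have h3 := integral_prod_mul (μ := volume.restrict (Set.Ioc 0 (2 * Real.pi)))
    (ν := volume.restrict (Set.Ioc 0 (Real.pi / 2))) (fun _ : ℝ => (1 : ℝ))
    (fun θ => Real.sin θ * Real.cos θ)
  simp only [one_mul] at h3
  rw [h3, ← intervalIntegral.integral_of_le (by positivity),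
    ← intervalIntegral.integral_of_le (by positivity), integral_sin_mul_cos]
  simp
  ring

/-- The gain term `F(ζ') M(ζ_*') B₀ |ζ_* - ζ|^γ` of `Q(F, M)`, without the angular factor, as a
function of `(ζ' - ζ, ζ_*' - ζ)`. -/
def gainIntegrand (B₀ γ : ℝ) (F : E3 → ℝ) (ζ : E3) (w : E3 × E3) : ℝ :=
  maxwellian (ζ + w.2) * F (ζ + w.1) * (B₀ * ‖w.1 + w.2‖ ^ γ)

lemma integral_gain_sub_loss {B₀ γ : ℝ} {F G : E3 → ℝ} {ζ : E3}
    (hΓ : Integrable (fun q => gainIntegrand B₀ γ F ζ (collisionMap q)) collisionMeasure)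
    (hG : Integrable fun v => B₀ * ‖v‖ ^ γ * G (ζ + v)) :
    ∫ ζs : E3, ∫ φ in (0 : ℝ)..(2 * Real.pi), ∫ θ in (0 : ℝ)..(Real.pi / 2),
        (maxwellian (ζs - momentum stdE2 stdE3 (ζs - ζ) θ φ) *
          F (ζ + momentum stdE2 stdE3 (ζs - ζ) θ φ) - G ζs) * crossSection B₀ γ ‖ζ - ζs‖ θ =
      ∫ q, gainIntegrand B₀ γ F ζ (collisionMap q) ∂collisionMeasure -
        Real.pi * ∫ v, B₀ * ‖v‖ ^ γ * G (ζ + v) := by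
  rw [← integral_collision_sub hΓ hG, ← integral_add_left_eq_self _ ζ]
  refine integral_congr_ae (Filter.Eventually.of_forall fun v => ?_)
  simp only [add_sub_cancel_left, crossSection, gainIntegrand, collisionMap, add_sub_cancel]
  congr 1
  ext1 φ
  congr 1
  ext1 θ
  rw [show ζ - (ζ + v) = -v by abel, norm_neg, add_sub_assoc]
  ring

lemma sqrt_maxwellian (ζ : E3) : Real.sqrt (maxwellian ζ) =
    Real.sqrt (Real.pi ^ (-(3 / 2) : ℝ)) * Real.exp (-(1 / 2) * ‖ζ‖ ^ 2) := by
  have hpi := Real.pi_pos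
  unfold maxwellian
  rw [Real.sqrt_mul (by positivity)]
  congr 1
  rw [Real.sqrt_eq_iff_mul_self_eq (by positivity) (by positivity), ← Real.exp_add]
  congr 1
  ring

/-- In the variables of `planeMap`, the weighted gain term of `M^{-1/2} Q` is `planeDensity` times the
weighted function at `ζ + p`. -/
lemma weight_mul_gainIntegrand (B₀ γ α : ℝ) (h : E3 → ℝ) (ζ : E3) {p : E3} (hp : p ≠ 0)
    (s : ℝ × ℝ) :
    Real.exp (α * ‖ζ‖ ^ 2) * (Real.sqrt (maxwellian ζ))⁻¹ *
      (‖p‖⁻¹ * ‖p + (planeMap (p, s)).2‖⁻¹ *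
        gainIntegrand B₀ γ (fun η => Real.sqrt (maxwellian η) * h η) ζ (planeMap (p, s))) =
    planeDensity B₀ γ α ζ (p, s) * (Real.exp (α * ‖ζ + p‖ ^ 2) * h (ζ + p)) := by
  have hpi := Real.pi_pos
  have hc : Real.sqrt (Real.pi ^ (-(3 / 2) : ℝ)) ≠ 0 := (Real.sqrt_pos.2 (by positivity)).ne'
  have hperp := inner_planeMap hp s
  simp only [gainIntegrand, planeDensity, sqrt_maxwellian]
  rw [show (planeMap (p, s)).1 = p from rfl]
  generalize (planeMap (p, s)).2 = q at hperp ⊢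
  -- the conservation of energy
  have hE : ‖ζ‖ ^ 2 = ‖ζ + p‖ ^ 2 + ‖ζ + q‖ ^ 2 - ‖ζ + q + p‖ ^ 2 := by
    have h1 := norm_add_sq_real ζ p
    have h2 := norm_add_sq_real ζ q
    have h3 := norm_add_sq_real (ζ + q) p
    rw [inner_add_left, real_inner_comm, real_inner_comm p q] at h3
    rw [real_inner_comm] at h1
    linarith
  have hexp : Real.exp (α * ‖ζ‖ ^ 2) * (Real.exp (-(1 / 2) * ‖ζ‖ ^ 2))⁻¹ *
      (Real.exp (-‖ζ + q‖ ^ 2) * Real.exp (-(1 / 2) * ‖ζ + p‖ ^ 2)) =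
      Real.exp (-(1 / 2 - α) * ‖ζ + q‖ ^ 2 - (1 / 2 + α) * ‖ζ + q + p‖ ^ 2) *
        Real.exp (α * ‖ζ + p‖ ^ 2) := by
    rw [← Real.exp_neg, ← Real.exp_add, ← Real.exp_add, ← Real.exp_add, ← Real.exp_add]
    congr 1
    linear_combination (α + 1 / 2) * hE
  unfold maxwellian
  rw [mul_inv]
  generalize Real.sqrt (Real.pi ^ (-(3 / 2) : ℝ)) = c at hc ⊢
  calc _ = (c⁻¹ * c) * (‖p‖⁻¹ * ‖p + q‖⁻¹ * (B₀ * ‖p + q‖ ^ γ) * Real.pi ^ (-(3 / 2) : ℝ)) *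
        h (ζ + p) * (Real.exp (α * ‖ζ‖ ^ 2) * (Real.exp (-(1 / 2) * ‖ζ‖ ^ 2))⁻¹ *
      (Real.exp (-‖ζ + q‖ ^ 2) * Real.exp (-(1 / 2) * ‖ζ + p‖ ^ 2))) := by ring
    _ = _ := by
      rw [hexp, inv_mul_cancel₀ hc]
      ring

lemma weight_mul_loss (B₀ γ α : ℝ) (h : E3 → ℝ) (ζ p : E3) :
    Real.exp (α * ‖ζ‖ ^ 2) * (Real.sqrt (maxwellian ζ))⁻¹ * (Real.pi * (B₀ * ‖p‖ ^ γ *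
      (maxwellian ζ * (Real.sqrt (maxwellian (ζ + p)) * h (ζ + p))))) =
    lossKernel B₀ γ α ζ p * (Real.exp (α * ‖ζ + p‖ ^ 2) * h (ζ + p)) := by
  have hpi := Real.pi_pos
  have hc : Real.sqrt (Real.pi ^ (-(3 / 2) : ℝ)) ≠ 0 := (Real.sqrt_pos.2 (by positivity)).ne'
  have hexp : Real.exp (α * ‖ζ‖ ^ 2) * (Real.exp (-(1 / 2) * ‖ζ‖ ^ 2))⁻¹ *
      (Real.exp (-‖ζ‖ ^ 2) * Real.exp (-(1 / 2) * ‖ζ + p‖ ^ 2)) =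
      Real.exp (-(1 / 2 - α) * ‖ζ‖ ^ 2 - (1 / 2 + α) * ‖ζ + p‖ ^ 2) *
        Real.exp (α * ‖ζ + p‖ ^ 2) := by
    rw [← Real.exp_neg, ← Real.exp_add, ← Real.exp_add, ← Real.exp_add, ← Real.exp_add]
    congr 1
    ring
  simp only [lossKernel, sqrt_maxwellian]
  unfold maxwellian
  rw [mul_inv]
  generalize Real.sqrt (Real.pi ^ (-(3 / 2) : ℝ)) = c at hc ⊢
  calc _ = (c⁻¹ * c) * (Real.pi * B₀ * ‖p‖ ^ γ * Real.pi ^ (-(3 / 2) : ℝ)) *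
        h (ζ + p) * (Real.exp (α * ‖ζ‖ ^ 2) * (Real.exp (-(1 / 2) * ‖ζ‖ ^ 2))⁻¹ *
      (Real.exp (-‖ζ‖ ^ 2) * Real.exp (-(1 / 2) * ‖ζ + p‖ ^ 2))) := by ring
    _ = _ := by
      rw [hexp, inv_mul_cancel₀ hc]
      ring

lemma measurable_maxwellian : Measurable maxwellian := by
  unfold maxwellian
  fun_prop

lemma maxwellian_pos (ζ : E3) : 0 < maxwellian ζ := by
  have := Real.pi_pos
  unfold maxwellian
  positivity

lemma measurable_planeMap_weight :
    Measurable fun q : E3 × ℝ × ℝ => ENNReal.ofReal (‖q.1‖⁻¹ * ‖q.1 + (planeMap q).2‖⁻¹) := by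
  have h1 := measurable_planeMap
  have h2 := measurable_stdE2
  have h3 := measurable_stdE3
  fun_prop

lemma quasiMeasurePreserving_planeMap_fst :
    Measure.QuasiMeasurePreserving (fun w : E3 × E3 => w.1) (planeMeasure.map planeMap) volume := by
  refine ⟨measurable_fst, ?_⟩
  rw [Measure.map_map measurable_fst measurable_planeMap]
  have h1 : planeMeasure ≪ (volume : Measure (E3 × ℝ × ℝ)) := withDensity_absolutelyContinuous _ _
  exact (h1.map (measurable_fst.comp measurable_planeMap)).trans
    (Measure.quasiMeasurePreserving_fst (μ := (volume : Measure E3))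
      (ν := (volume : Measure (ℝ × ℝ)))).absolutelyContinuous

lemma quasiMeasurePreserving_add_left (ζ : E3) :
    Measure.QuasiMeasurePreserving (fun p : E3 => ζ + p) volume volume :=
  (measurePreserving_add_left volume ζ).quasiMeasurePreserving

lemma integrable_planeDensity_mul {B₀ γ α c : ℝ} (hB₀ : 0 ≤ B₀) (hγ₀ : 0 ≤ γ) (hγ₁ : γ ≤ 1)
    (hα₀ : 0 ≤ α) (hα₁ : α < 1 / 2) {g : E3 → ℝ} (hg : AEStronglyMeasurable g)
    (hgc : ∀ᵐ η, ‖g η‖ ≤ c) (ζ : E3) :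
    Integrable fun s : E3 × ℝ × ℝ => planeDensity B₀ γ α ζ s * g (ζ + s.1) := by
  have hq := (quasiMeasurePreserving_add_left ζ).comp
    (Measure.quasiMeasurePreserving_fst (μ := (volume : Measure E3))
      (ν := (volume : Measure (ℝ × ℝ))))
  exact (integrable_planeDensity hB₀ hγ₀ hγ₁ hα₀ hα₁ ζ).mul_bdd (c := c)
    (hg.comp_quasiMeasurePreserving hq) (hq.ae hgc)

lemma aestronglyMeasurable_of_weight {α : ℝ} {h : E3 → ℝ}
    (hg : AEStronglyMeasurable fun η => Real.exp (α * ‖η‖ ^ 2) * h η) :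
    AEStronglyMeasurable h := by
  have h1 : h = fun η => Real.exp (-(α * ‖η‖ ^ 2)) * (Real.exp (α * ‖η‖ ^ 2) * h η) := by
    ext1 η
    rw [← mul_assoc, ← Real.exp_add, neg_add_cancel, Real.exp_zero, one_mul]
  rw [h1]
  exact AEStronglyMeasurable.mul (Measurable.aestronglyMeasurable (by fun_prop)) hg

section Gain

variable {B₀ γ α c : ℝ} {h : E3 → ℝ}

lemma aestronglyMeasurable_gainIntegrand
    (hg : AEStronglyMeasurable fun η => Real.exp (α * ‖η‖ ^ 2) * h η) (ζ : E3) :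
    AEStronglyMeasurable (gainIntegrand B₀ γ (fun η => Real.sqrt (maxwellian η) * h η) ζ)
      (planeMeasure.map planeMap) := by
  have hM := measurable_maxwellian
  have hF : AEStronglyMeasurable fun η => Real.sqrt (maxwellian η) * h η :=
    AEStronglyMeasurable.mul (Measurable.aestronglyMeasurable (by fun_prop))
      (aestronglyMeasurable_of_weight hg)
  have h1 := hF.comp_quasiMeasurePreserving
    ((quasiMeasurePreserving_add_left ζ).comp quasiMeasurePreserving_planeMap_fst)
  unfold gainIntegrand
  refine AEStronglyMeasurable.mul (AEStronglyMeasurable.mul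
    (Measurable.aestronglyMeasurable (by fun_prop)) h1)
    (Measurable.aestronglyMeasurable (by fun_prop))

lemma planeMeasure_smul_gainIntegrand_ae (ζ : E3) :
    (fun q : E3 × ℝ × ℝ => (ENNReal.ofReal (‖q.1‖⁻¹ * ‖q.1 + (planeMap q).2‖⁻¹)).toReal •
      gainIntegrand B₀ γ (fun η => Real.sqrt (maxwellian η) * h η) ζ (planeMap q)) =ᵐ[volume]
    fun q => (Real.exp (α * ‖ζ‖ ^ 2) * (Real.sqrt (maxwellian ζ))⁻¹)⁻¹ *
      (planeDensity B₀ γ α ζ q * (Real.exp (α * ‖ζ + q.1‖ ^ 2) * h (ζ + q.1))) := by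
  have hC : Real.exp (α * ‖ζ‖ ^ 2) * (Real.sqrt (maxwellian ζ))⁻¹ ≠ 0 :=
    mul_ne_zero (Real.exp_pos _).ne' (inv_ne_zero (Real.sqrt_pos.2 (maxwellian_pos ζ)).ne')
  filter_upwards [ae_fst_ne_zero] with q hq
  rw [ENNReal.toReal_ofReal (by positivity), smul_eq_mul, eq_inv_mul_iff_mul_eq₀ hC]
  exact weight_mul_gainIntegrand B₀ γ α h ζ hq q.2

lemma integrable_gainIntegrand (hB₀ : 0 ≤ B₀) (hγ₀ : 0 ≤ γ) (hγ₁ : γ ≤ 1) (hα₀ : 0 ≤ α)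
    (hα₁ : α < 1 / 2) (hg : AEStronglyMeasurable fun η => Real.exp (α * ‖η‖ ^ 2) * h η)
    (hgc : ∀ᵐ η, ‖Real.exp (α * ‖η‖ ^ 2) * h η‖ ≤ c) (ζ : E3) :
    Integrable (gainIntegrand B₀ γ (fun η => Real.sqrt (maxwellian η) * h η) ζ)
      (planeMeasure.map planeMap) := by
  rw [integrable_map_measure (aestronglyMeasurable_gainIntegrand hg ζ)
    measurable_planeMap.aemeasurable]
  unfold planeMeasure
  rw [integrable_withDensity_iff_integrable_smul' measurable_planeMap_weight
    (Filter.Eventually.of_forall fun _ => ENNReal.ofReal_lt_top)]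
  exact ((integrable_planeDensity_mul hB₀ hγ₀ hγ₁ hα₀ hα₁ hg hgc ζ).const_mul _).congr
    (planeMeasure_smul_gainIntegrand_ae ζ).symm

lemma integral_gainIntegrand (hB₀ : 0 ≤ B₀) (hγ₀ : 0 ≤ γ) (hγ₁ : γ ≤ 1) (hα₀ : 0 ≤ α)
    (hα₁ : α < 1 / 2) (hg : AEStronglyMeasurable fun η => Real.exp (α * ‖η‖ ^ 2) * h η)
    (hgc : ∀ᵐ η, ‖Real.exp (α * ‖η‖ ^ 2) * h η‖ ≤ c) (ζ : E3) :
    Real.exp (α * ‖ζ‖ ^ 2) * (Real.sqrt (maxwellian ζ))⁻¹ *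
      ∫ w, gainIntegrand B₀ γ (fun η => Real.sqrt (maxwellian η) * h η) ζ w
        ∂(planeMeasure.map planeMap) =
    ∫ p, gainKernel B₀ γ α ζ p * (Real.exp (α * ‖ζ + p‖ ^ 2) * h (ζ + p)) := by
  have hC : Real.exp (α * ‖ζ‖ ^ 2) * (Real.sqrt (maxwellian ζ))⁻¹ ≠ 0 :=
    mul_ne_zero (Real.exp_pos _).ne' (inv_ne_zero (Real.sqrt_pos.2 (maxwellian_pos ζ)).ne')
  rw [integral_map measurable_planeMap.aemeasurable (aestronglyMeasurable_gainIntegrand hg ζ)]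
  unfold planeMeasure
  rw [integral_withDensity_eq_integral_toReal_smul measurable_planeMap_weight
    (Filter.Eventually.of_forall fun _ => ENNReal.ofReal_lt_top),
    integral_congr_ae (planeMeasure_smul_gainIntegrand_ae (α := α) ζ), integral_const_mul,
    mul_inv_cancel_left₀ hC]
  have hi := integrable_planeDensity_mul hB₀ hγ₀ hγ₁ hα₀ hα₁ hg hgc ζ
  rw [Measure.volume_eq_prod] at hi ⊢
  rw [integral_prod _ hi]
  refine integral_congr_ae (Filter.Eventually.of_forall fun p => ?_)
  simp only [gainKernel]
  rw [integral_mul_const]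

lemma integrable_loss_mul (hB₀ : 0 ≤ B₀) (hγ₀ : 0 ≤ γ) (hα₀ : 0 ≤ α) (hα₁ : α < 1 / 2)
    (hg : AEStronglyMeasurable fun η => Real.exp (α * ‖η‖ ^ 2) * h η)
    (hgc : ∀ᵐ η, ‖Real.exp (α * ‖η‖ ^ 2) * h η‖ ≤ c) (ζ : E3) :
    Integrable fun p => lossKernel B₀ γ α ζ p * (Real.exp (α * ‖ζ + p‖ ^ 2) * h (ζ + p)) := by
  have hq := quasiMeasurePreserving_add_left ζ
  exact (integrable_lossKernel hB₀ hγ₀ hα₀ hα₁ ζ).mul_bdd (c := c)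
    (hg.comp_quasiMeasurePreserving hq) (hq.ae hgc)

lemma integrable_gain_mul (hB₀ : 0 ≤ B₀) (hγ₀ : 0 ≤ γ) (hγ₁ : γ ≤ 1) (hα₀ : 0 ≤ α)
    (hα₁ : α < 1 / 2) (hg : AEStronglyMeasurable fun η => Real.exp (α * ‖η‖ ^ 2) * h η)
    (hgc : ∀ᵐ η, ‖Real.exp (α * ‖η‖ ^ 2) * h η‖ ≤ c) (ζ : E3) :
    Integrable fun p => gainKernel B₀ γ α ζ p * (Real.exp (α * ‖ζ + p‖ ^ 2) * h (ζ + p)) := by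
  have hq := quasiMeasurePreserving_add_left ζ
  exact (integrable_gainKernel hB₀ hγ₀ hγ₁ hα₀ hα₁ ζ).mul_bdd (c := c)
    (hg.comp_quasiMeasurePreserving hq) (hq.ae hgc)

lemma integrable_rpow_mul_maxwellian (hγ₀ : 0 ≤ γ) (ζ : E3) :
    Integrable fun v : E3 => B₀ * ‖v‖ ^ γ * maxwellian (ζ + v) := by
  have hM := measurable_maxwellian
  have hpi := Real.pi_pos
  have h1 := ((integrable_lossKernel (B₀ := 1) (α := 0) zero_le_one hγ₀ le_rfl
    (by norm_num) ζ).const_mul (Real.pi⁻¹ * Real.exp (1 / 2 * ‖ζ‖ ^ 2)))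
  have h2 : Integrable fun v : E3 => ‖v‖ ^ γ * maxwellian (ζ + v) := by
    refine h1.mono' (Measurable.aestronglyMeasurable (by fun_prop))
      (Filter.Eventually.of_forall fun v => ?_)
    rw [Real.norm_of_nonneg (mul_nonneg (by positivity) (maxwellian_pos _).le)]
    unfold lossKernel maxwellian
    have h3 : Real.exp (-‖ζ + v‖ ^ 2) ≤ Real.exp (1 / 2 * ‖ζ‖ ^ 2) *
        Real.exp (-(1 / 2 - 0) * ‖ζ‖ ^ 2 - (1 / 2 + 0) * ‖ζ + v‖ ^ 2) := by
      rw [← Real.exp_add]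
      refine Real.exp_le_exp.2 ?_
      nlinarith [sq_nonneg ‖ζ + v‖]
    calc _ ≤ ‖v‖ ^ γ * (Real.pi ^ (-(3 / 2) : ℝ) * (Real.exp (1 / 2 * ‖ζ‖ ^ 2) *
        Real.exp (-(1 / 2 - 0) * ‖ζ‖ ^ 2 - (1 / 2 + 0) * ‖ζ + v‖ ^ 2))) := by gcongr
      _ = _ := by field_simp
  refine (h2.const_mul B₀).congr (Filter.Eventually.of_forall fun v => ?_)
  simp only
  ring

/-- `K`, conjugated by the weight, is the integral operator with kernel `collisionKernel`. The loss
term of `Q(M^{1/2} h, M)` is the one that `ν` cancels. -/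
lemma weighted_opK_eq {e₂ e₃ : E3 → E3} (he : IsCollisionFrame e₂ e₃) (hB₀ : 0 ≤ B₀) (hγ₀ : 0 ≤ γ)
    (hγ₁ : γ ≤ 1) (hα₀ : 0 ≤ α) (hα₁ : α < 1 / 2) {f : E3 × E3 → ℝ} {x : E3}
    (hg : AEStronglyMeasurable fun η => weighted α f (x, η))
    (hgc : ∀ᵐ η, ‖weighted α f (x, η)‖ ≤ c) (ζ : E3) :
    weighted α (opK e₂ e₃ B₀ γ f) (x, ζ) =
      ∫ η, collisionKernel B₀ γ α (ζ, η) * weighted α f (x, η) := by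
  obtain ⟨h, hh⟩ : ∃ h : E3 → ℝ, h = fun η => f (x, η) := ⟨_, rfl⟩
  have hw : ∀ η, weighted α f (x, η) = Real.exp (α * ‖η‖ ^ 2) * h η := fun η => by
    simp only [hh, weighted]
  simp only [hw] at hg hgc ⊢
  have hM0 : Real.sqrt (maxwellian ζ) ≠ 0 := (Real.sqrt_pos.2 (maxwellian_pos ζ)).ne'
  set F : E3 → ℝ := fun η => Real.sqrt (maxwellian η) * h η with hF
  have hΓ := integrable_gainIntegrand hB₀ hγ₀ hγ₁ hα₀ hα₁ hg hgc ζ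
  have hI := integral_gainIntegrand hB₀ hγ₀ hγ₁ hα₀ hα₁ hg hgc ζ
  have hmeas := aestronglyMeasurable_gainIntegrand (B₀ := B₀) (γ := γ) hg ζ
  rw [← map_collisionMap_collisionMeasure] at hΓ hI hmeas
  rw [integral_map measurable_collisionMap.aemeasurable hmeas] at hI
  have hΓc := hΓ.comp_measurable measurable_collisionMap
  set I : ℝ := ∫ q, gainIntegrand B₀ γ F ζ (collisionMap q) ∂collisionMeasure with hIdef
  have hloss := integrable_loss_mul hB₀ hγ₀ hα₀ hα₁ hg hgc ζ
  have hC : Real.exp (α * ‖ζ‖ ^ 2) * (Real.sqrt (maxwellian ζ))⁻¹ ≠ 0 :=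
    mul_ne_zero (Real.exp_pos _).ne' (inv_ne_zero hM0)
  have hl : ∀ p, lossKernel B₀ γ α ζ p * (Real.exp (α * ‖ζ + p‖ ^ 2) * h (ζ + p)) =
      Real.exp (α * ‖ζ‖ ^ 2) * (Real.sqrt (maxwellian ζ))⁻¹ * (Real.pi * (B₀ * ‖p‖ ^ γ *
        (maxwellian ζ * F (ζ + p)))) := fun p => (weight_mul_loss B₀ γ α h ζ p).symm
  have hG₁ : Integrable fun p => B₀ * ‖p‖ ^ γ * (maxwellian ζ * F (ζ + p)) := by
    simp only [hl] at hloss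
    have h1 := hloss.const_mul
      (Real.exp (α * ‖ζ‖ ^ 2) * (Real.sqrt (maxwellian ζ))⁻¹ * Real.pi)⁻¹
    refine h1.congr (Filter.Eventually.of_forall fun p => ?_)
    simp only
    rw [← mul_assoc _ Real.pi, inv_mul_cancel_left₀ (mul_ne_zero hC Real.pi_pos.ne')]
  have hG₂ : Integrable fun p => B₀ * ‖p‖ ^ γ * (F ζ * maxwellian (ζ + p)) := by
    refine ((integrable_rpow_mul_maxwellian (B₀ := B₀) hγ₀ ζ).const_mul (F ζ)).congr
      (Filter.Eventually.of_forall fun p => ?_)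
    simp only
    ring
  have hA₁ : collisionQ e₂ e₃ B₀ γ maxwellian F ζ =
      I - Real.pi * ∫ p, B₀ * ‖p‖ ^ γ * (maxwellian ζ * F (ζ + p)) := by
    rw [collisionQ_frame he, collisionQ_swap]
    exact integral_gain_sub_loss (G := fun η => maxwellian ζ * F η) hΓc hG₁
  have hA₂ : collisionQ e₂ e₃ B₀ γ F maxwellian ζ = I - F ζ * collisionFreq B₀ γ ζ := by
    rw [collisionQ_frame he]
    have h1 := integral_gain_sub_loss (G := fun η => F ζ * maxwellian η) hΓc hG₂
    have h2 : ∫ p, B₀ * ‖p‖ ^ γ * (F ζ * maxwellian (ζ + p)) =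
        F ζ * ∫ p, B₀ * ‖p‖ ^ γ * maxwellian (ζ + p) := by
      rw [← integral_const_mul]
      refine integral_congr_ae (Filter.Eventually.of_forall fun p => ?_)
      simp only
      ring
    rw [collisionFreq_eq]
    rw [h2] at h1
    refine Eq.trans ?_ (h1.trans ?_)
    · unfold collisionQ
      congr 1
      ext1 ζs
      refine intervalIntegral.integral_congr fun φ _ => ?_
      refine intervalIntegral.integral_congr fun θ _ => ?_
      change (F (ζ + momentum stdE2 stdE3 (ζs - ζ) θ φ) *
        maxwellian (ζs - momentum stdE2 stdE3 (ζs - ζ) θ φ) - _) * _ = _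
      ring
    · ring
  have hgain := integrable_gain_mul hB₀ hγ₀ hγ₁ hα₀ hα₁ hg hgc ζ
  have hR : ∫ η, collisionKernel B₀ γ α (ζ, η) * (Real.exp (α * ‖η‖ ^ 2) * h η) =
      2 * (∫ p, gainKernel B₀ γ α ζ p * (Real.exp (α * ‖ζ + p‖ ^ 2) * h (ζ + p))) -
        ∫ p, lossKernel B₀ γ α ζ p * (Real.exp (α * ‖ζ + p‖ ^ 2) * h (ζ + p)) := by
    rw [← integral_add_left_eq_self _ ζ, ← integral_const_mul,
      ← integral_sub (hgain.const_mul 2) hloss]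
    refine integral_congr_ae (Filter.Eventually.of_forall fun p => ?_)
    simp only [collisionKernel, weightedKernel, add_sub_cancel_left]
    ring
  have hL : ∫ p, lossKernel B₀ γ α ζ p * (Real.exp (α * ‖ζ + p‖ ^ 2) * h (ζ + p)) =
      Real.exp (α * ‖ζ‖ ^ 2) * (Real.sqrt (maxwellian ζ))⁻¹ *
        (Real.pi * ∫ p, B₀ * ‖p‖ ^ γ * (maxwellian ζ * F (ζ + p))) := by
    simp only [hl]
    rw [integral_const_mul, integral_const_mul]
  rw [hR, hL, ← hI]
  have hopK : opK e₂ e₃ B₀ γ f (x, ζ) = (Real.sqrt (maxwellian ζ))⁻¹ *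
      (collisionQ e₂ e₃ B₀ γ maxwellian F ζ + collisionQ e₂ e₃ B₀ γ F maxwellian ζ) +
        collisionFreq B₀ γ ζ * h ζ := by
    simp only [opK, linearizedL, hF, hh]
  change Real.exp (α * ‖ζ‖ ^ 2) * opK e₂ e₃ B₀ γ f (x, ζ) = _
  rw [hopK, hA₁, hA₂, show F ζ = Real.sqrt (maxwellian ζ) * h ζ from rfl]
  generalize ∫ p, B₀ * ‖p‖ ^ γ * (maxwellian ζ * F (ζ + p)) = J
  field_simp
  ring

end Gain

/-! ### The collision frequency -/

lemma measurable_collisionFreq (B₀ γ : ℝ) : Measurable (collisionFreq B₀ γ) := by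
  have hM := measurable_maxwellian
  rw [show collisionFreq B₀ γ = fun ζ => Real.pi * ∫ v : E3, B₀ * ‖v‖ ^ γ * maxwellian (ζ + v) from
    funext (collisionFreq_eq B₀ γ)]
  refine Measurable.const_mul (StronglyMeasurable.measurable ?_) _
  refine StronglyMeasurable.integral_prod_right'
    (f := fun q : E3 × E3 => B₀ * ‖q.2‖ ^ γ * maxwellian (q.1 + q.2)) ?_
  exact Measurable.stronglyMeasurable (by fun_prop)

lemma maxwellian_neg (ζ : E3) : maxwellian (-ζ) = maxwellian ζ := by
  simp [maxwellian]

lemma collisionFreq_neg (B₀ γ : ℝ) (ζ : E3) : collisionFreq B₀ γ (-ζ) = collisionFreq B₀ γ ζ := by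
  rw [collisionFreq_eq, collisionFreq_eq, ← integral_neg_eq_self]
  congr 1
  refine integral_congr_ae (Filter.Eventually.of_forall fun v => ?_)
  simp only
  rw [norm_neg, ← neg_add, maxwellian_neg]

lemma collisionFreq_zero_pos {B₀ γ : ℝ} (hB₀ : 0 < B₀) (hγ₀ : 0 ≤ γ) :
    0 < collisionFreq B₀ γ 0 := by
  rw [collisionFreq_eq]
  refine mul_pos Real.pi_pos ?_
  have h0 : ∀ v : E3, 0 ≤ B₀ * ‖v‖ ^ γ * maxwellian (0 + v) := fun v =>
    mul_nonneg (by positivity) (maxwellian_pos _).le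
  rw [integral_pos_iff_support_of_nonneg h0 (integrable_rpow_mul_maxwellian hγ₀ 0)]
  refine lt_of_lt_of_le ?_ (measure_mono (s := ({0}ᶜ : Set E3)) fun v hv => ?_)
  · exact isOpen_compl_singleton.measure_pos volume (exists_ne (0 : E3))
  · have hv' : 0 < ‖v‖ := norm_pos_iff.2 hv
    exact (mul_pos (mul_pos hB₀ (Real.rpow_pos_of_pos hv' γ)) (maxwellian_pos _)).ne'

/-- The collision frequency is bounded away from `0`. It is even, and of the two numbers `|ζ + u|`
and `|ζ - u|` one is at least `|u|`. -/
lemma collisionFreq_ge {B₀ γ : ℝ} (hB₀ : 0 ≤ B₀) (hγ₀ : 0 ≤ γ) (ζ : E3) :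
    collisionFreq B₀ γ 0 / 2 ≤ collisionFreq B₀ γ ζ := by
  have hshift : ∀ ξ : E3, collisionFreq B₀ γ ξ =
      Real.pi * ∫ u : E3, B₀ * ‖u - ξ‖ ^ γ * maxwellian u := by
    intro ξ
    rw [collisionFreq_eq, ← integral_sub_right_eq_self _ ξ]
    simp only [add_sub_cancel]
  have hint : ∀ ξ : E3, Integrable fun u : E3 => B₀ * ‖u - ξ‖ ^ γ * maxwellian u := by
    intro ξ
    have h := (integrable_rpow_mul_maxwellian (B₀ := B₀) hγ₀ ξ).comp_sub_right ξ
    simpa only [add_sub_cancel] using h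
  have h2 : collisionFreq B₀ γ 0 ≤ collisionFreq B₀ γ ζ + collisionFreq B₀ γ (-ζ) := by
    rw [hshift 0, hshift ζ, hshift (-ζ), ← mul_add, ← integral_add (hint _) (hint _)]
    refine mul_le_mul_of_nonneg_left (integral_mono (hint 0) ((hint ζ).add (hint (-ζ)))
      fun u => ?_) Real.pi_pos.le
    simp only [sub_zero, sub_neg_eq_add]
    have h3 : ‖u‖ ^ γ ≤ ‖u - ζ‖ ^ γ + ‖u + ζ‖ ^ γ := by
      have h4 : 2 * ‖u‖ ≤ ‖u - ζ‖ + ‖u + ζ‖ := by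
        have := norm_add_le (u - ζ) (u + ζ)
        rw [show u - ζ + (u + ζ) = (2 : ℝ) • u by module, norm_smul] at this
        simpa using this
      have h5 : 0 ≤ ‖u - ζ‖ ^ γ := by positivity
      have h6 : 0 ≤ ‖u + ζ‖ ^ γ := by positivity
      rcases le_total ‖u‖ ‖u - ζ‖ with h | h
      · linarith [Real.rpow_le_rpow (norm_nonneg _) h hγ₀]
      · have h7 : ‖u‖ ≤ ‖u + ζ‖ := by linarith
        linarith [Real.rpow_le_rpow (norm_nonneg _) h7 hγ₀]
    have h8 := mul_le_mul_of_nonneg_right (mul_le_mul_of_nonneg_left h3 hB₀) (maxwellian_pos u).le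
    linarith
  rw [collisionFreq_neg] at h2
  linarith

/-! ### `S_Ω` as an average along characteristics -/

/-- Along a backward characteristic that starts in a bounded convex domain, the points before the
exit time lie in the domain and the points after it do not. -/
lemma sub_smul_mem_iff {Ω : Set E3} (hΩ : Convex ℝ Ω) (hΩb : Bornology.IsBounded Ω) {x ζ : E3}
    (hx : x ∈ Ω) (hζ : ζ ≠ 0) {s : ℝ} (hs : 0 < s) (hne : s ≠ exitTime Ω x ζ) :
    x - s • ζ ∈ Ω ↔ s < exitTime Ω x ζ := by
  have hbdd : BddBelow {s : ℝ | 0 < s ∧ x - s • ζ ∉ Ω} := ⟨0, fun t ht => ht.1.le⟩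
  constructor
  · intro hmem
    by_contra hcon
    have hlt : exitTime Ω x ζ < s := lt_of_le_of_ne (not_lt.1 hcon) hne.symm
    have hnonempty : {s : ℝ | 0 < s ∧ x - s • ζ ∉ Ω}.Nonempty := by
      obtain ⟨r, hr⟩ := hΩb.exists_norm_le
      have hr0 : 0 ≤ r := (norm_nonneg x).trans (hr x hx)
      have hζ' : 0 < ‖ζ‖ := norm_pos_iff.2 hζ
      refine ⟨(2 * r + 1) / ‖ζ‖, by positivity, fun hm => ?_⟩
      have h1 := norm_sub_le x (x - ((2 * r + 1) / ‖ζ‖) • ζ)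
      rw [sub_sub_cancel, norm_smul, Real.norm_of_nonneg (by positivity),
        div_mul_cancel₀ _ hζ'.ne'] at h1
      linarith [hr x hx, hr _ hm]
    obtain ⟨b, hb, hbs⟩ := exists_lt_of_csInf_lt hnonempty hlt
    refine hb.2 ?_
    have h2 := hΩ hx hmem (a := 1 - b / s) (b := b / s)
      (by rw [sub_nonneg, div_le_one hs]; exact hbs.le) (div_nonneg hb.1.le hs.le) (by ring)
    have h3 : (1 - b / s) • x + (b / s) • (x - s • ζ) = x - b • ζ := by
      rw [smul_sub, smul_smul, div_mul_cancel₀ _ hs.ne']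
      module
    rwa [h3] at h2
  · intro hlt
    by_contra hcon
    exact absurd (csInf_le hbdd ⟨hs, hcon⟩) (not_le.2 hlt)

lemma weighted_opS_eq {Ω : Set E3} (hΩ : Convex ℝ Ω) (hΩb : Bornology.IsBounded Ω) (B₀ γ α : ℝ)
    (f : E3 × E3 → ℝ) {x ζ : E3} (hx : x ∈ Ω) (hζ : ζ ≠ 0) :
    weighted α (opS Ω B₀ γ f) (x, ζ) = kernelAverage (volume.restrict (Set.Ioi 0)) transportMap
      (transportKernel Ω (collisionFreq B₀ γ) fun _ => 1) (weighted α f) (x, ζ) := by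
  have hτ : 0 ≤ exitTime Ω x ζ := Real.sInf_nonneg fun s hs => hs.1.le
  unfold weighted opS kernelAverage
  simp only
  rw [intervalIntegral.integral_of_le hτ, ← integral_const_mul,
    ← integral_indicator measurableSet_Ioc, ← integral_indicator measurableSet_Ioi]
  refine integral_congr_ae ?_
  have h0 : ∀ᵐ s : ℝ, s ≠ exitTime Ω x ζ := compl_mem_ae_iff.2 (measure_singleton _)
  filter_upwards [h0] with s hne
  by_cases hs : 0 < s
  · rw [Set.indicator_of_mem (s := Set.Ioi (0 : ℝ)) hs]
    have hiff := sub_smul_mem_iff hΩ hΩb hx hζ hs hne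
    by_cases hm : x - s • ζ ∈ Ω
    · rw [Set.indicator_of_mem (show s ∈ Set.Ioc 0 (exitTime Ω x ζ) from ⟨hs, (hiff.1 hm).le⟩),
        transportKernel, Set.indicator_of_mem (by exact hm)]
      simp only [transportMap]
      ring
    · rw [Set.indicator_of_notMem (show s ∉ Set.Ioc 0 (exitTime Ω x ζ) from fun h =>
        hm (hiff.2 (lt_of_le_of_ne h.2 hne))), transportKernel,
        Set.indicator_of_notMem (by exact hm), zero_mul]
  · rw [Set.indicator_of_notMem (s := Set.Ioi (0 : ℝ)) hs,
      Set.indicator_of_notMem fun h => hs h.1]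

lemma isGivenBy_opS {Ω : Set E3} (hΩm : MeasurableSet Ω) (hΩ : Convex ℝ Ω)
    (hΩb : Bornology.IsBounded Ω) {B₀ γ C : ℝ} (α : ℝ)
    (hS : IsAdmissible (phaseMeasure Ω) (volume.restrict (Set.Ioi 0)) transportMap
      (transportKernel Ω (collisionFreq B₀ γ) fun _ => 1) C) :
    IsGivenBy (conjWeight α hS.toCLM) (opS Ω B₀ γ) := by
  refine isGivenBy_conjWeight fun G f hf => ?_
  refine Filter.EventuallyEq.trans ?_ (hS.toCLM_ae_eq hf).symm
  have h0 : ∀ᵐ ζ : E3, ζ ≠ 0 := compl_mem_ae_iff.2 (measure_singleton 0)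
  filter_upwards [ae_phase_of_ae_fst (ae_restrict_mem hΩm), ae_phase_of_ae_snd h0] with z hx hζ
  exact weighted_opS_eq hΩ hΩb B₀ γ α f hx hζ

lemma isGivenBy_opK {Ω : Set E3} {e₂ e₃ : E3 → E3} (he : IsCollisionFrame e₂ e₃) {B₀ γ α D : ℝ}
    (hB₀ : 0 ≤ B₀) (hγ₀ : 0 ≤ γ) (hγ₁ : γ ≤ 1) (hα₀ : 0 ≤ α) (hα₁ : α < 1 / 2)
    (hV : IsAdmissible (phaseMeasure Ω) volume velocityMap
      (fun q => collisionKernel B₀ γ α (q.1.2, q.2)) D) :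
    IsGivenBy (conjWeight α hV.toCLM) (opK e₂ e₃ B₀ γ) := by
  refine isGivenBy_conjWeight fun G f hf => ?_
  refine Filter.EventuallyEq.trans ?_ (hV.toCLM_ae_eq hf).symm
  filter_upwards [ae_phase_of_ae_fst (Measure.ae_ae_of_ae_prod hf),
    ae_phase_of_ae_fst (Measure.ae_ae_of_ae_prod (ae_norm_le_norm_linfty G))] with z h1 h2
  have hG : AEStronglyMeasurable fun η => G (z.1, η) :=
    ((Lp.stronglyMeasurable G).measurable.comp measurable_prodMk_left).aestronglyMeasurable
  refine weighted_opK_eq (c := ‖G‖) he hB₀ hγ₀ hγ₁ hα₀ hα₁ (x := z.1) (hG.congr ?_) ?_ z.2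
  · filter_upwards [h1] with η hη
    exact hη.symm
  · filter_upwards [h1, h2] with η hη hb
    rwa [hη]

end Boltzmann

end

theorem lemma5p1
    (Ω : Set Boltzmann.E3) (hΩ_open : IsOpen Ω) (hΩ_convex : Convex ℝ Ω)
    (hΩ_bdd : Bornology.IsBounded Ω)
    (B₀ γ α : ℝ) (hB₀ : 0 < B₀) (hγ₀ : 0 ≤ γ) (hγ₁ : γ ≤ 1) (hα₀ : 0 ≤ α) (hα₁ : α < 1 / 2)
    (e₂ e₃ : Boltzmann.E3 → Boltzmann.E3) (he : Boltzmann.IsCollisionFrame e₂ e₃) :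
    ∃ S K : Boltzmann.LinftyW Ω α →L[ℝ] Boltzmann.LinftyW Ω α,
      Boltzmann.IsGivenBy S (Boltzmann.opS Ω B₀ γ) ∧
      Boltzmann.IsGivenBy K (Boltzmann.opK e₂ e₃ B₀ γ) ∧
      IsCompactOperator ((S.comp K).comp (S.comp K)) := by
  have hν := Boltzmann.measurable_collisionFreq B₀ γ
  have hν₀ : 0 < Boltzmann.collisionFreq B₀ γ 0 / 2 :=
    half_pos (Boltzmann.collisionFreq_zero_pos hB₀ hγ₀)
  have hνν₀ := Boltzmann.collisionFreq_ge hB₀.le hγ₀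
  have hS := Boltzmann.isAdmissible_transport hΩ_open.measurableSet hν
    (measurable_const (a := (1 : ℝ))) (inv_pos.2 hν₀).le fun x _ ζ =>
      Boltzmann.lintegral_transportKernel_le hν₀ hνν₀ (χ := fun _ => 1) (by simp) x ζ
  obtain ⟨D, hD, hb⟩ := Boltzmann.exists_lintegral_collisionKernel_le hB₀.le hγ₀ hγ₁ hα₀ hα₁
  have hk := Boltzmann.measurable_collisionKernel B₀ γ α
  refine ⟨Boltzmann.conjWeight α hS.toCLM,
    Boltzmann.conjWeight α (Boltzmann.isAdmissible_velocity Ω hk hD hb).toCLM,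
    Boltzmann.isGivenBy_opS hΩ_open.measurableSet hΩ_convex hΩ_bdd α hS,
    Boltzmann.isGivenBy_opK he hB₀.le hγ₀ hγ₁ hα₀ hα₁ _, ?_⟩
  rw [Boltzmann.conjWeight_comp, Boltzmann.conjWeight_comp]
  exact Boltzmann.isCompactOperator_conjWeight α
    (Boltzmann.isCompactOperator_transport_velocity_sq hΩ_open.measurableSet hΩ_bdd hν hν₀ hνν₀
      hS hk hD hb (Boltzmann.tendsto_lintegral_collisionKernel hB₀.le hγ₀ hγ₁ hα₀ hα₁))
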